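/- Let $k$ be a field, let $t\ge 1$ and $n_1,\dots,n_t\ge 1$, and let $X=\mathbb P^{n_1}_k\times\cdots\times\mathbb P^{n_t}_k$. Let $S=k[x_{i,j} : 1\le i\le t,\ 0\le j\le n_i]$ be its Cox ring, graded by $\operatorname{Cl}(X)=\mathbb Z^t$ with $\deg x_{i,j}=\epsilon_i$ (the $i$-th unit vector), and let $B=\bigcap_i (x_{i,0},\dots,x_{i,n_i})$ be the irrelevant ideal. Let $E=\Lambda_k(e_{i,j})$ be the exterior algebra, graded by $\mathbb Z^t\oplus\mathbb Z$ with $\deg e_{i,j}=(-\epsilon_i;-1)$, let $\mathfrak m$ be the ideal generated by the $e_{i,j}$, and let $\omega_E=\operatorname{Hom}_k(E,k)$. All $E$-modules are right modules. A differential $E$-module is a $\mathbb Z^t\oplus\mathbb Z$-graded $E$-module with a square-zero endomorphism $\partial$ of degree $(0;-1)$; morphisms have degree $0$ and commute with $\partial$. For a $\mathbb Z^t$-graded $S$-module $M$, let $\mathbf R(M)=\bigoplus_{a} M_a\otimes_k\omega_E(-a;0)$, with differential $m\otimes f\mapsto\sum_{i,j} x_{i,j}m\otimes e_{i,j}f$.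 For $a\in\mathbb Z^t$ write $|a|=\sum_i a_i$, and order $\mathbb Z^t$ coordinatewise. Let $\mathcal F$ be a coherent sheaf on $X$, so $\mathcal F=\widetilde P$ for a finitely generated graded $S$-module $P$. Consider the following properties of a differential $E$-module $T$. 1. $T$ is free (as a graded $E$-module) and minimal, that is, $\partial T\subseteq T\mathfrak m$. 2. For all $a\in\mathbb Z^t$ and $j\in\mathbb Z$ there are $k$-linear isomorphisms $\theta_{a,j}\colon H^j(X,\mathcal F(a))\cong\underline{\operatorname{Hom}}_E(k,T)_{(a;-j)}$; the right side is the set of elements of $T$ of degree $(a;-j)$ annihilated by $\mathfrak m$. 3. With the identifications of (2): for every graded $S$-module $M$ with $\widetilde M=\mathcal F$ and $H^0_B(M)=0$, the injection $M\hookrightarrow\bigoplus_a H^0(X,\mathcal F(a))$ induces an embedding $\mathbf R(M)\hookrightarrow T$ of differential $E$-modules; that is, there is such an embedding which on the elements $m\otimes 1^*$, for $m\in M_a$ and $1^*\in\omega_E$ the form dual to $1\in E$, is $\theta_{a,0}$ composed with $M_a\to H^0(X,\mathcal F(a))$. 4. For every set $I$ of variables such that $B\subseteq\langle x_v : v\in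 I\rangle$, the differential module $T\otimes_E E/\langle e_v : v\notin I\rangle$ is exact. The Tate resolution $\mathbf T_{\mathrm{EES}}(\mathcal F)$ of Eisenbud, Erman and Schreyer is the minimal complex $C$ of free $\mathbb Z^t$-graded $E$-modules that is the inverse limit of the minimal free resolutions of the complexes $\mathbf R(P_{\ge c})$, $c\gg0$. Precisely: here $P_{\ge c}=\bigoplus_{a\ge c}P_a$; the complex $\mathbf R(P_{\ge c})$ has the term $\bigoplus_{a\ge c,\ |a|=-j}P_a\otimes_k\omega_E(-a)$ in homological degree $j$, with the differential above. For a complex $C$ of free modules let $C_{<c}$ be its quotient complex formed by the summands $\omega_E(-a)$ with $a_i<c_i$ for all $i$. Then $C$ is a Tate resolution of $\mathcal F$ if it is minimal and free and there are $c_0\in\mathbb Z^t$ and, for all $c\ge c_0$, chain maps $\varepsilon_c\colon C_{<c}[t]\to\mathbf R(P_{\ge c})$, where $(C_{<c}[t])_j=(C_{<c})_{j+t}$, which are minimal free resolutions and such that, for $c_0\le c\le c'$, the projection $C_{<c'}\to C_{<c}$ and the inclusion $\mathbf R(P_{\ge c'})\subseteq\mathbf R(P_{\ge c})$ are compatible with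 $\varepsilon_{c'}$ and $\varepsilon_c$ up to homotopy. The folding of a complex $C$ of $\mathbb Z^t$-graded $E$-modules is the differential module $\operatorname{Fold}(C)=\bigoplus_j C_j$ with $\operatorname{Fold}(C)_{(a;b)}=(C_{b-|a|})_a$ and the differential of $C$. **Theorem.** Let $T$ be a differential $E$-module with properties (1)–(4). Then a Tate resolution of $\mathcal F$ in the sense of Eisenbud, Erman and Schreyer exists, and for every such complex $C$ there is an isomorphism of differential $E$-modules $T\cong\operatorname{Fold}(C)$; that is, $T\cong\operatorname{Fold}(\mathbf T_{\mathrm{EES}}(\mathcal F))$. In particular, any two differential $E$-modules with properties (1)–(4) for $\mathcal F$ are isomorphic. -/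

import Mathlib

open scoped TensorProduct DirectSum
open MulOpposite

universe u

set_option linter.unusedSectionVars false

namespace ToricTate

/-! ### Degrees, variables, the Cox ring and the exterior algebra -/

/-- The class group `ℤ^t` of a product of `t` projective spaces. -/
abbrev Deg (t : ℕ) := Fin t → ℤ

/-- `|a| = a_1 + ⋯ + a_t`. -/
def total {t : ℕ} (a : Deg t) : ℤ := ∑ i, a i

/-- The homogeneous coordinates of `ℙ^{n_1} × ⋯ × ℙ^{n_t}`. -/
abbrev Var {t : ℕ} (n : Fin t → ℕ) := Σ i : Fin t, Fin (n i + 1)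

/-- The degree of a coordinate of the `i`-th factor: the `i`-th unit vector. -/
def varDeg {t : ℕ} {n : Fin t → ℕ} (v : Var n) : Deg t := Pi.single v.1 1

/-- The degree of `x_v` in `ℤ^t ⊕ ℤ`; the exterior variable `e_v` has the opposite degree. -/
def bigDeg {t : ℕ} {n : Fin t → ℕ} (v : Var n) : Deg t × ℤ := (varDeg v, 1)

/-- The Cox ring `S`. -/
abbrev Cox (k : Type u) [Field k] {t : ℕ} (n : Fin t → ℕ) := MvPolynomial (Var n) k

/-- The exterior algebra `E`. -/
abbrev Ext (k : Type u) [Field k] {t : ℕ} (n : Fin t → ℕ) := ExteriorAlgebra k (Var n → k)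

/-- The exterior variable `e_v`. -/
noncomputable def e (k : Type u) [Field k] {t : ℕ} {n : Fin t → ℕ} (v : Var n) : Ext k n :=
  ExteriorAlgebra.ι k (Pi.single v 1)

/-! ### Internal direct sums -/

section Internal

variable {k : Type u} [Field k] {G : Type*} [DecidableEq G]
  {X : Type*} [AddCommGroup X] [Module k X] {deg : G → Submodule k X}

/-- The projection onto a homogeneous component. -/
noncomputable def proj (h : DirectSum.IsInternal deg) (g : G) : X →ₗ[k] X :=
  (deg g).subtype ∘ₗ DirectSum.component k G (fun g => deg g) g ∘ₗ
    (LinearEquiv.ofBijective (DirectSum.coeLinearMap deg) h).symm.toLinearMap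

theorem proj_mem (h : DirectSum.IsInternal deg) (g : G) (x : X) : proj h g x ∈ deg g := by
  simp [proj]

theorem proj_symm_of (h : DirectSum.IsInternal deg) {g : G} {x : X} (hx : x ∈ deg g) :
    (LinearEquiv.ofBijective (DirectSum.coeLinearMap deg) h).symm x =
      DirectSum.lof k G (fun g => deg g) g ⟨x, hx⟩ := by
  rw [LinearEquiv.symm_apply_eq]
  exact (DirectSum.coeLinearMap_lof deg g ⟨x, hx⟩).symm

theorem proj_self (h : DirectSum.IsInternal deg) {g : G} {x : X} (hx : x ∈ deg g) :
    proj h g x = x := by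
  simp [proj, proj_symm_of h hx, DirectSum.component.lof_self]

theorem proj_ne (h : DirectSum.IsInternal deg) {g g' : G} {x : X} (hx : x ∈ deg g')
    (hg : g' ≠ g) : proj h g x = 0 := by
  simp [proj, proj_symm_of h hx, DirectSum.component.of, hg]

theorem internal_of_proj (p : G → X →ₗ[k] X) (h1 : ∀ g, ∀ x ∈ deg g, p g x = x)
    (h0 : ∀ g g', g' ≠ g → ∀ x ∈ deg g', p g x = 0) (ht : ⨆ g, deg g = ⊤) :
    DirectSum.IsInternal deg := by
  refine DirectSum.isInternal_submodule_of_iSupIndep_of_iSup_eq_top ?_ ht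
  intro g
  rw [Submodule.disjoint_def]
  intro x hx hx'
  have : (⨆ j, ⨆ (_ : j ≠ g), deg j) ≤ LinearMap.ker (p g) :=
    iSup₂_le fun j hj y hy => h0 g j hj y hy
  rw [← h1 g x hx]
  exact this hx'

end Internal

/-! ### The grading of `E` and of `ω_E` -/

section Gradings

variable (k : Type u) [Field k] {t : ℕ} (n : Fin t → ℕ) {G : Type} [AddCommGroup G]
  [DecidableEq G] (w : Var n → G)

/-- The component of degree `g` of `E`, where `e_v` has degree `-w v`. -/
def extDeg (g : G) : Submodule k (Ext k n) :=
  Submodule.span k {x | ∃ l : List (Var n), x = (l.map (e k)).prod ∧ g = -(l.map w).sum}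

/-- `ω_E = Hom_k(E, k)`. -/
def Omega : Type u := Module.Dual k (Ext k n)

noncomputable instance : AddCommGroup (Omega k n) :=
  inferInstanceAs (AddCommGroup (Module.Dual k (Ext k n)))
noncomputable instance : Module k (Omega k n) :=
  inferInstanceAs (Module k (Module.Dual k (Ext k n)))

variable {k n} in
/-- A linear form on `E` seen as an element of `ω_E`. -/
def Omega.mk (f : Ext k n →ₗ[k] k) : Omega k n := f

variable {k n} in
/-- The linear form underlying an element of `ω_E`. -/
def Omega.fn (f : Omega k n) : Ext k n →ₗ[k] k := f

/-- The right `E`-module structure of `ω_E`: `(f · e)(x) = f (e x)`. -/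
noncomputable instance : Module (Ext k n)ᵐᵒᵖ (Omega k n) where
  smul r f := Omega.mk (f.fn ∘ₗ LinearMap.mulLeft k r.unop)
  one_smul f := by
    refine LinearMap.ext fun x => ?_
    change f.fn (1 * x) = f.fn x
    rw [one_mul]
  mul_smul r s f := by
    refine LinearMap.ext fun x => ?_
    change f.fn ((s.unop * r.unop) * x) = f.fn (s.unop * (r.unop * x))
    rw [mul_assoc]
  smul_zero r := rfl
  smul_add r f g := rfl
  add_smul r s f := by
    refine LinearMap.ext fun x => ?_
    change f.fn ((r.unop + s.unop) * x) = f.fn (r.unop * x) + f.fn (s.unop * x)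
    rw [add_mul, map_add]
  zero_smul f := by
    refine LinearMap.ext fun x => ?_
    change f.fn (0 * x) = 0
    rw [zero_mul, map_zero]

theorem Omega.smul_fn (r : (Ext k n)ᵐᵒᵖ) (f : Omega k n) (x : Ext k n) :
    (r • f).fn x = f.fn (r.unop * x) := rfl

instance : IsScalarTower k (Ext k n)ᵐᵒᵖ (Omega k n) where
  smul_assoc c r f := by
    refine LinearMap.ext fun x => ?_
    change f.fn ((c • r.unop) * x) = c • f.fn (r.unop * x)
    rw [smul_mul_assoc, map_smul]

/-- The component of degree `g` of `ω_E`: the forms that vanish on `E_h` for all `h ≠ -g`. -/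
def omegaDeg (g : G) : Submodule k (Omega k n) where
  carrier := {f | ∀ h, h ≠ -g → ∀ x ∈ extDeg k n w h, f.fn x = 0}
  add_mem' {f f'} hf hf' h hh x hx := by
    change f.fn x + f'.fn x = 0
    rw [hf h hh x hx, hf' h hh x hx, add_zero]
  zero_mem' _ _ _ _ := rfl
  smul_mem' c f hf h hh x hx := by
    change c • f.fn x = 0
    rw [hf h hh x hx, smul_zero]

/-- Left multiplication by `e_v` on `ω_E`, `(e_v f)(x) = f (x e_v)`; it is right `E`-linear. -/
noncomputable def omegaLeft (v : Var n) : Omega k n →ₗ[(Ext k n)ᵐᵒᵖ] Omega k n where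
  toFun f := Omega.mk (f.fn ∘ₗ LinearMap.mulRight k (e k v))
  map_add' _ _ := rfl
  map_smul' r f := by
    refine LinearMap.ext fun x => ?_
    change f.fn (r.unop * (x * e k v)) = f.fn ((r.unop * x) * e k v)
    rw [mul_assoc]

/-- The socle element of `ω_E`: the form dual to `1 ∈ E`. -/
noncomputable def oneDual : Omega k n :=
  Omega.mk (ExteriorAlgebra.algebraMapInv (R := k)).toLinearMap

variable {k n}

theorem e_mul_self (v : Var n) : e k v * e k v = 0 := ExteriorAlgebra.ι_sq_zero _

theorem e_mul_swap (v v' : Var n) : e k v * e k v' + e k v' * e k v = 0 :=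
  ExteriorAlgebra.ι_add_mul_swap _ _

/-- A doubly indexed sum that is alternating vanishes. -/
theorem sum_alternating {ι N : Type*} [Fintype ι] [AddCommGroup N] (F : ι → ι → N)
    (h0 : ∀ i, F i i = 0) (h1 : ∀ i j, F i j + F j i = 0) : ∑ i, ∑ j, F i j = 0 := by
  classical
  rw [← Fintype.sum_prod_type']
  refine Finset.sum_involution (fun p _ => (p.2, p.1)) ?_ ?_ ?_ ?_
  · intro p _; exact h1 _ _
  · intro p _ hp heq
    apply hp
    have : p.2 = p.1 := congrArg Prod.fst heq
    rw [this]; exact h0 _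
  · intro p _; exact Finset.mem_univ _
  · intro p _; rfl

theorem ι_eq_sum (m : Var n → k) : ExteriorAlgebra.ι k m = ∑ v, m v • e k v := by
  conv_lhs => rw [← Finset.univ_sum_single m]
  rw [map_sum]
  refine Finset.sum_congr rfl fun v _ => ?_
  rw [e, ← map_smul]
  congr 1
  ext v'
  by_cases h : v' = v
  · subst h; simp
  · simp [h]

/-- The coaction `E → E[G]`, sending `e_v` to `e_v` placed in degree `-w v`. -/
noncomputable def coact : Ext k n →ₐ[k] AddMonoidAlgebra (Ext k n) G :=
  ExteriorAlgebra.lift k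
    ⟨∑ v, (AddMonoidAlgebra.lsingle (-w v) : Ext k n →ₗ[k] AddMonoidAlgebra (Ext k n) G) ∘ₗ
        (LinearMap.toSpanSingleton k _ (e k v)) ∘ₗ LinearMap.proj v, by
      intro m
      simp only [LinearMap.sum_apply]
      rw [Finset.sum_mul_sum]
      refine sum_alternating _ ?_ ?_
      · intro v
        simp [AddMonoidAlgebra.single_mul_single, e_mul_self]
      · intro v v'
        simp only [LinearMap.comp_apply, LinearMap.proj_apply, LinearMap.toSpanSingleton_apply,
          AddMonoidAlgebra.lsingle_apply, AddMonoidAlgebra.single_mul_single,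
          smul_mul_smul_comm]
        rw [add_comm (-w v') (-w v), ← AddMonoidAlgebra.single_add, mul_comm (m v') (m v),
          ← smul_add, e_mul_swap, smul_zero, AddMonoidAlgebra.single_zero]⟩

/-- The homogeneous component of degree `g` of an element of `E`. -/
noncomputable def extProj (g : G) : Ext k n →ₗ[k] Ext k n :=
  Finsupp.lapply g ∘ₗ (AddMonoidAlgebra.coeffLinearEquiv k).toLinearMap ∘ₗ
    (coact (k := k) w).toLinearMap

theorem coact_e (v : Var n) : coact (k := k) w (e k v) = AddMonoidAlgebra.single (-w v) (e k v) := by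
  rw [coact, e, ExteriorAlgebra.lift_ι_apply, LinearMap.sum_apply, Finset.sum_eq_single v]
  · simp [e]
  · intro v' _ hv
    simp [hv]
  · simp

theorem coact_list (l : List (Var n)) : coact (k := k) w (l.map (e k)).prod =
    AddMonoidAlgebra.single (-(l.map w).sum) (l.map (e k)).prod := by
  induction l with
  | nil => simp [AddMonoidAlgebra.one_def]
  | cons v l ih =>
    simp only [List.map_cons, List.prod_cons, List.sum_cons, map_mul, coact_e, ih,
      AddMonoidAlgebra.single_mul_single, neg_add]

theorem extProj_list (g : G) (l : List (Var n)) : extProj (k := k) w g (l.map (e k)).prod =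
    if -(l.map w).sum = g then (l.map (e k)).prod else 0 := by
  simp only [extProj, LinearMap.comp_apply, AlgHom.toLinearMap_apply, coact_list]
  simp [Finsupp.single_apply]

theorem extProj_same (g : G) (x : Ext k n) (hx : x ∈ extDeg k n w g) : extProj w g x = x := by
  induction hx using Submodule.span_induction with
  | mem x h => obtain ⟨l, rfl, rfl⟩ := h; simp [extProj_list]
  | zero => simp
  | add x y _ _ hx hy => rw [map_add, hx, hy]
  | smul c x _ hx => rw [map_smul, hx]

theorem extProj_ne (g g' : G) (hg : g' ≠ g) (x : Ext k n) (hx : x ∈ extDeg k n w g') :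
    extProj w g x = 0 := by
  induction hx using Submodule.span_induction with
  | mem x h => obtain ⟨l, rfl, rfl⟩ := h; simp [extProj_list, hg]
  | zero => simp
  | add x y _ _ hx hy => rw [map_add, hx, hy, add_zero]
  | smul c x _ hx => rw [map_smul, hx, smul_zero]

theorem span_list : Submodule.span k {x : Ext k n | ∃ l : List (Var n), x = (l.map (e k)).prod} = ⊤ := by
  rw [eq_top_iff]
  rintro x -
  induction x using ExteriorAlgebra.induction with
  | algebraMap r =>
    rw [Algebra.algebraMap_eq_smul_one]
    exact Submodule.smul_mem _ _ (Submodule.subset_span ⟨[], by simp⟩)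
  | ι m =>
    rw [ι_eq_sum]
    exact Submodule.sum_mem _ fun v _ =>
      Submodule.smul_mem _ _ (Submodule.subset_span ⟨[v], by simp⟩)
  | mul x y hx hy =>
    induction hx using Submodule.span_induction with
    | zero => simp
    | add a b _ _ ha hb => rw [add_mul]; exact Submodule.add_mem _ ha hb
    | smul c a _ ha => rw [smul_mul_assoc]; exact Submodule.smul_mem _ _ ha
    | mem a h =>
      obtain ⟨l, rfl⟩ := h
      induction hy using Submodule.span_induction with
      | zero => simp
      | add a b _ _ ha hb => rw [mul_add]; exact Submodule.add_mem _ ha hb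
      | smul c a _ ha => rw [mul_smul_comm]; exact Submodule.smul_mem _ _ ha
      | mem a h =>
        obtain ⟨l', rfl⟩ := h
        exact Submodule.subset_span ⟨l ++ l', by simp⟩
  | add x y hx hy => exact Submodule.add_mem _ hx hy

theorem ext_internal : DirectSum.IsInternal (extDeg k n w) := by
  refine internal_of_proj (extProj w) (extProj_same w) (extProj_ne w) ?_
  rw [eq_top_iff, ← span_list, Submodule.span_le]
  rintro x ⟨l, rfl⟩
  exact Submodule.mem_iSup_of_mem (-(l.map w).sum) (Submodule.subset_span ⟨l, rfl, rfl⟩)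

theorem extProj_mem (g : G) (x : Ext k n) : extProj w g x ∈ extDeg k n w g := by
  have hx : x ∈ Submodule.span k {x : Ext k n | ∃ l : List (Var n), x = (l.map (e k)).prod} := by
    rw [span_list]; trivial
  induction hx using Submodule.span_induction with
  | mem x h =>
    obtain ⟨l, rfl⟩ := h
    rw [extProj_list]
    split_ifs with h
    · exact Submodule.subset_span ⟨l, rfl, h.symm⟩
    · exact Submodule.zero_mem _
  | zero => simp
  | add x y _ _ hx hy => rw [map_add]; exact Submodule.add_mem _ hx hy
  | smul c x _ hx => rw [map_smul]; exact Submodule.smul_mem _ _ hx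

theorem sum_extProj (x : Ext k n) : ∃ s : Finset G, ∀ s', s ⊆ s' → ∑ g ∈ s', extProj w g x = x := by
  have hx : x ∈ Submodule.span k {x : Ext k n | ∃ l : List (Var n), x = (l.map (e k)).prod} := by
    rw [span_list]; trivial
  induction hx using Submodule.span_induction with
  | mem x h =>
    obtain ⟨l, rfl⟩ := h
    refine ⟨{-(l.map w).sum}, fun s' hs => ?_⟩
    rw [Finset.singleton_subset_iff] at hs
    simp [extProj_list, hs]
  | zero => exact ⟨∅, by simp⟩
  | add x y _ _ hx hy =>
    obtain ⟨s, hs⟩ := hx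
    obtain ⟨s', hs'⟩ := hy
    refine ⟨s ∪ s', fun r hr => ?_⟩
    simp only [map_add, Finset.sum_add_distrib]
    rw [hs r (Finset.union_subset_left hr), hs' r (Finset.union_subset_right hr)]
  | smul c x _ hx =>
    obtain ⟨s, hs⟩ := hx
    refine ⟨s, fun r hr => ?_⟩
    simp only [map_smul]
    rw [← Finset.smul_sum, hs r hr]

instance ext_finite : Module.Finite k (Ext k n) := by
  let ε := Fintype.equivFin (Var n)
  exact Module.Finite.of_basis (((Pi.basisFun k (Var n)).reindex ε).ExteriorAlgebra)

/-- The homogeneous component of degree `g` of an element of `ω_E`. -/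
noncomputable def omegaProj (g : G) : Omega k n →ₗ[k] Omega k n where
  toFun f := Omega.mk (f.fn ∘ₗ extProj w (-g))
  map_add' _ _ := rfl
  map_smul' _ _ := rfl

theorem omegaProj_mem (g : G) (f : Omega k n) : omegaProj w g f ∈ omegaDeg k n w g := by
  intro h hh x hx
  change f.fn (extProj w (-g) x) = 0
  rw [extProj_ne w _ _ hh x hx, map_zero]

theorem sum_omegaProj (f : Omega k n) : ∃ s : Finset G, ∑ g ∈ s, omegaProj w g f = f := by
  classical
  obtain ⟨b, hb⟩ := (ext_finite (k := k) (n := n)).fg_top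
  choose s hs using sum_extProj (k := k) (n := n) w
  refine ⟨(b.biUnion s).image (fun g => -g), ?_⟩
  refine LinearMap.ext_on (s := (b : Set (Ext k n))) (by rw [hb]) fun x hx => ?_
  have h1 : ∀ r : Finset G, Omega.fn (∑ g ∈ r, omegaProj w g f) x = f.fn (∑ g ∈ r, extProj w (-g) x) := by
    intro r
    induction r using Finset.induction_on with
    | empty => simp only [Finset.sum_empty, map_zero]; rfl
    | insert g r hg ih =>
      rw [Finset.sum_insert hg, Finset.sum_insert hg, map_add, ← ih]; rfl
  have h2 : ∑ g ∈ (b.biUnion s).image (fun g => -g), extProj w (-g) x = x := by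
    rw [Finset.sum_image (by simp)]
    simp only [neg_neg]
    exact hs x _ (Finset.subset_biUnion_of_mem s (Finset.mem_coe.mp hx))
  exact (h1 _).trans (congrArg f.fn h2)

theorem omegaProj_same (g : G) (f : Omega k n) (hf : f ∈ omegaDeg k n w g) : omegaProj w g f = f := by
  refine LinearMap.ext fun x => ?_
  change f.fn (extProj w (-g) x) = f.fn x
  obtain ⟨s, hs⟩ := sum_extProj (k := k) w x
  conv_rhs => rw [← hs (insert (-g) s) (Finset.subset_insert _ _)]
  rw [map_sum, Finset.sum_eq_single_of_mem (-g) (Finset.mem_insert_self _ _)]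
  intro h _ hh
  exact hf h hh _ (extProj_mem w _ _)

theorem omegaProj_ne (g g' : G) (hg : g' ≠ g) (f : Omega k n) (hf : f ∈ omegaDeg k n w g') :
    omegaProj w g f = 0 := by
  refine LinearMap.ext fun x => ?_
  exact hf (-g) (fun h => hg (neg_injective h).symm) _ (extProj_mem w _ _)

theorem omega_iSup : ⨆ g, omegaDeg k n w g = ⊤ := by
  rw [eq_top_iff]
  rintro f -
  obtain ⟨s, hs⟩ := sum_omegaProj w f
  rw [← hs]
  exact Submodule.sum_mem _ fun g _ => Submodule.mem_iSup_of_mem g (omegaProj_mem w g f)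

theorem mul_e_mem (v : Var n) (g : G) (x : Ext k n) (hx : x ∈ extDeg k n w g) :
    x * e k v ∈ extDeg k n w (g - w v) ∧ e k v * x ∈ extDeg k n w (g - w v) := by
  induction hx using Submodule.span_induction with
  | mem x h =>
    obtain ⟨l, rfl, rfl⟩ := h
    refine ⟨Submodule.subset_span ⟨l ++ [v], by simp, ?_⟩,
      Submodule.subset_span ⟨v :: l, by simp, ?_⟩⟩ <;> simp <;> abel
  | zero => simp
  | add x y _ _ hx hy =>
    rw [add_mul, mul_add]
    exact ⟨Submodule.add_mem _ hx.1 hy.1, Submodule.add_mem _ hx.2 hy.2⟩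
  | smul c x _ hx =>
    rw [smul_mul_assoc, mul_smul_comm]
    exact ⟨Submodule.smul_mem _ _ hx.1, Submodule.smul_mem _ _ hx.2⟩

theorem omega_act (v : Var n) (g : G) (f : Omega k n) (hf : f ∈ omegaDeg k n w g) :
    op (e k v) • f ∈ omegaDeg k n w (g - w v) := by
  intro h hh x hx
  refine hf (h - w v) (fun h' => hh ?_) _ (mul_e_mem w v h x hx).2
  rw [sub_eq_iff_eq_add] at h'
  rw [h']; abel

theorem omegaLeft_mem (v : Var n) (g : G) (f : Omega k n) (hf : f ∈ omegaDeg k n w g) :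
    omegaLeft k n v f ∈ omegaDeg k n w (g - w v) := by
  intro h hh x hx
  refine hf (h - w v) (fun h' => hh ?_) _ (mul_e_mem w v h x hx).1
  rw [sub_eq_iff_eq_add] at h'
  rw [h']; abel

end Gradings

/-! ### Graded right `E`-modules -/

/-- A right `E`-module graded by `G`, where `e_v` has degree `-w v`.  Right `E`-modules are modules
over the opposite ring, so `op r • x` is `x · r`. -/
structure GrMod (k : Type u) [Field k] {t : ℕ} (n : Fin t → ℕ) {G : Type} [AddCommGroup G]
    [DecidableEq G] (w : Var n → G) where
  carrier : Type u
  [addCommGroup : AddCommGroup carrier]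
  [moduleK : Module k carrier]
  [moduleE : Module (Ext k n)ᵐᵒᵖ carrier]
  [tower : IsScalarTower k (Ext k n)ᵐᵒᵖ carrier]
  deg : G → Submodule k carrier
  internal : DirectSum.IsInternal deg
  act_mem : ∀ v g x, x ∈ deg g → op (e k v) • x ∈ deg (g - w v)

namespace GrMod

variable {k : Type u} [Field k] {t : ℕ} {n : Fin t → ℕ} {G : Type} [AddCommGroup G]
  [DecidableEq G] {w : Var n → G}

instance : CoeSort (GrMod k n w) (Type u) := ⟨carrier⟩

attribute [instance] addCommGroup moduleK moduleE tower

/-- A graded module is free if it has a basis of homogeneous elements. -/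
def IsFree (X : GrMod k n w) : Prop :=
  ∃ (ι : Type u) (b : Module.Basis ι (Ext k n)ᵐᵒᵖ X), ∀ i, ∃ g, b i ∈ X.deg g

/-- The submodule `X · ⟨e_v : v ∈ J⟩`. -/
def idealMul (X : GrMod k n w) (J : Set (Var n)) : Submodule (Ext k n)ᵐᵒᵖ X :=
  Submodule.span _ {y | ∃ v ∈ J, ∃ x : X, y = op (e k v) • x}

/-- `X · 𝔪`, where `𝔪` is the ideal of `E` generated by all exterior variables. -/
def maxMul (X : GrMod k n w) : Submodule (Ext k n)ᵐᵒᵖ X := X.idealMul Set.univ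

/-- The component of degree `g` of `Hom_E(k, X)`: the homogeneous elements of degree `g` that are
killed by all exterior variables. -/
def socle (X : GrMod k n w) (g : G) : Submodule k X where
  carrier := {x | x ∈ X.deg g ∧ ∀ v : Var n, op (e k v) • x = 0}
  add_mem' hx hy := ⟨Submodule.add_mem _ hx.1 hy.1, fun v => by
    rw [smul_add, hx.2, hy.2, add_zero]⟩
  zero_mem' := ⟨Submodule.zero_mem _, fun v => smul_zero (op (e k v))⟩
  smul_mem' c x hx := ⟨Submodule.smul_mem _ _ hx.1, fun v => by
    rw [← algebraMap_smul (Ext k n)ᵐᵒᵖ c x, ← mul_smul, ← Algebra.commutes, mul_smul, hx.2,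
      smul_zero]⟩

/-- A `k`-subspace stable under the exterior variables is stable under `E`. -/
theorem smul_mem_of_act (X : GrMod k n w) (N : Submodule k X)
    (hN : ∀ v : Var n, ∀ x ∈ N, op (e k v) • x ∈ N) (r : Ext k n) (x : X) (hx : x ∈ N) : op r • x ∈ N := by
  induction r using ExteriorAlgebra.induction generalizing x with
  | algebraMap c =>
    rw [← MulOpposite.algebraMap_apply, algebraMap_smul]
    exact Submodule.smul_mem _ _ hx
  | ι m =>
    rw [ι_eq_sum, Finset.op_sum, Finset.sum_smul]
    refine Submodule.sum_mem _ fun v _ => ?_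
    rw [op_smul, smul_assoc]
    exact Submodule.smul_mem _ _ (hN v x hx)
  | mul a b ha hb =>
    rw [op_mul, mul_smul]
    exact hb _ (ha x hx)
  | add a b ha hb =>
    rw [op_add, add_smul]
    exact Submodule.add_mem _ (ha x hx) (hb x hx)

theorem smul_deg_mem (X : GrMod k n w) (N : Submodule (Ext k n)ᵐᵒᵖ X) (c : k) (x : X) (hx : x ∈ N) :
    c • x ∈ N := by
  rw [← algebraMap_smul (Ext k n)ᵐᵒᵖ c x]
  exact Submodule.smul_mem _ _ hx

/-- A submodule generated by homogeneous elements contains the components of its elements. -/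
theorem span_homogeneous (X : GrMod k n w) (s : Set X) (hs : ∀ x ∈ s, ∃ g, x ∈ X.deg g) (g : G)
    (x : X) (hx : x ∈ Submodule.span (Ext k n)ᵐᵒᵖ s) :
    proj X.internal g x ∈ Submodule.span (Ext k n)ᵐᵒᵖ s := by
  set N := Submodule.span (Ext k n)ᵐᵒᵖ s with hN
  let H : Submodule k X := Submodule.span k {y | y ∈ N ∧ ∃ g, y ∈ X.deg g}
  have hact : ∀ v : Var n, ∀ y ∈ H, op (e k v) • y ∈ H := by
    intro v y hy
    induction hy using Submodule.span_induction with
    | mem y h =>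
      obtain ⟨h1, g, h2⟩ := h
      exact Submodule.subset_span ⟨Submodule.smul_mem _ _ h1, _, X.act_mem v g y h2⟩
    | zero => rw [smul_zero]; exact Submodule.zero_mem _
    | add y z _ _ hy hz => rw [smul_add]; exact Submodule.add_mem _ hy hz
    | smul c y _ hy =>
      rw [← algebraMap_smul (Ext k n)ᵐᵒᵖ c y, ← mul_smul, ← Algebra.commutes, mul_smul,
        algebraMap_smul]
      exact Submodule.smul_mem _ _ hy
  have hle : ∀ y ∈ N, y ∈ H := by
    intro y hy
    induction hy using Submodule.span_induction with
    | mem y h => exact Submodule.subset_span ⟨Submodule.subset_span h, hs y h⟩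
    | zero => exact Submodule.zero_mem _
    | add y z _ _ hy hz => exact Submodule.add_mem _ hy hz
    | smul r y _ hy => exact X.smul_mem_of_act H hact r.unop y hy
  have hx' := hle x hx
  clear hx
  induction hx' using Submodule.span_induction with
  | mem y h =>
    obtain ⟨h1, g', h2⟩ := h
    by_cases hg : g' = g
    · subst hg; rw [proj_self X.internal h2]; exact h1
    · rw [proj_ne X.internal h2 hg]; exact Submodule.zero_mem _
  | zero => rw [map_zero]; exact Submodule.zero_mem _
  | add y z _ _ hy hz => rw [map_add]; exact Submodule.add_mem _ hy hz
  | smul c y _ hy => rw [map_smul]; exact X.smul_deg_mem _ _ _ hy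

theorem exists_sum_proj (X : GrMod k n w) (x : X) : ∃ s : Finset G, ∑ g ∈ s, proj X.internal g x = x := by
  classical
  let y := (LinearEquiv.ofBijective (DirectSum.coeLinearMap X.deg) X.internal).symm x
  refine ⟨DFinsupp.support y, ?_⟩
  have h : DirectSum.coeLinearMap X.deg y = x :=
    (LinearEquiv.ofBijective (DirectSum.coeLinearMap X.deg) X.internal).apply_symm_apply x
  conv_rhs => rw [← h]
  rw [DirectSum.coeLinearMap_eq_dfinsuppSum]
  rfl

/-- The graded submodule generated by a set of homogeneous elements. -/
def sub (X : GrMod k n w) (s : Set X) (hs : ∀ x ∈ s, ∃ g, x ∈ X.deg g) : GrMod k n w where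
  carrier := Submodule.span (Ext k n)ᵐᵒᵖ s
  deg g := (X.deg g).comap ((Submodule.span (Ext k n)ᵐᵒᵖ s).subtype.restrictScalars k)
  internal := by
    refine internal_of_proj (fun g => ((proj X.internal g) ∘ₗ
      (Submodule.span (Ext k n)ᵐᵒᵖ s).subtype.restrictScalars k).codRestrict
        ((Submodule.span (Ext k n)ᵐᵒᵖ s).restrictScalars k)
        (fun x => X.span_homogeneous s hs g x x.2)) ?_ ?_ ?_
    · intro g x hx
      exact Subtype.ext (proj_self X.internal hx)
    · intro g g' hg x hx
      exact Subtype.ext (proj_ne X.internal hx hg)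
    · rw [eq_top_iff]
      rintro x -
      obtain ⟨f, hf⟩ := X.exists_sum_proj x
      have : x = ∑ g ∈ f, ⟨proj X.internal g x, X.span_homogeneous s hs g x x.2⟩ := by
        apply Subtype.ext
        rw [AddSubmonoidClass.coe_finsetSum]
        exact hf.symm
      rw [this]
      exact Submodule.sum_mem _ fun g _ => Submodule.mem_iSup_of_mem g (proj_mem X.internal g x)
  act_mem v g x hx := X.act_mem v g x hx

/-- The quotient by the graded submodule generated by a set of homogeneous elements. -/
def quot (X : GrMod k n w) (s : Set X) (hs : ∀ x ∈ s, ∃ g, x ∈ X.deg g) : GrMod k n w where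
  carrier := X ⧸ Submodule.span (Ext k n)ᵐᵒᵖ s
  deg g := (X.deg g).map ((Submodule.span (Ext k n)ᵐᵒᵖ s).mkQ.restrictScalars k)
  internal := by
    refine internal_of_proj (fun g =>
      Submodule.mapQ ((Submodule.span (Ext k n)ᵐᵒᵖ s).restrictScalars k)
        ((Submodule.span (Ext k n)ᵐᵒᵖ s).restrictScalars k) (proj X.internal g)
        (fun x hx => X.span_homogeneous s hs g x hx)) ?_ ?_ ?_
    · rintro g _ ⟨x, hx, rfl⟩
      exact congrArg (Submodule.span (Ext k n)ᵐᵒᵖ s).mkQ (proj_self X.internal hx)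
    · rintro g g' hg _ ⟨x, hx, rfl⟩
      exact (congrArg (Submodule.span (Ext k n)ᵐᵒᵖ s).mkQ (proj_ne X.internal hx hg)).trans
        (map_zero _)
    · rw [eq_top_iff]
      rintro x -
      obtain ⟨x, rfl⟩ := Submodule.mkQ_surjective _ x
      obtain ⟨f, hf⟩ := X.exists_sum_proj x
      rw [← hf, map_sum]
      exact Submodule.sum_mem _ fun g _ => Submodule.mem_iSup_of_mem g
        (Submodule.mem_map_of_mem (f := (Submodule.span (Ext k n)ᵐᵒᵖ s).mkQ.restrictScalars k)
          (proj_mem X.internal g x))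
  act_mem := by
    rintro v g _ ⟨x, hx, rfl⟩
    exact ⟨op (e k v) • x, X.act_mem v g x hx, rfl⟩

end GrMod

/-! ### Graded modules over the Cox ring -/

/-- A `ℤ^t`-graded module over the Cox ring. -/
structure GrSMod (k : Type u) [Field k] {t : ℕ} (n : Fin t → ℕ) where
  carrier : Type u
  [addCommGroup : AddCommGroup carrier]
  [moduleK : Module k carrier]
  [moduleS : Module (Cox k n) carrier]
  [tower : IsScalarTower k (Cox k n) carrier]
  deg : Deg t → Submodule k carrier
  internal : DirectSum.IsInternal deg
  X_mem : ∀ v a m, m ∈ deg a → (MvPolynomial.X v : Cox k n) • m ∈ deg (a + varDeg v)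

namespace GrSMod

variable {k : Type u} [Field k] {t : ℕ} {n : Fin t → ℕ}

instance : CoeSort (GrSMod k n) (Type u) := ⟨carrier⟩

attribute [instance] addCommGroup moduleK moduleS tower

/-- Multiplication by a variable. -/
noncomputable def mulX (M : GrSMod k n) (v : Var n) : M →ₗ[k] M :=
  (LinearMap.lsmul (Cox k n) M (MvPolynomial.X v)).restrictScalars k

section Koszul

variable {G : Type} [AddCommGroup G] [DecidableEq G] (w : Var n → G) (φ : Deg t →+ G)

/-- The component of degree `g` of `ω_E ⊗ M = ⨁_a ω_E(-φ a) ⊗ M_a`. -/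
noncomputable def koszulDeg (M : GrSMod k n) (g : G) : Submodule k (Omega k n ⊗[k] M) :=
  Submodule.span k {z | ∃ a, ∃ m ∈ M.deg a, ∃ f ∈ omegaDeg k n w (g - φ a), z = f ⊗ₜ[k] m}

/-- The projection of `ω_E ⊗ M` to its component of degree `g`. -/
noncomputable def koszulProj (M : GrSMod k n) (g : G) :
    Omega k n ⊗[k] M →ₗ[k] Omega k n ⊗[k] M :=
  TensorProduct.lift (LinearMap.flip
    (DirectSum.toModule k (Deg t) (Omega k n →ₗ[k] Omega k n ⊗[k] M)
      (fun a => LinearMap.lcomp k _ (omegaProj w (g - φ a)) ∘ₗ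
        (TensorProduct.mk k (Omega k n) M).flip ∘ₗ (M.deg a).subtype) ∘ₗ
      (LinearEquiv.ofBijective (DirectSum.coeLinearMap M.deg) M.internal).symm.toLinearMap))

theorem koszulProj_tmul (M : GrSMod k n) (g : G) (a : Deg t) (m : M) (hm : m ∈ M.deg a)
    (f : Omega k n) : koszulProj w φ M g (f ⊗ₜ m) = omegaProj w (g - φ a) f ⊗ₜ m := by
  simp only [koszulProj, TensorProduct.lift.tmul, LinearMap.flip_apply, LinearMap.comp_apply,
    LinearEquiv.coe_coe, proj_symm_of M.internal hm, DirectSum.toModule_lof]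
  rfl

/-- The graded right `E`-module `⨁_a ω_E(-φ a) ⊗ M_a`. -/
noncomputable def koszul (M : GrSMod k n) : GrMod k n w where
  carrier := Omega k n ⊗[k] M
  deg := koszulDeg w φ M
  internal := by
    refine internal_of_proj (koszulProj w φ M) ?_ ?_ ?_
    · intro g x hx
      induction hx using Submodule.span_induction with
      | mem x h =>
        obtain ⟨a, m, hm, f, hf, rfl⟩ := h
        rw [koszulProj_tmul w φ M g a m hm, omegaProj_same w _ f hf]
      | zero => simp
      | add x y _ _ hx hy => rw [map_add, hx, hy]
      | smul c x _ hx => rw [map_smul, hx]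
    · intro g g' hg x hx
      induction hx using Submodule.span_induction with
      | mem x h =>
        obtain ⟨a, m, hm, f, hf, rfl⟩ := h
        rw [koszulProj_tmul w φ M g a m hm,
          omegaProj_ne w _ _ (fun h => hg (sub_left_injective h)) f hf, TensorProduct.zero_tmul]
      | zero => simp
      | add x y _ _ hx hy => rw [map_add, hx, hy, add_zero]
      | smul c x _ hx => rw [map_smul, hx, smul_zero]
    · rw [eq_top_iff]
      rintro x -
      induction x using TensorProduct.induction_on with
      | zero => exact Submodule.zero_mem _
      | add x y hx hy => exact Submodule.add_mem _ hx hy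
      | tmul f m =>
        have hm : m ∈ ⨆ a, M.deg a := by rw [M.internal.submodule_iSup_eq_top]; trivial
        have hf : f ∈ ⨆ g, omegaDeg k n w g := by rw [omega_iSup]; trivial
        induction hm using Submodule.iSup_induction' with
        | zero => rw [TensorProduct.tmul_zero]; exact Submodule.zero_mem _
        | add x y _ _ hx hy => rw [TensorProduct.tmul_add]; exact Submodule.add_mem _ hx hy
        | mem a m hm =>
          induction hf using Submodule.iSup_induction' with
          | zero => rw [TensorProduct.zero_tmul]; exact Submodule.zero_mem _
          | add x y _ _ hx hy => rw [TensorProduct.add_tmul]; exact Submodule.add_mem _ hx hy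
          | mem g f hf =>
            exact Submodule.mem_iSup_of_mem (g + φ a)
              (Submodule.subset_span ⟨a, m, hm, f, by rwa [add_sub_cancel_right], rfl⟩)
  act_mem v g x hx := by
    induction hx using Submodule.span_induction with
    | mem x h =>
      obtain ⟨a, m, hm, f, hf, rfl⟩ := h
      refine Submodule.subset_span ⟨a, m, hm, op (e k v) • f, ?_, rfl⟩
      rw [sub_right_comm]
      exact omega_act w v _ f hf
    | zero => rw [smul_zero]; exact Submodule.zero_mem _
    | add x y _ _ hx hy => rw [smul_add]; exact Submodule.add_mem _ hx hy
    | smul c x _ hx => rw [smul_comm]; exact Submodule.smul_mem _ _ hx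

/-- The endomorphism `f ⊗ m ↦ ∑_v e_v f ⊗ x_v m`. -/
noncomputable def koszulDiff (M : GrSMod k n) :
    Omega k n ⊗[k] M →ₗ[(Ext k n)ᵐᵒᵖ] Omega k n ⊗[k] M :=
  ∑ v, TensorProduct.AlgebraTensorModule.map (omegaLeft k n v) (M.mulX v)

theorem koszulDiff_tmul (M : GrSMod k n) (f : Omega k n) (m : M) :
    M.koszulDiff (f ⊗ₜ m) = ∑ v, omegaLeft k n v f ⊗ₜ M.mulX v m := by
  simp [koszulDiff, LinearMap.sum_apply]

theorem omegaLeft_swap (v v' : Var n) (f : Omega k n) :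
    omegaLeft k n v (omegaLeft k n v' f) + omegaLeft k n v' (omegaLeft k n v f) = 0 := by
  refine LinearMap.ext fun x => ?_
  change f.fn ((x * e k v) * e k v') + f.fn ((x * e k v') * e k v) = 0
  rw [mul_assoc, mul_assoc, ← map_add, ← mul_add, e_mul_swap, mul_zero, map_zero]

theorem omegaLeft_self (v : Var n) (f : Omega k n) : omegaLeft k n v (omegaLeft k n v f) = 0 := by
  refine LinearMap.ext fun x => ?_
  change f.fn ((x * e k v) * e k v) = 0
  rw [mul_assoc, e_mul_self, mul_zero, map_zero]

theorem koszulDiff_sq (M : GrSMod k n) (z : Omega k n ⊗[k] M) :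
    M.koszulDiff (M.koszulDiff z) = 0 := by
  induction z using TensorProduct.induction_on with
  | zero => rw [map_zero, map_zero]
  | add x y hx hy => rw [map_add, map_add, hx, hy, add_zero]
  | tmul f m =>
    rw [koszulDiff_tmul, map_sum]
    simp only [koszulDiff_tmul]
    refine sum_alternating _ ?_ ?_
    · intro v
      rw [omegaLeft_self, TensorProduct.zero_tmul]
    · intro v v'
      have : M.mulX v' (M.mulX v m) = M.mulX v (M.mulX v' m) := by
        change (MvPolynomial.X v' : Cox k n) • (MvPolynomial.X v : Cox k n) • m =
          (MvPolynomial.X v : Cox k n) • (MvPolynomial.X v' : Cox k n) • m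
        rw [smul_smul, smul_smul, mul_comm]
      rw [this, ← TensorProduct.add_tmul, omegaLeft_swap, TensorProduct.zero_tmul]

theorem koszulDiff_mem (M : GrSMod k n) (s : G) (hs : ∀ v, φ (varDeg v) - w v = s) (g : G)
    (z : Omega k n ⊗[k] M) (hz : z ∈ koszulDeg w φ M g) : M.koszulDiff z ∈ koszulDeg w φ M (g + s) := by
  induction hz using Submodule.span_induction with
  | mem x h =>
    obtain ⟨a, m, hm, f, hf, rfl⟩ := h
    rw [koszulDiff_tmul]
    refine Submodule.sum_mem _ fun v _ => Submodule.subset_span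
      ⟨a + varDeg v, _, M.X_mem v a m hm, _, ?_, rfl⟩
    have h := omegaLeft_mem w v _ f hf
    have h' : g + s - φ (a + varDeg v) = g - φ a - w v := by rw [← hs v, map_add]; abel
    rwa [h']
  | zero => rw [map_zero]; exact Submodule.zero_mem _
  | add x y _ _ hx hy => rw [map_add]; exact Submodule.add_mem _ hx hy
  | smul c x _ hx =>
    rw [← algebraMap_smul (Ext k n)ᵐᵒᵖ c x, map_smul, algebraMap_smul]
    exact Submodule.smul_mem _ _ hx

end Koszul

end GrSMod

/-! ### Differential `E`-modules -/

/-- A differential `E`-module: a `ℤ^t ⊕ ℤ`-graded right `E`-module with a square zero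
endomorphism of degree `(0; -1)`. -/
structure DMod (k : Type u) [Field k] {t : ℕ} (n : Fin t → ℕ) extends
    GrMod k n (bigDeg (n := n)) where
  diff : carrier →ₗ[(Ext k n)ᵐᵒᵖ] carrier
  diff_mem : ∀ g x, x ∈ deg g → diff x ∈ deg (g + (0, -1))
  diff_sq : ∀ x, diff (diff x) = 0

namespace DMod

variable {k : Type u} [Field k] {t : ℕ} {n : Fin t → ℕ}

/-- A morphism of differential modules. -/
structure Hom (D D' : DMod k n) where
  map : D.carrier →ₗ[(Ext k n)ᵐᵒᵖ] D'.carrier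
  map_mem : ∀ g x, x ∈ D.deg g → map x ∈ D'.deg g
  comm : ∀ x, map (D.diff x) = D'.diff (map x)

/-- Two differential modules are isomorphic. -/
def Iso (D D' : DMod k n) : Prop :=
  ∃ (f : Hom D D') (f' : Hom D' D), (∀ x, f'.map (f.map x) = x) ∧ ∀ y, f.map (f'.map y) = y

/-- `∂ D ⊆ D 𝔪`. -/
def IsMinimal (D : DMod k n) : Prop := ∀ x, D.diff x ∈ D.maxMul

/-- `D ⊗_E E_I`, that is `D / D⟨e_v : v ∉ I⟩` with the induced differential, is exact. -/
def ExactOn (D : DMod k n) (I : Set (Var n)) : Prop :=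
  ∀ x, D.diff x ∈ D.idealMul Iᶜ → ∃ y, x - D.diff y ∈ D.idealMul Iᶜ

end DMod

/-- The differential module `R(M) = ⨁_a ω_E(-a; 0) ⊗ M_a`, with differential
`f ⊗ m ↦ ∑_v e_v f ⊗ x_v m`. -/
noncomputable def RR {k : Type u} [Field k] {t : ℕ} {n : Fin t → ℕ} (M : GrSMod k n) : DMod k n where
  toGrMod := M.koszul bigDeg (AddMonoidHom.inl (Deg t) ℤ)
  diff := M.koszulDiff
  diff_mem := M.koszulDiff_mem bigDeg (AddMonoidHom.inl (Deg t) ℤ) (0, -1)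
    (fun v => by simp [bigDeg])
  diff_sq := M.koszulDiff_sq

/-! ### Complexes of graded `E`-modules and folding -/

/-- A complex of `ℤ^t`-graded right `E`-modules, with homological indexing. -/
structure Cpx (k : Type u) [Field k] {t : ℕ} (n : Fin t → ℕ) where
  X : ℤ → GrMod k n (varDeg (n := n))
  d : ∀ i j : ℤ, i = j + 1 → (X i →ₗ[(Ext k n)ᵐᵒᵖ] X j)
  d_mem : ∀ i j h a x, x ∈ (X i).deg a → d i j h x ∈ (X j).deg a
  d_comp : ∀ i j l h h' x, d j l h' (d i j h x) = 0

namespace Cpx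

variable {k : Type u} [Field k] {t : ℕ} {n : Fin t → ℕ}

/-- All terms are free graded modules. -/
def IsFree (C : Cpx k n) : Prop := ∀ j, (C.X j).IsFree

/-- A complex is minimal if its differentials have image in the maximal ideal times the target. -/
def IsMinimal (C : Cpx k n) : Prop := ∀ i j h x, C.d i j h x ∈ (C.X j).maxMul

/-- Chain maps. -/
structure Hom (C D : Cpx k n) where
  map : ∀ i, C.X i →ₗ[(Ext k n)ᵐᵒᵖ] D.X i
  map_mem : ∀ i a x, x ∈ (C.X i).deg a → map i x ∈ (D.X i).deg a
  comm : ∀ i j h x, map j (C.d i j h x) = D.d i j h (map i x)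

/-- Composition of chain maps. -/
def Hom.comp {C D F : Cpx k n} (g : Hom D F) (f : Hom C D) : Hom C F where
  map i := g.map i ∘ₗ f.map i
  map_mem i a x hx := g.map_mem i a _ (f.map_mem i a x hx)
  comm i j h x := by simp [f.comm, g.comm]

/-- Chain homotopy. -/
def Hom.Homotopic {C D : Cpx k n} (f g : Hom C D) : Prop :=
  ∃ s : ∀ i j : ℤ, j = i + 1 → (C.X i →ₗ[(Ext k n)ᵐᵒᵖ] D.X j),
    (∀ i j h a x, x ∈ (C.X i).deg a → s i j h x ∈ (D.X j).deg a) ∧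
    ∀ (i : ℤ) (x : C.X i), f.map i x - g.map i x =
      D.d (i + 1) i rfl (s i (i + 1) rfl x) +
        s (i - 1) i (by ring) (C.d i (i - 1) (by ring) x)

/-- A chain map is a quasi-isomorphism if it is injective and surjective on homology. -/
def Hom.IsQuasiIso {C D : Cpx k n} (f : Hom C D) : Prop :=
  (∀ (i : ℤ) (x : C.X i), C.d i (i - 1) (by ring) x = 0 →
    (∃ y, f.map i x = D.d (i + 1) i rfl y) → ∃ z, x = C.d (i + 1) i rfl z) ∧
  (∀ (i : ℤ) (y : D.X i), D.d i (i - 1) (by ring) y = 0 →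
    ∃ x, C.d i (i - 1) (by ring) x = 0 ∧ ∃ z, y - f.map i x = D.d (i + 1) i rfl z)

/-- A minimal free resolution of a complex: a quasi-isomorphism from a minimal complex of free
modules that vanishes in low homological degrees. -/
def Hom.IsMinimalFreeResolution {Q D : Cpx k n} (f : Hom Q D) : Prop :=
  Q.IsFree ∧ Q.IsMinimal ∧ (∃ j₀, ∀ j < j₀, ∀ x : Q.X j, x = 0) ∧ f.IsQuasiIso

/-- The complex with `j`-th term `C_{j+s}`. -/
def shift (C : Cpx k n) (s : ℤ) : Cpx k n where
  X j := C.X (j + s)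
  d i j h := C.d (i + s) (j + s) (by rw [h]; ring)
  d_mem _ _ _ a x hx := C.d_mem _ _ _ a x hx
  d_comp _ _ _ _ _ x := C.d_comp _ _ _ _ _ x

/-- The shift of a chain map. -/
def Hom.shift {C D : Cpx k n} (f : Hom C D) (s : ℤ) : Hom (C.shift s) (D.shift s) where
  map i := f.map (i + s)
  map_mem _ a x hx := f.map_mem _ a x hx
  comm _ _ _ x := f.comm _ _ _ x

/-- The component of degree `(a; b)` of the folding: `(C_{b - |a|})_a`. -/
noncomputable def foldDeg (C : Cpx k n) (g : Deg t × ℤ) : Submodule k (⨁ j, C.X j) :=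
  ((C.X (g.2 - total g.1)).deg g.1).map (DirectSum.lof k ℤ (fun j => C.X j) (g.2 - total g.1))

theorem total_sub_varDeg (a : Deg t) (v : Var n) : total (a - varDeg v) = total a - 1 := by
  simp [total, varDeg, Finset.sum_sub_distrib]

theorem fold_internal (C : Cpx k n) : DirectSum.IsInternal C.foldDeg := by
  refine internal_of_proj (fun g => DirectSum.lof k ℤ (fun j => C.X j) (g.2 - total g.1) ∘ₗ
    proj (C.X (g.2 - total g.1)).internal g.1 ∘ₗ
      DirectSum.component k ℤ (fun j => C.X j) (g.2 - total g.1)) ?_ ?_ ?_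
  · rintro g _ ⟨x, hx, rfl⟩
    simp only [LinearMap.comp_apply, DirectSum.component.lof_self]
    rw [proj_self _ hx]
  · rintro ⟨a, b⟩ ⟨a', b'⟩ hg _ ⟨x, hx, rfl⟩
    simp only [LinearMap.comp_apply]
    by_cases h : b' - total a' = b - total a
    · have ha : a' ≠ a := by
        rintro rfl
        exact hg (by rw [sub_left_injective h])
      simp only at hx ⊢
      generalize b' - total a' = j at h x hx ⊢
      subst h
      rw [DirectSum.component.lof_self, proj_ne _ hx ha, map_zero]
    · rw [DirectSum.component.of, dif_neg h, map_zero, map_zero]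
  · rw [eq_top_iff]
    rintro x -
    induction x using DirectSum.induction_on with
    | zero => exact Submodule.zero_mem _
    | add x y hx hy => exact Submodule.add_mem _ hx hy
    | of j x =>
      have hx : x ∈ ⨆ a, (C.X j).deg a := by
        rw [(C.X j).internal.submodule_iSup_eq_top]; trivial
      induction hx using Submodule.iSup_induction' with
      | zero => rw [map_zero]; exact Submodule.zero_mem _
      | add x y _ _ hx hy => rw [map_add]; exact Submodule.add_mem _ hx hy
      | mem a x hx =>
        refine Submodule.mem_iSup_of_mem (a, j + total a) ?_
        have h : ∀ j', j = j' → DirectSum.of (fun j => C.X j) j x ∈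
            ((C.X j').deg a).map (DirectSum.lof k ℤ (fun j => C.X j) j') := by
          rintro _ rfl
          exact ⟨x, hx, rfl⟩
        exact h _ (by simp)

theorem foldDeg_of (C : Cpx k n) (j : ℤ) (a : Deg t) (b : ℤ) (h : b - total a = j) (x : C.X j)
    (hx : x ∈ (C.X j).deg a) : DirectSum.lof k ℤ (fun j => C.X j) j x ∈ C.foldDeg (a, b) := by
  subst h
  exact ⟨x, hx, rfl⟩

/-- The differential of the folding. -/
noncomputable def foldDiff (C : Cpx k n) :
    (⨁ j, C.X j) →ₗ[(Ext k n)ᵐᵒᵖ] ⨁ j, C.X j :=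
  DirectSum.toModule _ ℤ _ fun i =>
    DirectSum.lof (Ext k n)ᵐᵒᵖ ℤ (fun j => C.X j) (i - 1) ∘ₗ C.d i (i - 1) (by ring)

theorem foldDiff_of (C : Cpx k n) (j : ℤ) (x : C.X j) :
    C.foldDiff (DirectSum.of (fun j => C.X j) j x) =
      DirectSum.of (fun j => C.X j) (j - 1) (C.d j (j - 1) (by ring) x) :=
  DirectSum.toModule_lof (Ext k n)ᵐᵒᵖ (φ := fun i =>
    DirectSum.lof (Ext k n)ᵐᵒᵖ ℤ (fun j => C.X j) (i - 1) ∘ₗ C.d i (i - 1) (by ring)) j x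

theorem foldDiff_mem (C : Cpx k n) (g : Deg t × ℤ) (z : ⨁ j, C.X j) (hz : z ∈ C.foldDeg g) :
    C.foldDiff z ∈ C.foldDeg (g + (0, -1)) := by
  obtain ⟨a, b⟩ := g
  obtain ⟨x, hx, rfl⟩ := hz
  have h := C.foldDeg_of (b - total a - 1) (a + 0) (b + -1) (by rw [add_zero]; ring)
    (C.d (b - total a) (b - total a - 1) (by ring) x)
    (by rw [add_zero]; exact C.d_mem _ _ _ a x hx)
  rw [DirectSum.lof_eq_of] at h ⊢
  rw [foldDiff_of]
  exact h

theorem foldDiff_sq (C : Cpx k n) (x : ⨁ j, C.X j) : C.foldDiff (C.foldDiff x) = 0 := by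
  induction x using DirectSum.induction_on with
  | zero => rw [map_zero, map_zero]
  | add x y hx hy => rw [map_add, map_add, hx, hy, add_zero]
  | of j x => rw [foldDiff_of, foldDiff_of, C.d_comp, map_zero]

theorem fold_act_mem (C : Cpx k n) (v : Var n) (g : Deg t × ℤ) (z : ⨁ j, C.X j)
    (hz : z ∈ C.foldDeg g) : op (e k v) • z ∈ C.foldDeg (g - bigDeg v) := by
  obtain ⟨a, b⟩ := g
  obtain ⟨x, hx, rfl⟩ := hz
  have h := C.foldDeg_of (b - total a) (a - varDeg v) (b - 1)
    (by rw [total_sub_varDeg]; ring) _ ((C.X _).act_mem v a x hx)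
  have h' : DirectSum.lof k ℤ (fun j => C.X j) (b - total a) (op (e k v) • x) =
      op (e k v) • DirectSum.lof k ℤ (fun j => C.X j) (b - total a) x :=
    (DirectSum.lof (Ext k n)ᵐᵒᵖ ℤ (fun j => C.X j) (b - total a)).map_smul (op (e k v)) x
  rw [h'] at h
  exact h

/-- The folding `⨁_j C_j(0; -j)` of a complex, where a `ℤ^t`-graded `E`-module is regarded as
`ℤ^t ⊕ ℤ`-graded by placing its component of degree `a` in degree `(a; |a|)`. -/
noncomputable def fold (C : Cpx k n) : DMod k n where
  carrier := ⨁ j, C.X j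
  deg := C.foldDeg
  internal := C.fold_internal
  act_mem := C.fold_act_mem
  diff := C.foldDiff
  diff_mem := C.foldDiff_mem
  diff_sq := C.foldDiff_sq

/-! ### Quadrants of a complex -/

/-- In a free module, the summand `ω_E(-a)` is generated in degree `a + (n_1 + 1, …, n_t + 1)`.
So these elements generate the summands `ω_E(-a)` for which `a_i ≥ c_i` for some `i`. -/
def upperSet (C : Cpx k n) (c : Deg t) (j : ℤ) : Set (C.X j) :=
  {x | ∃ a, x ∈ (C.X j).deg a ∧ ∃ i, c i + n i + 1 ≤ a i}

theorem upperSet_mono (C : Cpx k n) {c c' : Deg t} (h : c ≤ c') (j : ℤ) :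
    C.upperSet c' j ⊆ C.upperSet c j := by
  rintro x ⟨a, hx, i, hi⟩
  exact ⟨a, hx, i, by have h' : c i ≤ c' i := h i; omega⟩

/-- The lower quadrant of a complex of free modules: the quotient complex that consists of the
summands `ω_E(-a)` with `a_i < c_i` for all `i`. -/
def lower (C : Cpx k n) (c : Deg t) : Cpx k n where
  X j := (C.X j).quot (C.upperSet c j) (fun _ hx => ⟨hx.choose, hx.choose_spec.1⟩)
  d i j h := Submodule.mapQ _ _ (C.d i j h) (by
    rw [Submodule.span_le]
    rintro x ⟨a, hx, hi⟩
    exact Submodule.subset_span ⟨a, C.d_mem i j h a x hx, hi⟩)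
  d_mem := by
    rintro i j h a _ ⟨x, hx, rfl⟩
    exact ⟨C.d i j h x, C.d_mem i j h a x hx, rfl⟩
  d_comp i j l h h' x := by
    obtain ⟨x, rfl⟩ := Submodule.mkQ_surjective _ x
    exact (congrArg (Submodule.mkQ _) (C.d_comp i j l h h' x)).trans (map_zero _)

/-- The projection from a larger lower quadrant to a smaller one. -/
def lowerProj (C : Cpx k n) {c c' : Deg t} (h : c ≤ c') : Hom (C.lower c') (C.lower c) where
  map j := Submodule.mapQ _ _ LinearMap.id (Submodule.span_mono (C.upperSet_mono h j))
  map_mem := by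
    rintro i a _ ⟨x, hx, rfl⟩
    exact ⟨x, hx, rfl⟩
  comm i j hij x := by
    obtain ⟨x, rfl⟩ := Submodule.mkQ_surjective _ x
    rfl

end Cpx

/-! ### The complex `R(M_{≥ c})` -/

namespace GrSMod

variable {k : Type u} [Field k] {t : ℕ} {n : Fin t → ℕ}

/-- Generators of the term `⨁ M_a ⊗ ω_E(-a)`, over `a ≥ c` with `|a| = -j`. -/
noncomputable def headSet (M : GrSMod k n) (c : Deg t) (j : ℤ) :
    Set (Omega k n ⊗[k] M) :=
  {z | ∃ a, c ≤ a ∧ total a = -j ∧ ∃ m ∈ M.deg a, ∃ b, ∃ f ∈ omegaDeg k n varDeg b,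
    z = f ⊗ₜ[k] m}

theorem headSet_hom (M : GrSMod k n) (c : Deg t) (j : ℤ) :
    ∀ z ∈ M.headSet c j, ∃ g, z ∈ M.koszulDeg varDeg (AddMonoidHom.id (Deg t)) g := by
  rintro _ ⟨a, -, -, m, hm, b, f, hf, rfl⟩
  exact ⟨b + a, Submodule.subset_span ⟨a, m, hm, f, by simpa using hf, rfl⟩⟩

theorem headSet_mono (M : GrSMod k n) {c c' : Deg t} (h : c ≤ c') (j : ℤ) :
    M.headSet c' j ⊆ M.headSet c j := by
  rintro z ⟨a, ha, hz⟩
  exact ⟨a, h.trans ha, hz⟩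

theorem koszulDiff_head (M : GrSMod k n) (c : Deg t) (i j : ℤ) (h : i = j + 1) :
    ∀ z ∈ Submodule.span (Ext k n)ᵐᵒᵖ (M.headSet c i),
      M.koszulDiff z ∈ Submodule.span (Ext k n)ᵐᵒᵖ (M.headSet c j) := by
  intro z hz
  induction hz using Submodule.span_induction with
  | mem z hz =>
    obtain ⟨a, ha, ht, m, hm, b, f, hf, rfl⟩ := hz
    rw [koszulDiff_tmul]
    refine Submodule.sum_mem _ fun v _ => Submodule.subset_span
      ⟨a + varDeg v, ?_, ?_, _, M.X_mem v a m hm, _, _, omegaLeft_mem varDeg v b f hf, rfl⟩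
    · refine ha.trans (le_add_of_nonneg_right ?_)
      exact Pi.single_nonneg.mpr zero_le_one
    · have := Cpx.total_sub_varDeg (a + varDeg v) v
      rw [add_sub_cancel_right] at this
      omega
  | zero => rw [map_zero]; exact Submodule.zero_mem _
  | add x y _ _ hx hy => rw [map_add]; exact Submodule.add_mem _ hx hy
  | smul r x _ hx => rw [map_smul]; exact Submodule.smul_mem _ _ hx

/-- The complex `R(M_{≥ c})`, where `M_{≥ c} = ⨁_{a ≥ c} M_a`: its term of homological degree `j`
is `⨁ M_a ⊗ ω_E(-a)` over `a ≥ c` with `|a| = -j`, and its differential is `∑_v x_v ⊗ e_v`. -/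
noncomputable def head (M : GrSMod k n) (c : Deg t) : Cpx k n where
  X j := (M.koszul varDeg (AddMonoidHom.id (Deg t))).sub (M.headSet c j) (M.headSet_hom c j)
  d i j h := M.koszulDiff.restrict (M.koszulDiff_head c i j h)
  d_mem i j h a x hx := by
    have := M.koszulDiff_mem varDeg (AddMonoidHom.id (Deg t)) 0 (by simp) a _ hx
    rw [add_zero] at this
    exact this
  d_comp i j l h h' x := Subtype.ext (M.koszulDiff_sq x.1)

/-- The inclusion `R(M_{≥ c'}) ⊆ R(M_{≥ c})` for `c ≤ c'`. -/
noncomputable def headIncl (M : GrSMod k n) {c c' : Deg t} (h : c ≤ c') :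
    Cpx.Hom (M.head c') (M.head c) where
  map j := Submodule.inclusion (Submodule.span_mono (M.headSet_mono h j))
  map_mem _ _ _ hx := hx
  comm _ _ _ _ := rfl

end GrSMod

/-! ### The Tate resolution of Eisenbud, Erman and Schreyer -/

/-- `C` is a Tate resolution, in the sense of Eisenbud, Erman and Schreyer, of the coherent sheaf
associated with the finitely generated graded module `M`: a minimal complex of free modules that is
the inverse limit of the minimal free resolutions of the complexes `R(M_{≥ c})`, for `c ≫ 0`.
That is, the lower quadrants of `C` (whose limit is `C`, since every degree of `C` meets only
finitely many degrees of generators), shifted by the number of factors, are minimal free resolutions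
of the complexes `R(M_{≥ c})`, and the projections between the lower quadrants lift the inclusions
between these complexes. -/
def IsEESTate {k : Type u} [Field k] {t : ℕ} {n : Fin t → ℕ} (C : Cpx k n) (M : GrSMod k n) : Prop :=
  C.IsFree ∧ C.IsMinimal ∧
  ∃ (c₀ : Deg t) (ε : ∀ c, Cpx.Hom ((C.lower c).shift t) (M.head c)),
    (∀ c, c₀ ≤ c → (ε c).IsMinimalFreeResolution) ∧
    ∀ c c' (h : c ≤ c'), c₀ ≤ c →
      ((ε c).comp ((C.lowerProj h).shift t)).Homotopic ((M.headIncl h).comp (ε c'))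

/-! ### Sheaf cohomology on a product of projective spaces -/

namespace GrSMod

variable {k : Type u} [Field k] {t : ℕ} {n : Fin t → ℕ}

variable (n) in
/-- The standard affine charts of the product: one coordinate for each factor. -/
abbrev Chart := ∀ i : Fin t, Fin (n i + 1)

variable (n) in
/-- The coordinates that are invertible on the intersection of a family of charts. -/
def chartVars {p : ℕ} (s : Fin p → Chart n) : Set (Var n) := {v | ∃ q, s q v.1 = v.2}

variable (k n) in
/-- The multiplicative set generated by a set of coordinates. -/
noncomputable def varMonoid (U : Set (Var n)) : Submonoid (Cox k n) :=
  Submonoid.closure ((MvPolynomial.X : Var n → Cox k n) '' U)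

/-- The localization of `M` at a set of coordinates. -/
abbrev Loc (M : GrSMod k n) (U : Set (Var n)) := LocalizedModule (varMonoid k n U) M

/-- The component of degree `a` of a localization: spanned by the fractions `m / s` with `m` of
degree `a + deg s`. -/
noncomputable def locDeg (M : GrSMod k n) (U : Set (Var n)) (a : Deg t) : Submodule k (M.Loc U) :=
  Submodule.span k {z | ∃ (s : varMonoid k n U) (b : Deg t),
    MvPolynomial.IsWeightedHomogeneous (varDeg (n := n)) s.1 b ∧
      ∃ m ∈ M.deg (a + b), z = LocalizedModule.mk m s}

/-- Restriction maps between localizations. -/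
noncomputable def locRes (M : GrSMod k n) {U U' : Set (Var n)} (h : U ⊆ U') : M.Loc U →ₗ[Cox k n] M.Loc U' :=
  LocalizedModule.liftOfLE _ _ (Submonoid.closure_mono (Set.image_mono h))

/-- Čech cochains of all the twists of the sheaf associated with `M`, for the standard affine
cover. -/
abbrev Cochain (M : GrSMod k n) (p : ℕ) := ∀ s : Fin (p + 1) → Chart n, M.Loc (chartVars n s)

theorem chartVars_comp {p : ℕ} (s : Fin (p + 1) → Chart n) (q : Fin (p + 1)) :
    chartVars n (s ∘ q.succAbove) ⊆ chartVars n s := by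
  rintro v ⟨r, hr⟩
  exact ⟨_, hr⟩

/-- The Čech differential. -/
noncomputable def cechD (M : GrSMod k n) (p : ℕ) : M.Cochain p →ₗ[k] M.Cochain (p + 1) :=
  (LinearMap.pi fun s => ∑ q : Fin (p + 2), (-1 : ℤ) ^ (q : ℕ) •
    (M.locRes (chartVars_comp s q) ∘ₗ
      LinearMap.proj (R := Cox k n) (φ := fun s => M.Loc (chartVars n s)) (s ∘ q.succAbove))).restrictScalars k

/-- The cochains of degree `a`, that is, the Čech cochains of the twist by `a`. -/
noncomputable def cochainDeg (M : GrSMod k n) (p : ℕ) (a : Deg t) : Submodule k (M.Cochain p) :=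
  Submodule.pi Set.univ fun s => M.locDeg (chartVars n s) a

/-- Cocycles of degree `a`. -/
noncomputable def cocycles (M : GrSMod k n) (p : ℕ) (a : Deg t) : Submodule k (M.Cochain p) :=
  M.cochainDeg p a ⊓ LinearMap.ker (M.cechD p)

/-- Coboundaries of degree `a`. -/
noncomputable def coboundaries (M : GrSMod k n) : (p : ℕ) → (a : Deg t) → Submodule k (M.Cochain p)
  | 0, _ => ⊥
  | p + 1, a => (M.cochainDeg p a).map (M.cechD p)

/-- `H^p(X, F(a))`, where `F` is the sheaf associated with `M`. -/
abbrev Coh (M : GrSMod k n) (p : ℕ) (a : Deg t) :=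
  M.cocycles p a ⧸ (M.coboundaries p a).submoduleOf (M.cocycles p a)

/-- A homomorphism of graded modules from `M` to `⨁_a H^0(X, F(a))`, with `F` the sheaf associated
with `P`, such that the corresponding map from the sheaf associated with `M` to `F` is an
isomorphism: on each chart it exhibits the sections of `F` as a localization of `M`. -/
structure SheafIso (M P : GrSMod k n) where
  map : M →ₗ[Cox k n] P.Cochain 0
  map_mem : ∀ a m, m ∈ M.deg a → map m ∈ P.cocycles 0 a
  isLocalized : ∀ s, IsLocalizedModule (varMonoid k n (chartVars n s))
    ((LinearMap.proj (R := Cox k n) (φ := fun s => P.Loc (chartVars n s)) s) ∘ₗ map)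

variable (k n) in
/-- The irrelevant ideal, generated by the products of one coordinate from each factor. -/
noncomputable def irrelevantIdeal : Ideal (Cox k n) :=
  Ideal.span (Set.range fun s : Chart n => ∏ i, (MvPolynomial.X ⟨i, s i⟩ : Cox k n))

variable (k n) in
/-- A set of coordinates is irrelevant if the ideal it generates contains the irrelevant ideal. -/
def IsIrrelevant (I : Set (Var n)) : Prop :=
  irrelevantIdeal k n ≤ Ideal.span ((MvPolynomial.X : Var n → Cox k n) '' I)

/-- `H^0_B(M) = 0`. -/
def TorsionFree (M : GrSMod k n) : Prop :=
  ∀ m : M, (∃ r : ℕ, ∀ b ∈ irrelevantIdeal k n ^ r, b • m = 0) → m = 0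

end GrSMod

/-! ### The characterizing properties of a toric Tate resolution -/

/-- The four properties of the Tate resolution of the coherent sheaf `F` associated with a finitely
generated graded module `P`. -/
def IsToricTate {k : Type u} [Field k] {t : ℕ} {n : Fin t → ℕ} (T : DMod k n) (P : GrSMod k n) : Prop :=
  -- `T` is a minimal, free differential module
  (T.IsFree ∧ T.IsMinimal) ∧
  -- `H^j(X, F(a)) = Hom_E(k, T)_{(a; -j)}` for all integers `j`
  (∀ a, ∀ j : ℤ, j < 0 → T.socle (a, -j) = ⊥) ∧
  (∃ θ : ∀ (a : Deg t) (j : ℕ), P.Coh j a ≃ₗ[k] T.socle (a, -(j : ℤ)),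
    -- if `F` is the sheaf associated with `M` and `H^0_B(M) = 0`, then `M → ⨁_a H^0(X, F(a))`
    -- induces an embedding of `R(M)` in `T`
    ∀ (M : GrSMod k n) (φ : M.SheafIso P), M.TorsionFree →
      ∃ ψ : DMod.Hom (RR M) T, Function.Injective ψ.map ∧
        ∀ (a : Deg t) (m : M) (hm : m ∈ M.deg a),
          ψ.map (oneDual k n ⊗ₜ[k] m : Omega k n ⊗[k] M) =
            (θ a 0 (Submodule.Quotient.mk ⟨φ.map m, φ.map_mem a m hm⟩)).1) ∧
  -- `T ⊗_E E_I` is exact for each irrelevant `I`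
  (∀ I : Set (Var n), GrSMod.IsIrrelevant k n I → T.ExactOn I)

end ToricTate

namespace ToricTate

/-! ### Monomials of the exterior algebra -/

section Monomials

variable {k : Type u} [Field k] {t : ℕ} {n : Fin t → ℕ}

/-! A free `T` is a sum of copies of ω_E, one for each element of a homogeneous basis, and by
property (2) the socle generator of such a copy, in degree (a; -p), corresponds to a nonzero class
in H^p(X, F(a)). The number b - |a| is unchanged by the exterior variables and lowered by one by ∂,
so `T` is the folding of a complex of strands (`unfold`). Two things remain: this complex is a Tate
resolution (`unfold_isEESTate`), and Tate resolutions are unique up to isomorphism of complexes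
(`IsEESTate.exists_bijective`).

Existence. The differential never lowers a coordinate of the socle degree a, so every convex region
of ℤ^t defines a subquotient of `T` with its own differential. Modulo the variables outside the r-th
factor, the differential moves only the r-th coordinate of a; hence property (4) makes every convex
region that ignores this coordinate exact (`exactReg_of_exactOn`). If such a region is cut by the
wall a_r = c_r, the connecting map from the lower to the upper half is a quasi-isomorphism
(`quasiIso_conn`). Crossing the t walls one after the other yields a quasi-isomorphism `corner` of
degree -t from the lower quadrant {a_i < c_i for all i} to the upper quadrant {a ≥ c}, compatible up
to homotopy with enlarging c (`corner_homotopy`).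

For c ≫ 0, Serre vanishing leaves only H^0(X, F(a)) = P_a in the upper quadrant, and property (3),
applied to P modulo torsion, together with Nakayama's lemma identifies this quadrant with R(P_{≥c})
(`exists_isUpper`). Cohomology lives in finitely many degrees, so the lower quadrant is bounded
below (`lower_bounded`), and the corner map makes its shift by t a minimal free resolution of
R(P_{≥c}). Serre vanishing itself is proved for the augmented Čech complex: for free modules by
inspecting Laurent monomials (`free_exactAt`), in general by a descending induction along
presentations (`exists_exactAt`).

Uniqueness. For each large c, the two minimal resolutions of R(P_{≥c}) are related by a lift, which
is bijective by minimality. The homotopies that appear when c grows lift along the surjective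
projections and can be absorbed (`exists_compatible_lift`), so along a cofinal sequence of c the
isomorphisms can be chosen strictly compatible. Each multidegree of a Tate resolution embeds in
every sufficiently large lower quadrant, so the isomorphisms glue (`exists_glue_bijective`). -/

variable (k) in
/-- The product of the exterior variables in a list. -/
noncomputable def mono (l : List (Var n)) : Ext k n := (l.map (e k)).prod

@[simp] theorem mono_nil : mono k ([] : List (Var n)) = 1 := rfl

theorem mono_cons (v : Var n) (l : List (Var n)) : mono k (v :: l) = e k v * mono k l := by
  simp [mono]

theorem mono_append (l l' : List (Var n)) : mono k (l ++ l') = mono k l * mono k l' := by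
  simp [mono]

theorem mono_singleton (v : Var n) : mono k [v] = e k v := by simp [mono]

theorem span_mono : Submodule.span k (Set.range (mono k (n := n))) = ⊤ := by
  rw [← span_list]
  congr 1
  ext x
  exact ⟨fun ⟨l, h⟩ => ⟨l, h.symm⟩, fun ⟨l, h⟩ => ⟨l, h.symm⟩⟩

/-- Linear maps on `E` are determined by their values on monomials. -/
theorem mono_induction {C : Ext k n → Prop} (r : Ext k n) (hm : ∀ l, C (mono k l)) (h0 : C 0)
    (ha : ∀ x y, C x → C y → C (x + y)) (hs : ∀ (c : k) x, C x → C (c • x)) : C r := by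
  have hr : r ∈ Submodule.span k (Set.range (mono k (n := n))) := by rw [span_mono]; trivial
  induction hr using Submodule.span_induction with
  | mem x h => obtain ⟨l, rfl⟩ := h; exact hm l
  | zero => exact h0
  | add x y _ _ hx hy => exact ha x y hx hy
  | smul c x _ hx => exact hs c x hx

theorem mono_mem_extDeg {G : Type} [AddCommGroup G] [DecidableEq G] (w : Var n → G)
    (l : List (Var n)) : mono k l ∈ extDeg k n w (-(l.map w).sum) :=
  Submodule.subset_span ⟨l, rfl, rfl⟩

theorem e_mul_mono (v : Var n) (l : List (Var n)) :
    e k v * mono k l = (-1 : k) ^ l.length • (mono k l * e k v) := by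
  induction l with
  | nil => simp
  | cons v' l ih =>
    have h : e k v * e k v' = -(e k v' * e k v) := eq_neg_of_add_eq_zero_left (e_mul_swap v v')
    rw [mono_cons, ← mul_assoc, h, neg_mul, mul_assoc, ih, List.length_cons, pow_succ,
      mul_neg_one, neg_smul, mul_smul_comm, mul_assoc]

theorem mono_cons_eq_zero {v : Var n} {l : List (Var n)} (h : v ∈ l) : mono k (v :: l) = 0 := by
  obtain ⟨l₁, l₂, rfl⟩ := List.append_of_mem h
  rw [mono_cons, mono_append, mono_cons, ← mul_assoc, e_mul_mono, smul_mul_assoc, mul_assoc,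
    ← mul_assoc (e k v), e_mul_self, zero_mul, mul_zero, smul_zero]

theorem nodup_of_mono_ne_zero {l : List (Var n)} (h : mono k l ≠ 0) : l.Nodup := by
  induction l with
  | nil => exact List.nodup_nil
  | cons v l ih =>
    refine List.nodup_cons.mpr ⟨fun hv => h (mono_cons_eq_zero hv), ih fun hl => h ?_⟩
    rw [mono_cons, hl, mul_zero]

variable (k) in
/-- The right contraction with the coordinate dual to `e_u`. -/
noncomputable def contr (u : Var n) : Ext k n →ₗ[k] Ext k n :=
  (CliffordAlgebra.contractRight (R := k) (M := Var n → k) (Q := 0)).flip (LinearMap.proj u)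

@[simp] theorem contr_one (u : Var n) : contr k u 1 = 0 :=
  CliffordAlgebra.contractRight_one _ _

theorem contr_mul_e (u v : Var n) (x : Ext k n) :
    contr k u (x * e k v) = (if u = v then x else 0) - contr k u x * e k v := by
  have h := CliffordAlgebra.contractRight_mul_ι (R := k) (M := Var n → k) (Q := 0)
    (LinearMap.proj u) (Pi.single v 1) x
  refine h.trans ?_
  congr 1
  by_cases huv : u = v
  · subst huv; simp
  · simp [huv]

theorem contr_mul_mono {u : Var n} {l : List (Var n)} (h : u ∉ l) (x : Ext k n) :
    contr k u (x * mono k l) = (-1 : k) ^ l.length • (contr k u x * mono k l) := by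
  induction l generalizing x with
  | nil => simp
  | cons v l ih =>
    rw [List.mem_cons, not_or] at h
    rw [mono_cons, ← mul_assoc, ih h.2, contr_mul_e, if_neg h.1, zero_sub, List.length_cons,
      pow_succ, mul_neg_one, neg_smul, neg_mul, smul_neg, mul_assoc]

/-- Contraction with the last variable strips it off, because the remaining factors do not contain
it; so vanishing would propagate down to the empty product 1. -/
theorem mono_ne_zero {l : List (Var n)} (h : l.Nodup) : mono k l ≠ 0 := by
  induction l using List.reverseRecOn with
  | nil => exact one_ne_zero
  | append_singleton l v ih =>
    rw [List.nodup_append] at h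
    have hv : v ∉ l := fun hv => h.2.2 v hv v (List.mem_singleton_self v) rfl
    intro h0
    apply ih h.1
    have h1 : contr k v (mono k l) = 0 := by
      have := contr_mul_mono (k := k) hv 1
      rwa [one_mul, contr_one, zero_mul, smul_zero] at this
    have := contr_mul_e v v (mono k l)
    rwa [← mono_singleton, ← mono_append, h0, map_zero, if_pos rfl, h1, zero_mul, sub_zero,
      eq_comm] at this

variable (k) in
/-- The ideal of `E` generated by the variables in `W`. -/
def varIdeal (W : Set (Var n)) : Submodule k (Ext k n) :=
  Submodule.span k {x | ∃ l : List (Var n), x = mono k l ∧ ∃ v ∈ W, v ∈ l}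

theorem mul_mem_varIdeal_left (W : Set (Var n)) (r x : Ext k n) (hx : x ∈ varIdeal k W) :
    r * x ∈ varIdeal k W := by
  induction hx using Submodule.span_induction with
  | mem x h =>
    obtain ⟨l, rfl, v, hv, hl⟩ := h
    induction r using mono_induction with
    | hm l' =>
      exact Submodule.subset_span ⟨l' ++ l, (mono_append _ _).symm, v, hv, by simp [hl]⟩
    | h0 => rw [zero_mul]; exact Submodule.zero_mem _
    | ha x y hx hy => rw [add_mul]; exact Submodule.add_mem _ hx hy
    | hs c x hx => rw [smul_mul_assoc]; exact Submodule.smul_mem _ _ hx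
  | zero => rw [mul_zero]; exact Submodule.zero_mem _
  | add x y _ _ hx hy => rw [mul_add]; exact Submodule.add_mem _ hx hy
  | smul c x _ hx => rw [mul_smul_comm]; exact Submodule.smul_mem _ _ hx

theorem mul_mem_varIdeal_right (W : Set (Var n)) (r x : Ext k n) (hx : x ∈ varIdeal k W) :
    x * r ∈ varIdeal k W := by
  induction hx using Submodule.span_induction with
  | mem x h =>
    obtain ⟨l, rfl, v, hv, hl⟩ := h
    induction r using mono_induction with
    | hm l' =>
      exact Submodule.subset_span ⟨l ++ l', (mono_append _ _).symm, v, hv, by simp [hl]⟩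
    | h0 => rw [mul_zero]; exact Submodule.zero_mem _
    | ha x y hx hy => rw [mul_add]; exact Submodule.add_mem _ hx hy
    | hs c x hx => rw [mul_smul_comm]; exact Submodule.smul_mem _ _ hx
  | zero => rw [zero_mul]; exact Submodule.zero_mem _
  | add x y _ _ hx hy => rw [add_mul]; exact Submodule.add_mem _ hx hy
  | smul c x _ hx => rw [smul_mul_assoc]; exact Submodule.smul_mem _ _ hx

theorem e_mem_varIdeal {W : Set (Var n)} {v : Var n} (hv : v ∈ W) : e k v ∈ varIdeal k W :=
  Submodule.subset_span ⟨[v], (mono_singleton v).symm, v, hv, List.mem_singleton_self v⟩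

theorem varIdeal_mono {W W' : Set (Var n)} (h : W ⊆ W') : varIdeal k W ≤ varIdeal k W' :=
  Submodule.span_mono fun _ ⟨l, hl, v, hv, hvl⟩ => ⟨l, hl, v, h hv, hvl⟩

/-- The contraction is a skew derivation that kills the variables of `W` as soon as u is not one of
them. This allows relations modulo `W` to be differentiated with respect to u. -/
theorem contr_mem_varIdeal {W : Set (Var n)} {u : Var n} (hu : u ∉ W) (x : Ext k n)
    (hx : x ∈ varIdeal k W) : contr k u x ∈ varIdeal k W := by
  induction hx using Submodule.span_induction with
  | mem x h =>
    obtain ⟨l, rfl, v, hv, hl⟩ := h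
    induction l using List.reverseRecOn with
    | nil => simp at hl
    | append_singleton l v' ih =>
      rw [mono_append, mono_singleton, contr_mul_e]
      rw [List.mem_append, List.mem_singleton] at hl
      rcases hl with hl | rfl
      · refine Submodule.sub_mem _ ?_ (mul_mem_varIdeal_right _ _ _ (ih hl))
        split_ifs
        · exact Submodule.subset_span ⟨l, rfl, v, hv, hl⟩
        · exact Submodule.zero_mem _
      · rw [if_neg (fun h : u = v => hu (h ▸ hv)), zero_sub]
        exact Submodule.neg_mem _ (mul_mem_varIdeal_left _ _ _ (e_mem_varIdeal hv))
  | zero => rw [map_zero]; exact Submodule.zero_mem _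
  | add x y _ _ hx hy => rw [map_add]; exact Submodule.add_mem _ hx hy
  | smul c x _ hx => rw [map_smul]; exact Submodule.smul_mem _ _ hx

/-- If `r e_u` is in the ideal generated by `W`, then `r` is in that generated by `W ∪ {u}`. -/
theorem mem_varIdeal_insert_of_mul_e {W : Set (Var n)} {u : Var n} (hu : u ∉ W) (r : Ext k n)
    (h : r * e k u ∈ varIdeal k W) : r ∈ varIdeal k (insert u W) := by
  -- Contracting `r e_u` returns `r` up to a multiple of `e_u`.
  have h1 := contr_mem_varIdeal hu _ h
  rw [contr_mul_e, if_pos rfl] at h1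
  have h2 := Submodule.add_mem _ (varIdeal_mono (Set.subset_insert u W) h1)
    (mul_mem_varIdeal_left _ (contr k u r) _ (e_mem_varIdeal (Set.mem_insert u W)))
  rwa [sub_add_cancel] at h2

variable (k n) in
/-- The product of all the exterior variables. -/
noncomputable def topMono : Ext k n := mono k (Finset.univ : Finset (Var n)).toList

theorem topMono_ne_zero : topMono k n ≠ 0 := mono_ne_zero (Finset.nodup_toList _)

theorem algebraMapInv_mono_cons (v : Var n) (l : List (Var n)) :
    ExteriorAlgebra.algebraMapInv (mono k (v :: l)) = 0 := by
  rw [mono_cons, map_mul]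
  simp [e, ExteriorAlgebra.algebraMapInv]

/-- Every nonempty monomial repeats a variable of the top one, so only the constant term of `r`
survives. -/
theorem mul_topMono (r : Ext k n) :
    r * topMono k n = (ExteriorAlgebra.algebraMapInv r : k) • topMono k n := by
  induction r using mono_induction with
  | hm l =>
    cases l with
    | nil => simp
    | cons v l =>
      rw [algebraMapInv_mono_cons, zero_smul, topMono, ← mono_append]
      by_contra h
      have := nodup_of_mono_ne_zero h
      rw [List.nodup_append] at this
      exact this.2.2 v (by simp) v (by simp) rfl
  | h0 => simp
  | ha x y hx hy => rw [add_mul, hx, hy, map_add, add_smul]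
  | hs c x hx => rw [smul_mul_assoc, hx, map_smul, smul_assoc]

theorem topMono_mul (r : Ext k n) :
    topMono k n * r = (ExteriorAlgebra.algebraMapInv r : k) • topMono k n := by
  induction r using mono_induction with
  | hm l =>
    cases l with
    | nil => simp
    | cons v l =>
      rw [algebraMapInv_mono_cons, zero_smul, topMono, ← mono_append]
      by_contra h
      have := nodup_of_mono_ne_zero h
      rw [List.nodup_append] at this
      exact this.2.2 v (by simp) v (by simp) rfl
  | h0 => simp
  | ha x y hx hy => rw [mul_add, hx, hy, map_add, add_smul]
  | hs c x hx => rw [mul_smul_comm, hx, map_smul, smul_assoc]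

theorem mem_varIdeal_univ (r : Ext k n) (h : (ExteriorAlgebra.algebraMapInv r : k) = 0) :
    r ∈ varIdeal k (Set.univ : Set (Var n)) := by
  have key : r - algebraMap k _ (ExteriorAlgebra.algebraMapInv r : k) ∈
      varIdeal k (Set.univ : Set (Var n)) := by
    clear h
    induction r using mono_induction with
    | hm l =>
      cases l with
      | nil => simp
      | cons v l =>
        rw [algebraMapInv_mono_cons, map_zero, sub_zero]
        exact Submodule.subset_span ⟨_, rfl, v, trivial, by simp⟩
    | h0 => simp
    | ha x y hx hy =>
      rw [map_add, map_add, add_sub_add_comm]; exact Submodule.add_mem _ hx hy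
    | hs c x hx =>
      have : c • x - algebraMap k _ (ExteriorAlgebra.algebraMapInv (c • x) : k) =
          c • (x - algebraMap k (Ext k n) (ExteriorAlgebra.algebraMapInv x : k)) := by
        rw [map_smul, smul_sub, smul_eq_mul, map_mul, Algebra.smul_def, Algebra.smul_def]
      rw [this]; exact Submodule.smul_mem _ _ hx
  rwa [h, map_zero, sub_zero] at key

/-- An element of `E` annihilated by all variables is a multiple of the top monomial. -/
theorem eq_smul_topMono (r : Ext k n) (h : ∀ v, r * e k v = 0) : ∃ c : k, r = c • topMono k n := by
  -- Contracting `r e_v = 0` with v shows that `r` is its own contraction times `e_v`; in this way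
  -- the variables split off on the right one at a time.
  have key : ∀ l : List (Var n), l.Nodup → ∃ r', r = r' * mono k l := by
    intro l hl
    induction l using List.reverseRecOn with
    | nil => exact ⟨r, by simp⟩
    | append_singleton l v ih =>
      rw [List.nodup_append] at hl
      have hv : v ∉ l := fun hv => hl.2.2 v hv v (List.mem_singleton_self v) rfl
      obtain ⟨r', hr'⟩ := ih hl.1
      have h1 := contr_mul_e v v r
      rw [h v, map_zero, if_pos rfl, eq_comm, sub_eq_zero] at h1
      refine ⟨(-1 : k) ^ l.length • contr k v r', ?_⟩
      rw [mono_append, mono_singleton, ← mul_assoc, smul_mul_assoc, ← contr_mul_mono hv, ← hr']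
      exact h1
  obtain ⟨r', hr'⟩ := key _ (Finset.nodup_toList Finset.univ)
  exact ⟨_, hr'.trans (mul_topMono r')⟩

theorem mono_eq_zero_of_length {l : List (Var n)} (h : Fintype.card (Var n) < l.length) :
    mono k l = 0 := by
  by_contra h0
  exact absurd (nodup_of_mono_ne_zero h0).length_le_card (not_le.mpr h)

/-- A nonzero element of `E` has a right multiple equal to the top monomial. -/
theorem exists_mul_eq_topMono (r : Ext k n) (hr : r ≠ 0) : ∃ x, r * x = topMono k n := by
  -- `Nat.find` will minimise the complementary length m, so that l is a longest monomial with
  -- nonzero product; this product is then killed by every variable.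
  have h1 : ∃ m, ∃ l : List (Var n), l.length + m = Fintype.card (Var n) + 1 ∧
      r * mono k l ≠ 0 := ⟨_, [], by simp; rfl, by simpa using hr⟩
  classical
  obtain ⟨l, hl, hne⟩ := Nat.find_spec h1
  obtain ⟨c, hc⟩ := eq_smul_topMono (r * mono k l) (by
    intro v
    by_contra hv
    rw [mul_assoc, ← mono_singleton, ← mono_append] at hv
    by_cases hm : Nat.find h1 = 0
    · refine hv ?_
      rw [mono_eq_zero_of_length, mul_zero]
      simp only [List.length_append, List.length_singleton]; omega
    · refine Nat.find_min h1 (m := Nat.find h1 - 1) (by omega) ⟨l ++ [v], ?_, hv⟩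
      simp only [List.length_append, List.length_singleton]; omega)
  have hc0 : c ≠ 0 := by rintro rfl; exact hne (by rw [hc, zero_smul])
  exact ⟨c⁻¹ • mono k l, by rw [mul_smul_comm, hc, smul_smul, inv_mul_cancel₀ hc0, one_smul]⟩

variable {G : Type} [AddCommGroup G] [DecidableEq G] (w : Var n → G)

theorem topMono_mem : topMono k n ∈ extDeg k n w (-∑ v, w v) := by
  have h := mono_mem_extDeg (k := k) w (Finset.univ : Finset (Var n)).toList
  rwa [Finset.sum_map_toList] at h

/-- `ω_E` is a cyclic module, generated by an element of the degree of the product of all the `x_v`. -/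
theorem exists_omega_generator : ∃ f : Omega k n, f ∈ omegaDeg k n w (∑ v, w v) ∧
    op (topMono k n) • f = oneDual k n ∧ ∀ f' : Omega k n, ∃ r : Ext k n, op r • f = f' := by
  obtain ⟨g, hg⟩ : ∃ g : Module.Dual k (Ext k n), g (topMono k n) = 1 := by
    obtain ⟨g, hg, -⟩ := Submodule.exists_dual_map_eq_bot_of_notMem (R := k)
      (p := (⊥ : Submodule k (Ext k n))) (x := topMono k n)
      (by simpa using topMono_ne_zero) inferInstance
    exact ⟨(g (topMono k n))⁻¹ • g, by simp [hg]⟩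
  -- On the top monomial only the component of this degree of a form matters, so the form may be
  -- replaced by it.
  let f : Omega k n := omegaProj w (∑ v, w v) (Omega.mk g)
  have hf : f.fn (topMono k n) = 1 := by
    change g (extProj w (-∑ v, w v) (topMono k n)) = 1
    rw [extProj_same w _ _ (topMono_mem w), hg]
  refine ⟨f, omegaProj_mem w _ _, ?_, ?_⟩
  · refine LinearMap.ext fun x => ?_
    change f.fn (topMono k n * x) = ExteriorAlgebra.algebraMapInv x
    rw [topMono_mul, map_smul, hf, smul_eq_mul, mul_one]
  -- The pairing (r, x) ↦ f(r x) is nondegenerate because every nonzero element divides the top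
  -- monomial; equality of dimensions then gives surjectivity.
  · let F : Ext k n →ₗ[k] Module.Dual k (Ext k n) :=
      (LinearMap.mul k (Ext k n)).compr₂ f.fn
    have hinj : Function.Injective F := by
      rw [injective_iff_map_eq_zero]
      intro r hr
      by_contra hne
      obtain ⟨x, hx⟩ := exists_mul_eq_topMono r hne
      have : f.fn (r * x) = 0 := LinearMap.congr_fun hr x
      rw [hx, hf] at this
      exact one_ne_zero this
    have hsurj : Function.Surjective F :=
      (LinearMap.injective_iff_surjective_of_finrank_eq_finrank
        Subspace.dual_finrank_eq.symm).mp hinj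
    intro f'
    obtain ⟨r, hr⟩ := hsurj f'
    exact ⟨r, hr⟩

end Monomials

/-! ### Homogeneous components -/

section Components

variable {k : Type u} [Field k] {G G' : Type*} [DecidableEq G] [DecidableEq G']
  {X : Type*} [AddCommGroup X] [Module k X] {deg : G → Submodule k X}
  {Y : Type*} [AddCommGroup Y] [Module k Y] {deg' : G' → Submodule k Y}

theorem exists_sum_of_internal (h : DirectSum.IsInternal deg) (x : X) :
    ∃ s : Finset G, ∑ g ∈ s, proj h g x = x := by
  classical
  let y := (LinearEquiv.ofBijective (DirectSum.coeLinearMap deg) h).symm x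
  refine ⟨DFinsupp.support y, ?_⟩
  have hy : DirectSum.coeLinearMap deg y = x :=
    (LinearEquiv.ofBijective (DirectSum.coeLinearMap deg) h).apply_symm_apply x
  conv_rhs => rw [← hy]
  rw [DirectSum.coeLinearMap_eq_dfinsuppSum]
  rfl

theorem eq_of_proj_eq (h : DirectSum.IsInternal deg) {x y : X}
    (hxy : ∀ g, proj h g x = proj h g y) : x = y := by
  rw [← sub_eq_zero]
  obtain ⟨s, hs⟩ := exists_sum_of_internal h (x - y)
  rw [← hs]
  exact Finset.sum_eq_zero fun g _ => by rw [map_sub, hxy, sub_self]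

theorem mem_deg_iff (h : DirectSum.IsInternal deg) {g : G} {x : X} :
    x ∈ deg g ↔ ∀ g', g' ≠ g → proj h g' x = 0 := by
  refine ⟨fun hx g' hg => proj_ne h hx hg.symm, fun hx => ?_⟩
  have : proj h g x = x := by
    refine eq_of_proj_eq h fun g' => ?_
    by_cases hg : g' = g
    · subst hg; exact proj_self h (proj_mem h _ x)
    · rw [proj_ne h (proj_mem h g x) (Ne.symm hg), hx g' hg]
  rw [← this]; exact proj_mem h g x

/-- To prove something about all elements it suffices to treat homogeneous ones. -/
theorem homogeneous_induction (h : DirectSum.IsInternal deg) {C : X → Prop} (x : X) (h0 : C 0)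
    (hadd : ∀ x y, C x → C y → C (x + y)) (hdeg : ∀ g, ∀ x ∈ deg g, C x) : C x := by
  have hx : x ∈ ⨆ g, deg g := by rw [h.submodule_iSup_eq_top]; trivial
  induction hx using Submodule.iSup_induction' with
  | mem g x hx => exact hdeg g x hx
  | zero => exact h0
  | add x y _ _ hx hy => exact hadd x y hx hy

theorem proj_comm (h : DirectSum.IsInternal deg) (h' : DirectSum.IsInternal deg')
    (φ : X →ₗ[k] Y) (τ : G → G') (hτ : Function.Injective τ)
    (hφ : ∀ g, ∀ x ∈ deg g, φ x ∈ deg' (τ g)) (g : G) (x : X) :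
    proj h' (τ g) (φ x) = φ (proj h g x) := by
  induction x using homogeneous_induction h with
  | h0 => simp
  | hadd x y hx hy => simp only [map_add, hx, hy]
  | hdeg g' x hx =>
    by_cases hg : g' = g
    · subst hg; rw [proj_self h hx, proj_self h' (hφ _ x hx)]
    · rw [proj_ne h hx hg, proj_ne h' (hφ _ x hx) (fun h => hg (hτ h)), map_zero]

/-- Spanning subspaces of the components are the components. -/
theorem deg_le_of_iSup (h : DirectSum.IsInternal deg) (D : G → Submodule k X)
    (hD : ∀ g, D g ≤ deg g) (ht : ∀ x, x ∈ ⨆ g, D g) (g : G) : deg g ≤ D g := by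
  intro x hx
  have key : ∀ y, proj h g y ∈ D g := by
    intro y
    have hy := ht y
    induction hy using Submodule.iSup_induction' with
    | mem g' y hy =>
      by_cases hg : g' = g
      · subst hg; rw [proj_self h (hD _ hy)]; exact hy
      · rw [proj_ne h (hD _ hy) hg]; exact Submodule.zero_mem _
    | zero => rw [map_zero]; exact Submodule.zero_mem _
    | add x y _ _ hx hy => rw [map_add]; exact Submodule.add_mem _ hx hy
  rw [← proj_self h hx]
  exact key x

end Components

/-! ### Free graded modules -/

namespace GrMod

variable {k : Type u} [Field k] {t : ℕ} {n : Fin t → ℕ} {G : Type} [AddCommGroup G]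
  [DecidableEq G] {w : Var n → G}

theorem mono_smul_cons (X : GrMod k n w) (v : Var n) (l : List (Var n)) (x : X) :
    op (mono k (v :: l)) • x = op (mono k l) • op (e k v) • x := by
  rw [mono_cons, op_mul, mul_smul]

theorem mono_smul_mem_of {k : Type u} [Field k] {n : Fin t → ℕ} {w : Var n → G}
    {Y : Type*} [AddCommGroup Y] [Module k Y] [Module (Ext k n)ᵐᵒᵖ Y]
    {deg : G → Submodule k Y} (hact : ∀ v g x, x ∈ deg g → op (e k v) • x ∈ deg (g - w v))
    (l : List (Var n)) {g : G} {x : Y} (hx : x ∈ deg g) :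
    op (mono k l) • x ∈ deg (g - (l.map w).sum) := by
  induction l generalizing g x with
  | nil => simpa using hx
  | cons v l ih =>
    rw [mono_cons, op_mul, mul_smul, List.map_cons, List.sum_cons, ← sub_sub]
    exact ih (hact v g x hx)

theorem mono_smul_mem (X : GrMod k n w) (l : List (Var n)) {g : G} {x : X} (hx : x ∈ X.deg g) :
    op (mono k l) • x ∈ X.deg (g - (l.map w).sum) :=
  mono_smul_mem_of X.act_mem l hx

/-- A homogeneous basis of a graded module. -/
structure HBasis (X : GrMod k n w) where
  ι : Type u
  b : Module.Basis ι (Ext k n)ᵐᵒᵖ X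
  gd : ι → G
  mem : ∀ i, b i ∈ X.deg (gd i)

theorem IsFree.hBasis {X : GrMod k n w} (h : X.IsFree) : Nonempty X.HBasis := by
  obtain ⟨ι, b, hb⟩ := h
  choose gd hgd using hb
  exact ⟨⟨ι, b, gd, hgd⟩⟩

theorem HBasis.isFree {X : GrMod k n w} (B : X.HBasis) : X.IsFree :=
  ⟨B.ι, B.b, fun i => ⟨B.gd i, B.mem i⟩⟩

/-- The component of degree `g` of a free module is spanned by the multiples of basis elements by
monomials that have degree `g`. -/
theorem HBasis.mem_span {X : GrMod k n w} (B : X.HBasis) {g : G} {x : X} (hx : x ∈ X.deg g) :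
    x ∈ Submodule.span k {y : X | ∃ i l, y = op (mono k l) • B.b i ∧
      B.gd i - (l.map w).sum = g} := by
  refine deg_le_of_iSup X.internal (fun g => Submodule.span k {y : X | ∃ i l,
    y = op (mono k l) • B.b i ∧ B.gd i - (l.map w).sum = g}) ?_ ?_ g hx
  · intro g
    rw [Submodule.span_le]
    rintro _ ⟨i, l, rfl, rfl⟩
    exact X.mono_smul_mem l (B.mem i)
  · intro x
    rw [← B.b.linearCombination_repr x, Finsupp.linearCombination_apply, Finsupp.sum]
    refine Submodule.sum_mem _ fun i _ => ?_
    rw [← op_unop (B.b.repr x i)]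
    generalize (B.b.repr x i).unop = r
    induction r using mono_induction with
    | hm l => exact Submodule.mem_iSup_of_mem _ (Submodule.subset_span ⟨i, l, rfl, rfl⟩)
    | h0 => rw [op_zero, zero_smul]; exact Submodule.zero_mem _
    | ha x y hx hy => rw [op_add, add_smul]; exact Submodule.add_mem _ hx hy
    | hs c x hx => rw [op_smul, smul_assoc]; exact Submodule.smul_mem _ _ hx

section Lift

variable {Y : Type*} [AddCommGroup Y] [Module k Y] [Module (Ext k n)ᵐᵒᵖ Y]
  [IsScalarTower k (Ext k n)ᵐᵒᵖ Y] {deg : G → Submodule k Y}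

/-- A linear map from a free module that respects the degrees of the basis is homogeneous. -/
theorem HBasis.map_mem {X : GrMod k n w} (B : X.HBasis)
    (hact : ∀ v g x, x ∈ deg g → op (e k v) • x ∈ deg (g - w v))
    (φ : X →ₗ[(Ext k n)ᵐᵒᵖ] Y) (s : G) (hφ : ∀ i, φ (B.b i) ∈ deg (B.gd i + s)) (g : G) (x : X)
    (hx : x ∈ X.deg g) : φ x ∈ deg (g + s) := by
  have hx' := B.mem_span hx
  clear hx
  induction hx' using Submodule.span_induction with
  | mem x h =>
    obtain ⟨i, l, rfl, rfl⟩ := h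
    rw [map_smul, sub_add_eq_add_sub]
    exact mono_smul_mem_of hact l (hφ i)
  | zero => rw [map_zero]; exact Submodule.zero_mem _
  | add x y _ _ hx hy => rw [map_add]; exact Submodule.add_mem _ hx hy
  | smul c x _ hx => rw [φ.map_smul_of_tower]; exact Submodule.smul_mem _ _ hx

/-- Lifting homogeneous maps from a free module. -/
theorem HBasis.exists_lift {X : GrMod k n w} (B : X.HBasis) {Z : Type*} [AddCommGroup Z]
    [Module (Ext k n)ᵐᵒᵖ Z] (hact : ∀ v g x, x ∈ deg g → op (e k v) • x ∈ deg (g - w v))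
    (L : Y →ₗ[(Ext k n)ᵐᵒᵖ] Z) (K : X →ₗ[(Ext k n)ᵐᵒᵖ] Z)
    (h : ∀ g, ∀ x ∈ X.deg g, ∃ y ∈ deg g, L y = K x) :
    ∃ φ : X →ₗ[(Ext k n)ᵐᵒᵖ] Y, (∀ g, ∀ x ∈ X.deg g, φ x ∈ deg g) ∧ ∀ x, L (φ x) = K x := by
  choose y hy hL using fun i => h (B.gd i) (B.b i) (B.mem i)
  refine ⟨B.b.constr ℕ y, fun g x hx => ?_, fun x => ?_⟩
  · have := B.map_mem hact (B.b.constr ℕ y) 0 (by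
      intro i; rw [Module.Basis.constr_basis, add_zero]; exact hy i) g x hx
    rwa [add_zero] at this
  · have : L ∘ₗ B.b.constr ℕ y = K := B.b.ext fun i => by
      rw [LinearMap.comp_apply, Module.Basis.constr_basis, hL]
    exact LinearMap.congr_fun this x

end Lift

/-! ### Multiples of the exterior variables -/

/-- The `k`-subspace spanned by the products `x e_v`, for `v ∈ W` and `x` in an `E`-submodule, is
an `E`-submodule. -/
theorem span_e_smul (X : GrMod k n w) (N : Submodule (Ext k n)ᵐᵒᵖ X) (W : Set (Var n)) (y : X)
    (hy : y ∈ Submodule.span (Ext k n)ᵐᵒᵖ {y | ∃ v ∈ W, ∃ x ∈ N, y = op (e k v) • x}) :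
    y ∈ Submodule.span k {y : X | ∃ v ∈ W, ∃ x ∈ N, y = op (e k v) • x} := by
  induction hy using Submodule.span_induction with
  | mem y h => exact Submodule.subset_span h
  | zero => exact Submodule.zero_mem _
  | add x y _ _ hx hy => exact Submodule.add_mem _ hx hy
  | smul r x _ hx =>
    refine X.smul_mem_of_act _ ?_ r.unop x hx
    intro v' x hx
    induction hx using Submodule.span_induction with
    | mem x h =>
      obtain ⟨v, hv, x, hxN, rfl⟩ := h
      have h' : op (e k v') • op (e k v) • x = -(op (e k v) • op (e k v') • x) := by
        have h2 : e k v * e k v' = -(e k v' * e k v) :=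
          eq_neg_of_add_eq_zero_left (e_mul_swap v v')
        rw [← mul_smul, ← mul_smul, ← op_mul, ← op_mul, h2, op_neg, neg_smul]
      rw [h']
      exact Submodule.neg_mem _ (Submodule.subset_span
        ⟨v, hv, _, Submodule.smul_mem _ _ hxN, rfl⟩)
    | zero => rw [smul_zero]; exact Submodule.zero_mem _
    | add x y _ _ hx hy => rw [smul_add]; exact Submodule.add_mem _ hx hy
    | smul c x _ hx =>
      rw [← algebraMap_smul (Ext k n)ᵐᵒᵖ c x, ← mul_smul, ← Algebra.commutes, mul_smul,
        algebraMap_smul]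
      exact Submodule.smul_mem _ _ hx

theorem mem_span_of_mem_idealMul (X : GrMod k n w) {W : Set (Var n)} {y : X}
    (hy : y ∈ X.idealMul W) :
    y ∈ Submodule.span k {y : X | ∃ v ∈ W, ∃ x, y = op (e k v) • x} := by
  have h := X.span_e_smul ⊤ W y (by simpa [idealMul] using hy)
  simpa using h

theorem e_smul_mem_idealMul (X : GrMod k n w) {W : Set (Var n)} {v : Var n} (hv : v ∈ W) (x : X) :
    op (e k v) • x ∈ X.idealMul W := Submodule.subset_span ⟨v, hv, x, rfl⟩

theorem idealMul_mono (X : GrMod k n w) {W W' : Set (Var n)} (h : W ⊆ W') :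
    X.idealMul W ≤ X.idealMul W' :=
  Submodule.span_mono fun _ ⟨v, hv, x, hx⟩ => ⟨v, h hv, x, hx⟩

theorem map_idealMul {G' : Type} [AddCommGroup G'] [DecidableEq G'] {w' : Var n → G'}
    (X : GrMod k n w) (Y : GrMod k n w') (φ : X →ₗ[(Ext k n)ᵐᵒᵖ] Y) {W : Set (Var n)} {x : X}
    (hx : x ∈ X.idealMul W) : φ x ∈ Y.idealMul W := by
  induction hx using Submodule.span_induction with
  | mem x h =>
    obtain ⟨v, hv, x, rfl⟩ := h
    rw [map_smul]; exact Y.e_smul_mem_idealMul hv _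
  | zero => rw [map_zero]; exact Submodule.zero_mem _
  | add x y _ _ hx hy => rw [map_add]; exact Submodule.add_mem _ hx hy
  | smul c x _ hx => rw [map_smul]; exact Submodule.smul_mem _ _ hx

theorem varIdeal_smul_mem (X : GrMod k n w) {W : Set (Var n)} {r : Ext k n}
    (hr : r ∈ varIdeal k W) (x : X) : op r • x ∈ X.idealMul W := by
  induction hr using Submodule.span_induction with
  | mem r h =>
    obtain ⟨l, rfl, v, hv, hl⟩ := h
    obtain ⟨l₁, l₂, rfl⟩ := List.append_of_mem hl
    rw [mono_append, op_mul, mul_smul, mono_smul_cons]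
    exact Submodule.smul_mem _ _ (X.e_smul_mem_idealMul hv _)
  | zero => rw [op_zero, zero_smul]; exact Submodule.zero_mem _
  | add x y _ _ hx hy => rw [op_add, add_smul]; exact Submodule.add_mem _ hx hy
  | smul c x _ hx => rw [op_smul, smul_assoc]; exact X.smul_deg_mem _ _ _ hx

theorem mem_idealMul_iff (X : GrMod k n w) {ι : Type*} (b : Module.Basis ι (Ext k n)ᵐᵒᵖ X)
    {W : Set (Var n)} {x : X} :
    x ∈ X.idealMul W ↔ ∀ i, (b.repr x i).unop ∈ varIdeal k W := by
  constructor
  · intro hx i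
    induction hx using Submodule.span_induction with
    | mem x h =>
      obtain ⟨v, hv, x, rfl⟩ := h
      rw [map_smul, Finsupp.smul_apply, smul_eq_mul, unop_mul, unop_op]
      exact mul_mem_varIdeal_left _ _ _ (e_mem_varIdeal hv)
    | zero => rw [map_zero]; exact Submodule.zero_mem _
    | add x y _ _ hx hy =>
      rw [map_add, Finsupp.add_apply, unop_add]; exact Submodule.add_mem _ hx hy
    | smul c x _ hx =>
      rw [map_smul, Finsupp.smul_apply, smul_eq_mul, unop_mul]
      exact mul_mem_varIdeal_right _ _ _ hx
  · intro h
    rw [← b.linearCombination_repr x, Finsupp.linearCombination_apply, Finsupp.sum]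
    exact Submodule.sum_mem _ fun i _ => X.varIdeal_smul_mem (h i) _

/-- Modulo the variables of `W`, the kernel of `e_u` on a free module is no larger than its image;
coordinates in the basis reduce this to E. It drives the induction in `exact_of_exact_mod`. -/
theorem HBasis.mem_idealMul_insert {X : GrMod k n w} (B : X.HBasis) {W : Set (Var n)} {u : Var n}
    (hu : u ∉ W) {x : X} (hx : op (e k u) • x ∈ X.idealMul W) : x ∈ X.idealMul (insert u W) := by
  rw [X.mem_idealMul_iff B.b] at hx ⊢
  intro i
  have := hx i
  rw [map_smul, Finsupp.smul_apply, smul_eq_mul, unop_mul, unop_op] at this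
  exact mem_varIdeal_insert_of_mul_e hu _ this

/-- Multiplication by the top monomial sees only the constant terms of the coordinates, so it
detects the residue class modulo 𝔪. -/
theorem HBasis.mem_maxMul_of_topMono {X : GrMod k n w} (B : X.HBasis) {x : X}
    (hx : op (topMono k n) • x = 0) : x ∈ X.maxMul := by
  rw [maxMul, X.mem_idealMul_iff B.b]
  intro i
  have h := congrArg (fun y => (B.b.repr y i).unop) hx
  simp only [map_smul, Finsupp.smul_apply, smul_eq_mul, unop_mul, unop_op, map_zero,
    Finsupp.zero_apply, unop_zero] at h
  rw [mul_topMono, smul_eq_zero_iff_left topMono_ne_zero] at h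
  exact mem_varIdeal_univ _ h

theorem HBasis.topMono_smul_ne_zero {X : GrMod k n w} (B : X.HBasis) (i : B.ι) :
    op (topMono k n) • B.b i ≠ 0 := by
  intro h
  have := congrArg (fun y => (B.b.repr y i).unop) h
  simp only [map_smul, Module.Basis.repr_self, Finsupp.smul_apply, Finsupp.single_eq_same,
    smul_eq_mul, mul_one, unop_op, map_zero, Finsupp.zero_apply, unop_zero] at this
  exact topMono_ne_zero this

theorem topMono_smul_mem_socle (X : GrMod k n w) {g : G} {x : X} (hx : x ∈ X.deg g) :
    op (topMono k n) • x ∈ X.socle (g - ∑ v, w v) := by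
  refine ⟨?_, fun v => ?_⟩
  · have h := X.mono_smul_mem (Finset.univ : Finset (Var n)).toList hx
    rwa [Finset.sum_map_toList] at h
  · rw [← mul_smul, ← op_mul, topMono_mul]
    have : ExteriorAlgebra.algebraMapInv (e k v) = (0 : k) := by
      simp [e, ExteriorAlgebra.algebraMapInv]
    rw [this, zero_smul, op_zero, zero_smul]

/-- Nakayama's lemma for the nilpotent ideal `𝔪`. -/
theorem le_of_le_sup_e_smul (X : GrMod k n w) (N H : Submodule (Ext k n)ᵐᵒᵖ X)
    (h : N ≤ H ⊔ Submodule.span _ {y | ∃ v : Var n, ∃ x ∈ N, y = op (e k v) • x}) : N ≤ H := by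
  -- Substituting the hypothesis into itself m times leaves a remainder in the multiples of N by
  -- monomials of length m, and these vanish once m exceeds the number of variables.
  have step : ∀ m : ℕ, ∀ x ∈ N, ∃ z ∈ H, x - z ∈ Submodule.span k
      {y : X | ∃ l : List (Var n), l.length = m ∧ ∃ x ∈ N, y = op (mono k l) • x} := by
    intro m
    induction m with
    | zero =>
      intro x hx
      exact ⟨0, Submodule.zero_mem _, by
        rw [sub_zero]; exact Submodule.subset_span ⟨[], rfl, x, hx, by simp⟩⟩
    | succ m ih =>
      intro x hx
      obtain ⟨z, hz, hxz⟩ := ih x hx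
      suffices hs : ∀ y ∈ Submodule.span k
          {y : X | ∃ l : List (Var n), l.length = m ∧ ∃ x ∈ N, y = op (mono k l) • x},
          ∃ z ∈ H, y - z ∈ Submodule.span k
          {y : X | ∃ l : List (Var n), l.length = m + 1 ∧ ∃ x ∈ N, y = op (mono k l) • x} by
        obtain ⟨z', hz', h'⟩ := hs _ hxz
        exact ⟨z + z', Submodule.add_mem _ hz hz', by rwa [← sub_sub]⟩
      intro y hy
      induction hy using Submodule.span_induction with
      | mem y hy =>
        obtain ⟨l, hl, x', hx', rfl⟩ := hy
        obtain ⟨z', hz', y', hy', rfl⟩ := Submodule.mem_sup.mp (h hx')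
        refine ⟨op (mono k l) • z', Submodule.smul_mem _ _ hz', ?_⟩
        rw [smul_add, add_sub_cancel_left]
        have hy'' := X.span_e_smul N Set.univ y' (by simpa using hy')
        clear hx' hy'
        induction hy'' using Submodule.span_induction with
        | mem y hy =>
          obtain ⟨v, -, x, hx, rfl⟩ := hy
          exact Submodule.subset_span ⟨v :: l, by simp [hl], x, hx, (X.mono_smul_cons v l x).symm⟩
        | zero => rw [smul_zero]; exact Submodule.zero_mem _
        | add x y _ _ hx hy => rw [smul_add]; exact Submodule.add_mem _ hx hy
        | smul c x _ hx =>
          rw [← algebraMap_smul (Ext k n)ᵐᵒᵖ c x, ← mul_smul, ← Algebra.commutes, mul_smul,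
            algebraMap_smul]
          exact Submodule.smul_mem _ _ hx
      | zero => exact ⟨0, Submodule.zero_mem _, by simp⟩
      | add x y _ _ hx hy =>
        obtain ⟨z, hz, h⟩ := hx
        obtain ⟨z', hz', h'⟩ := hy
        exact ⟨z + z', Submodule.add_mem _ hz hz', by
          rw [add_sub_add_comm]; exact Submodule.add_mem _ h h'⟩
      | smul c x _ hx =>
        obtain ⟨z, hz, h⟩ := hx
        exact ⟨c • z, X.smul_deg_mem _ _ _ hz, by
          rw [← smul_sub]; exact Submodule.smul_mem _ _ h⟩
  intro x hx
  obtain ⟨z, hz, hxz⟩ := step (Fintype.card (Var n) + 1) x hx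
  have h0 : Submodule.span k {y : X | ∃ l : List (Var n), l.length = Fintype.card (Var n) + 1 ∧
      ∃ x ∈ N, y = op (mono k l) • x} = ⊥ := by
    rw [Submodule.span_eq_bot]
    rintro _ ⟨l, hl, x, -, rfl⟩
    rw [mono_eq_zero_of_length (by omega), op_zero, zero_smul]
  rw [h0, Submodule.mem_bot, sub_eq_zero] at hxz
  rwa [hxz]

/-- An endomorphism with image in `X 𝔪` is nilpotent. -/
theorem isNilpotent_of_maxMul (X : GrMod k n w) (ν : Module.End (Ext k n)ᵐᵒᵖ X)
    (h : ∀ x, ν x ∈ X.maxMul) : IsNilpotent ν := by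
  have step : ∀ m : ℕ, ∀ x, (ν ^ m) x ∈ Submodule.span k
      {y : X | ∃ l : List (Var n), l.length = m ∧ ∃ x, y = op (mono k l) • x} := by
    intro m
    induction m with
    | zero => exact fun x => Submodule.subset_span ⟨[], rfl, x, by simp⟩
    | succ m ih =>
      intro x
      rw [pow_succ', Module.End.mul_apply]
      have hx := ih x
      generalize (ν ^ m) x = y at hx
      induction hx using Submodule.span_induction with
      | mem y hy =>
        obtain ⟨l, hl, x', rfl⟩ := hy
        rw [map_smul]
        have hx' := X.mem_span_of_mem_idealMul (h x')
        generalize ν x' = y at hx'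
        induction hx' using Submodule.span_induction with
        | mem y hy =>
          obtain ⟨v, -, x, rfl⟩ := hy
          exact Submodule.subset_span ⟨v :: l, by simp [hl], x, (X.mono_smul_cons v l x).symm⟩
        | zero => rw [smul_zero]; exact Submodule.zero_mem _
        | add x y _ _ hx hy => rw [smul_add]; exact Submodule.add_mem _ hx hy
        | smul c x _ hx =>
          rw [← algebraMap_smul (Ext k n)ᵐᵒᵖ c x, ← mul_smul, ← Algebra.commutes, mul_smul,
            algebraMap_smul]
          exact Submodule.smul_mem _ _ hx
      | zero => rw [map_zero]; exact Submodule.zero_mem _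
      | add x y _ _ hx hy => rw [map_add]; exact Submodule.add_mem _ hx hy
      | smul c x _ hx => rw [ν.map_smul_of_tower]; exact Submodule.smul_mem _ _ hx
  refine ⟨Fintype.card (Var n) + 1, LinearMap.ext fun x => ?_⟩
  have h0 : Submodule.span k {y : X | ∃ l : List (Var n), l.length = Fintype.card (Var n) + 1 ∧
      ∃ x, y = op (mono k l) • x} = ⊥ := by
    rw [Submodule.span_eq_bot]
    rintro _ ⟨l, hl, x, rfl⟩
    rw [mono_eq_zero_of_length (by omega), op_zero, zero_smul]
  have := step (Fintype.card (Var n) + 1) x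
  rwa [h0, Submodule.mem_bot] at this

end GrMod

/-! ### Operators on a free differential module -/

section Degrees

variable {t : ℕ} {n : Fin t → ℕ}

theorem list_sum_varDeg_nonneg (l : List (Var n)) : 0 ≤ (l.map (varDeg (n := n))).sum := by
  refine List.sum_nonneg fun x hx => ?_
  obtain ⟨v, -, rfl⟩ := List.mem_map.mp hx
  exact Pi.single_nonneg.mpr zero_le_one

theorem list_sum_bigDeg (l : List (Var n)) :
    (l.map (bigDeg (n := n))).sum = ((l.map varDeg).sum, (l.length : ℤ)) := by
  induction l with
  | nil => rfl
  | cons v l ih =>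
    rw [List.map_cons, List.sum_cons, ih]
    simp [bigDeg, add_comm]

theorem total_add (a b : Deg t) : total (a + b) = total a + total b := by
  simp [total, Finset.sum_add_distrib]

theorem total_sub (a b : Deg t) : total (a - b) = total a - total b := by
  simp [total, Finset.sum_sub_distrib]

theorem total_list_sum_varDeg (l : List (Var n)) :
    total (l.map (varDeg (n := n))).sum = l.length := by
  induction l with
  | nil => simp [total]
  | cons v l ih =>
    rw [List.map_cons, List.sum_cons, total_add, ih]
    simp [total, varDeg, add_comm]

theorem list_sum_varDeg_apply_eq_zero {r : Fin t} {l : List (Var n)} (h : ∀ v ∈ l, v.1 = r)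
    {i : Fin t} (hi : i ≠ r) : (l.map (varDeg (n := n))).sum i = 0 := by
  induction l with
  | nil => rfl
  | cons v l ih =>
    rw [List.map_cons, List.sum_cons, Pi.add_apply, ih fun v hv => h v (List.mem_cons_of_mem _ hv)]
    have := h v List.mem_cons_self
    simp [varDeg, this, hi]

variable (n) in
/-- The degree of the product of all the variables. -/
def topDeg : Deg t := fun i => n i + 1

theorem sum_varDeg : ∑ v : Var n, varDeg v = topDeg n := by
  ext i
  rw [Finset.sum_apply, Fintype.sum_sigma, Finset.sum_eq_single i]
  · simp [varDeg, topDeg]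
  · intro j _ hj; simp [varDeg, hj.symm]
  · simp

theorem sum_bigDeg : ∑ v : Var n, bigDeg v = (topDeg n, total (topDeg n)) := by
  have h := sum_varDeg (n := n)
  refine Prod.ext ?_ ?_
  · rw [Prod.fst_sum]; exact h
  · rw [Prod.snd_sum]
    have : total (topDeg n) = ∑ v : Var n, total (varDeg v) := by
      rw [← h]; simp only [total, Finset.sum_apply]; rw [Finset.sum_comm]
    rw [this]
    exact Finset.sum_congr rfl fun v _ => by simp [bigDeg, total, varDeg]

end Degrees

namespace DMod

variable {k : Type u} [Field k] {t : ℕ} {n : Fin t → ℕ} {T : DMod k n} (B : T.toGrMod.HBasis)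

/-- Endomorphisms of a differential module that do not have to respect degrees or differentials. -/
abbrev EndE (T : DMod k n) := Module.End (Ext k n)ᵐᵒᵖ T.carrier

/-- The degree of the socle element of the summand generated by a basis element. -/
def sdeg (i : B.ι) : Deg t := (B.gd i).1 - topDeg n

/-- The homological degree of a basis element. -/
def hdeg (i : B.ι) : ℤ := (B.gd i).2 - total (B.gd i).1

/-- The degrees of the basis elements `i` and `j` allow `b_j` to occur in `∂ b_i`. -/
def Rel (i j : B.ι) : Prop :=
  ∃ l : List (Var n), B.gd j - (l.map bigDeg).sum = B.gd i + (0, -1)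

variable {B} in
-- The monomials in the matrix of ∂ have nonnegative weight in each coordinate, so socle degrees can
-- only go up. Hence upward closed sets of degrees give differential submodules; all truncations of
-- `T` rest on this.
theorem Rel.sdeg_le {i j : B.ι} (h : Rel B i j) : sdeg B i ≤ sdeg B j := by
  obtain ⟨l, hl⟩ := h
  have h1 := congrArg Prod.fst hl
  rw [list_sum_bigDeg] at h1
  simp only [Prod.fst_sub, Prod.fst_add, add_zero] at h1
  refine sub_le_sub_right ?_ _
  rw [← h1]
  exact sub_le_self _ (list_sum_varDeg_nonneg l)

variable {B} in
-- Each exterior variable changes b and |a| by the same amount, so b - |a| is constant on the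
-- summand of a basis element and only the degree of ∂ itself counts.
theorem Rel.hdeg_eq {i j : B.ι} (h : Rel B i j) : hdeg B j = hdeg B i - 1 := by
  obtain ⟨l, hl⟩ := h
  have h1 := congrArg (fun g : Deg t × ℤ => g.2 - total g.1) hl
  rw [list_sum_bigDeg] at h1
  simp only [Prod.fst_sub, Prod.fst_add, Prod.snd_sub, Prod.snd_add, add_zero, total_sub,
    total_list_sum_varDeg] at h1
  rw [hdeg, hdeg]; linarith

/-- The operator that multiplies the basis elements by integers. -/
noncomputable def diag (c : B.ι → ℤ) : T.EndE := B.b.constr ℕ fun i => c i • B.b i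

@[simp] theorem diag_b (c : B.ι → ℤ) (i : B.ι) : diag B c (B.b i) = c i • B.b i :=
  B.b.constr_basis ℕ _ i

theorem diag_mul (c c' : B.ι → ℤ) : diag B c * diag B c' = diag B (c * c') :=
  B.b.ext fun i => by
    rw [Module.End.mul_apply, diag_b, map_zsmul, diag_b, diag_b, smul_smul, Pi.mul_apply, mul_comm]

theorem diag_comm (c c' : B.ι → ℤ) : diag B c * diag B c' = diag B c' * diag B c := by
  rw [diag_mul, diag_mul, mul_comm]

theorem diag_add (c c' : B.ι → ℤ) : diag B (c + c') = diag B c + diag B c' :=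
  B.b.ext fun i => by
    rw [LinearMap.add_apply, diag_b, diag_b, diag_b, Pi.add_apply, add_smul]

theorem diag_one : diag B 1 = 1 := B.b.ext fun i => by
  rw [diag_b, Pi.one_apply, one_smul, Module.End.one_apply]

theorem diag_mem (c : B.ι → ℤ) (g : Deg t × ℤ) (x : T.carrier) (hx : x ∈ T.deg g) :
    diag B c x ∈ T.deg g := by
  have := B.map_mem (deg := T.deg) T.act_mem (diag B c) 0 (by
    intro i; rw [diag_b, add_zero]; exact zsmul_mem (B.mem i) _) g x hx
  rwa [add_zero] at this

theorem diff_b_mem (i : B.ι) : T.diff (B.b i) ∈ Submodule.span k {y : T.carrier |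
    ∃ j, ∃ l : List (Var n), y = op (mono k l) • B.b j ∧ B.gd j - (l.map bigDeg).sum = B.gd i + (0, -1)} :=
  B.mem_span (T.diff_mem _ _ (B.mem i))

theorem diag_diff_congr (c c' : B.ι → ℤ) (i : B.ι) (h : ∀ j, Rel B i j → c j = c' j) :
    diag B c (T.diff (B.b i)) = diag B c' (T.diff (B.b i)) := by
  have hx := diff_b_mem B i
  generalize T.diff (B.b i) = y at hx
  induction hx using Submodule.span_induction with
  | mem y hy =>
    obtain ⟨j, l, rfl, hl⟩ := hy
    rw [map_smul, map_smul, diag_b, diag_b, h j ⟨l, hl⟩]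
  | zero => rw [map_zero, map_zero]
  | add x y _ _ hx hy => rw [map_add, map_add, hx, hy]
  | smul a x _ hx => rw [LinearMap.map_smul_of_tower, LinearMap.map_smul_of_tower, hx]

/-- The operator obtained from the differential by multiplying the entries of its matrix by
integers. -/
noncomputable def weave (M : B.ι → B.ι → ℤ) : T.EndE :=
  B.b.constr ℕ fun i => diag B (M i) (T.diff (B.b i))

@[simp] theorem weave_b (M : B.ι → B.ι → ℤ) (i : B.ι) :
    weave B M (B.b i) = diag B (M i) (T.diff (B.b i)) :=
  B.b.constr_basis ℕ _ i

theorem weave_congr {M M' : B.ι → B.ι → ℤ} (h : ∀ i j, Rel B i j → M i j = M' i j) :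
    weave B M = weave B M' :=
  B.b.ext fun i => by rw [weave_b, weave_b]; exact diag_diff_congr B _ _ i (h i)

theorem weave_add (M M' : B.ι → B.ι → ℤ) : weave B (M + M') = weave B M + weave B M' :=
  B.b.ext fun i => by
    rw [LinearMap.add_apply, weave_b, weave_b, weave_b, Pi.add_apply, diag_add,
      LinearMap.add_apply]

/-- Identities between truncated differentials thus become identities between integer matrices,
which need to be checked only on pairs related by `Rel`. -/
theorem weave_sandwich (c c' : B.ι → ℤ) :
    diag B c * T.diff * diag B c' = weave B fun i j => c' i * c j :=
  B.b.ext fun i => by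
    have : (fun j => c' i * c j) = (fun _ => c' i) * c := rfl
    have h2 : diag B (fun _ : B.ι => c' i) = c' i • 1 := B.b.ext fun j => by simp
    rw [weave_b, this, ← diag_mul, h2, Module.End.mul_apply, Module.End.mul_apply, diag_b,
      map_zsmul, map_zsmul]
    rfl

variable {B} in
/-- Two operators of the form `c ∂ c'` agree if their matrices do. -/
theorem sandwich_congr {c₁ c₁' c₂ c₂' : B.ι → ℤ}
    (h : ∀ i j, Rel B i j → c₁' i * c₁ j = c₂' i * c₂ j) :
    diag B c₁ * T.diff * diag B c₁' = diag B c₂ * T.diff * diag B c₂' := by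
  rw [weave_sandwich, weave_sandwich]
  exact weave_congr B h

variable {B} in
theorem sandwich_add_congr {c₁ c₁' c₂ c₂' c₃ c₃' c₄ c₄' : B.ι → ℤ}
    (h : ∀ i j, Rel B i j → c₁' i * c₁ j + c₂' i * c₂ j = c₃' i * c₃ j + c₄' i * c₄ j) :
    diag B c₁ * T.diff * diag B c₁' + diag B c₂ * T.diff * diag B c₂' =
      diag B c₃ * T.diff * diag B c₃' + diag B c₄ * T.diff * diag B c₄' := by
  simp only [weave_sandwich, ← weave_add]
  exact weave_congr B h

theorem diff_mul_diff : (T.diff : T.EndE) * T.diff = 0 := LinearMap.ext T.diff_sq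

/-- The sign of the homological degree. -/
noncomputable def sgn : T.EndE := diag B fun i => ((hdeg B i).negOnePow : ℤ)

theorem sgn_mul_sgn : sgn B * sgn B = 1 := by
  rw [sgn, diag_mul, ← diag_one B]
  congr 1
  ext i
  rw [Pi.mul_apply, Pi.one_apply, ← Units.val_mul, ← Int.negOnePow_add, ← two_mul,
    Int.negOnePow_two_mul, Units.val_one]

theorem sgn_mul_diff : sgn B * T.diff = -(T.diff * sgn B) := by
  have h : diag B (fun i => ((hdeg B i).negOnePow : ℤ)) * T.diff * diag B 1 =
      diag B 1 * T.diff * diag B (-fun i => ((hdeg B i).negOnePow : ℤ)) := by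
    refine sandwich_congr fun i j hij => ?_
    rw [hij.hdeg_eq, Int.negOnePow_sub, Int.negOnePow_one]
    simp
  rw [diag_one, one_mul, mul_one] at h
  have h2 : diag B (-fun i => ((hdeg B i).negOnePow : ℤ)) = -sgn B := by
    rw [eq_neg_iff_add_eq_zero, sgn, ← diag_add, neg_add_cancel]
    exact B.b.ext fun i => by simp
  rw [h2, mul_neg] at h
  exact h

/-! ### Regions -/

open Classical in
/-- The indicator function of the summands with socle in a region. -/
noncomputable def ind (R : Set (Deg t)) (i : B.ι) : ℤ := if sdeg B i ∈ R then 1 else 0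

theorem ind_of_mem {R : Set (Deg t)} {i : B.ι} (h : sdeg B i ∈ R) : ind B R i = 1 := if_pos h

theorem ind_of_notMem {R : Set (Deg t)} {i : B.ι} (h : sdeg B i ∉ R) : ind B R i = 0 := if_neg h

/-- The projection to the summands with socle in a region. -/
noncomputable def reg (R : Set (Deg t)) : T.EndE := diag B (ind B R)

theorem reg_mul_reg (R R' : Set (Deg t)) : reg B R * reg B R' = reg B (R ∩ R') := by
  classical
  rw [reg, reg, diag_mul]
  congr 1
  ext i
  simp only [ind, Pi.mul_apply, Set.mem_inter_iff]
  split_ifs <;> simp_all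

theorem reg_mul_of_subset {R R' : Set (Deg t)} (h : R ⊆ R') : reg B R * reg B R' = reg B R := by
  rw [reg_mul_reg, Set.inter_eq_left.mpr h]

theorem reg_mul_of_subset' {R R' : Set (Deg t)} (h : R ⊆ R') : reg B R' * reg B R = reg B R := by
  rw [reg_mul_reg, Set.inter_eq_right.mpr h]

theorem reg_idem (R : Set (Deg t)) : reg B R * reg B R = reg B R := reg_mul_of_subset B subset_rfl

theorem reg_mul_eq_zero {R R' : Set (Deg t)} (h : Disjoint R R') : reg B R * reg B R' = 0 := by
  rw [reg_mul_reg, h.inter_eq]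
  exact B.b.ext fun i => by simp [reg, ind]

theorem reg_union {R R' : Set (Deg t)} (h : Disjoint R R') :
    reg B (R ∪ R') = reg B R + reg B R' := by
  classical
  rw [reg, reg, reg, ← diag_add]
  congr 1
  ext i
  have : sdeg B i ∈ R → sdeg B i ∉ R' := fun hi => Set.disjoint_left.mp h hi
  simp only [ind, Pi.add_apply, Set.mem_union]
  split_ifs <;> simp_all

theorem sgn_mul_reg (R : Set (Deg t)) : sgn B * reg B R = reg B R * sgn B := diag_comm B _ _

/-- The differential induced on a region. -/
noncomputable def dreg (R : Set (Deg t)) : T.EndE := reg B R * T.diff * reg B R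

theorem reg_mul_dreg (R : Set (Deg t)) : reg B R * dreg B R = dreg B R := by
  rw [dreg, ← mul_assoc, ← mul_assoc, reg_idem]

theorem dreg_mul_reg (R : Set (Deg t)) : dreg B R * reg B R = dreg B R := by
  rw [dreg, mul_assoc, reg_idem]

theorem sgn_mul_dreg (R : Set (Deg t)) : sgn B * dreg B R = -(dreg B R * sgn B) := by
  rw [dreg, ← mul_assoc, ← mul_assoc, sgn_mul_reg, mul_assoc (reg B R), sgn_mul_diff, mul_neg,
    neg_mul, mul_assoc (reg B R * T.diff), ← sgn_mul_reg]
  simp only [mul_assoc]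

/-- A region that contains every degree between two of its elements. -/
def Convex (R : Set (Deg t)) : Prop := ∀ a ∈ R, ∀ c ∈ R, ∀ b, a ≤ b → b ≤ c → b ∈ R

/-- A convex region is the difference of two upward closed sets, hence a quotient of one
differential submodule by another, and it inherits a square-zero differential. -/
theorem dreg_mul_dreg {R : Set (Deg t)} (hR : Convex R) : dreg B R * dreg B R = 0 := by
  classical
  let U : Set (Deg t) := {b | ∃ a ∈ R, a ≤ b}
  have hU : R ⊆ U := fun a ha => ⟨a, ha, le_rfl⟩
  -- the differential of `R` lands in `U`, and elements of `U` outside of `R` do not return to `R`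
  have h1 : T.diff * reg B R = reg B U * T.diff * reg B R := by
    have := sandwich_congr (B := B) (c₁ := 1) (c₁' := ind B R) (c₂ := ind B U) (c₂' := ind B R)
      (fun i j hij => by
        by_cases h : sdeg B i ∈ R
        · rw [ind_of_mem B h, ind_of_mem B (show sdeg B j ∈ U from ⟨_, h, hij.sdeg_le⟩)]; rfl
        · rw [ind_of_notMem B h, zero_mul, zero_mul])
    rwa [diag_one, one_mul] at this
  have h2 : reg B R * T.diff * reg B U = reg B R * T.diff * reg B R := by
    refine sandwich_congr fun i j hij => ?_
    by_cases hj : sdeg B j ∈ R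
    · by_cases hi : sdeg B i ∈ R
      · rw [ind_of_mem B hi, ind_of_mem B (hU hi)]
      · rw [ind_of_notMem B hi, ind_of_notMem B (R := U)]
        rintro ⟨a, ha, hai⟩
        exact hi (hR a ha _ hj _ hai hij.sdeg_le)
    · rw [ind_of_notMem B hj, mul_zero, mul_zero]
  calc dreg B R * dreg B R = (reg B R * T.diff * reg B R) * (T.diff * reg B R) := by
        rw [dreg, mul_assoc _ (reg B R) (reg B R * _ * _), ← mul_assoc (reg B R) (reg B R * _),
          ← mul_assoc (reg B R) (reg B R), reg_idem]
        simp only [mul_assoc]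
    _ = reg B R * T.diff * (reg B U * T.diff * reg B R) := by
        rw [← h2]; simp only [mul_assoc]
    _ = 0 := by
        rw [← h1, mul_assoc, ← mul_assoc T.diff, diff_mul_diff, zero_mul, mul_zero]

end DMod

namespace DMod

variable {k : Type u} [Field k] {t : ℕ} {n : Fin t → ℕ} {T : DMod k n} (B : T.toGrMod.HBasis)

/-! ### Exactness of regions -/

theorem mem_of_basis_mem (N : Submodule (Ext k n)ᵐᵒᵖ T.carrier) (φ : T.EndE)
    (h : ∀ i, φ (B.b i) ∈ N) (x : T.carrier) : φ x ∈ N := by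
  have : (⊤ : Submodule (Ext k n)ᵐᵒᵖ T.carrier) ≤ N.comap φ := by
    rw [← B.b.span_eq, Submodule.span_le]
    rintro _ ⟨i, rfl⟩
    exact h i
  exact this trivial

/-- If a differential on a summand of a free module is exact modulo the variables in a set, it is
exact. -/
theorem exact_of_exact_mod (B : T.toGrMod.HBasis) (p δ : T.EndE) (hp : p * p = p) (hpδ : p * δ = δ) (hδ : δ * δ = 0)
    (W : Finset (Var n)) (h : ∀ x, p x = x → δ x ∈ T.idealMul (W : Set (Var n)) →
      ∃ y, x - δ y ∈ T.idealMul (W : Set (Var n))) (x : T.carrier) (hx : p x = x)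
    (hδx : δ x = 0) : ∃ y, x = δ y := by
  classical
  induction W using Finset.induction_on generalizing x with
  | empty =>
    have h0 : T.idealMul ((∅ : Finset (Var n)) : Set (Var n)) = ⊥ := by
      simp [GrMod.idealMul]
    obtain ⟨y, hy⟩ := h x hx (by rw [hδx]; exact Submodule.zero_mem _)
    rw [h0, Submodule.mem_bot, sub_eq_zero] at hy
    exact ⟨y, hy⟩
  | insert u W hu ih =>
    refine ih ?_ x hx hδx
    clear x hx hδx
    have hsplit : ∀ x ∈ T.idealMul ((insert u W : Finset (Var n)) : Set (Var n)),
        ∃ z, x - op (e k u) • z ∈ T.idealMul (W : Set (Var n)) := by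
      intro x hx
      have hx' := T.mem_span_of_mem_idealMul hx
      clear hx
      induction hx' using Submodule.span_induction with
      | mem x h =>
        obtain ⟨v, hv, x, rfl⟩ := h
        rw [Finset.coe_insert, Set.mem_insert_iff] at hv
        rcases hv with rfl | hv
        · exact ⟨x, by rw [sub_self]; exact Submodule.zero_mem _⟩
        · exact ⟨0, by rw [smul_zero, sub_zero]; exact T.e_smul_mem_idealMul hv x⟩
      | zero => exact ⟨0, by simp⟩
      | add x y _ _ hx hy =>
        obtain ⟨z, hz⟩ := hx
        obtain ⟨z', hz'⟩ := hy
        exact ⟨z + z', by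
          rw [smul_add, add_sub_add_comm]; exact Submodule.add_mem _ hz hz'⟩
      | smul c x _ hx =>
        obtain ⟨z, hz⟩ := hx
        refine ⟨c • z, ?_⟩
        rw [smul_comm, ← smul_sub]
        exact T.smul_deg_mem _ _ _ hz
    have hle : T.idealMul (W : Set (Var n)) ≤
        T.idealMul ((insert u W : Finset (Var n)) : Set (Var n)) :=
      T.idealMul_mono (by rw [Finset.coe_insert]; exact Set.subset_insert _ _)
    have hpx : ∀ y, p (δ y) = δ y := fun y => LinearMap.congr_fun hpδ y
    have hδδ : ∀ y, δ (δ y) = 0 := fun y => LinearMap.congr_fun hδ y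
    intro x hx hδx
    -- Modulo `W`, x = δy + e_u z. Applying δ gives e_u δ(pz) ≡ 0, so δ(pz) lies in the ideal of `W`
    -- and u, and the hypothesis applies a second time: pz = δy' + e_u z' modulo `W`. Since e_u² =
    -- 0, y + e_u y' is a primitive of x modulo `W`.
    obtain ⟨y, hy⟩ := h x hx (hle hδx)
    obtain ⟨z, hz⟩ := hsplit _ hy
    have hz' := T.map_idealMul T.toGrMod p hz
    rw [map_sub, map_sub, map_smul, hx, hpx] at hz'
    have h1 := T.map_idealMul T.toGrMod δ hz'
    rw [map_sub, map_sub, map_smul, hδδ, sub_zero] at h1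
    have h2 : op (e k u) • δ (p z) ∈ T.idealMul (W : Set (Var n)) := by
      have := Submodule.sub_mem _ hδx h1
      rwa [sub_sub_cancel] at this
    have h3 := B.mem_idealMul_insert (by simpa using hu) h2
    rw [← Finset.coe_insert] at h3
    obtain ⟨y', hy'⟩ := h (p z) (LinearMap.congr_fun hp z) h3
    obtain ⟨z', hz''⟩ := hsplit _ hy'
    refine ⟨y + op (e k u) • y', ?_⟩
    have h4 : op (e k u) • (p z - δ y') ∈ T.idealMul (W : Set (Var n)) := by
      have := Submodule.smul_mem _ (op (e k u)) hz''
      rwa [smul_sub, ← mul_smul (op (e k u)) (op (e k u)), ← op_mul, e_mul_self, op_zero,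
        zero_smul, sub_zero] at this
    have := Submodule.add_mem _ hz' h4
    rw [smul_sub, sub_add_sub_cancel] at this
    rwa [map_add, map_smul, ← sub_sub]

/-- A region of degrees defined by conditions on the coordinates other than the `r`-th. -/
def IndepOf (r : Fin t) (D : Set (Deg t)) : Prop := ∀ a b, (∀ i, i ≠ r → a i = b i) → a ∈ D → b ∈ D

/-- Modulo the variables outside the r-th factor, only monomials in the r-th factor survive in the
matrix of ∂, and these leave the other coordinates of the socle degree alone. So a region that
ignores the r-th coordinate is a direct summand of the reduced differential module. -/
theorem reg_diff_sub_mem {r : Fin t} {D : Set (Deg t)} (hD : IndepOf r D) (x : T.carrier) :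
    (reg B D * T.diff - T.diff * reg B D) x ∈ T.idealMul {v : Var n | v.1 = r}ᶜ := by
  refine mem_of_basis_mem B _ _ (fun i => ?_) x
  have h : (reg B D * T.diff - T.diff * reg B D) (B.b i) =
      (reg B D - ind B D i • 1) (T.diff (B.b i)) := by
    rw [LinearMap.sub_apply, Module.End.mul_apply, Module.End.mul_apply, reg, diag_b, map_zsmul]
    rfl
  rw [h]
  have hx := diff_b_mem B i
  generalize T.diff (B.b i) = y at hx
  induction hx using Submodule.span_induction with
  | mem y hy =>
    obtain ⟨j, l, rfl, hl⟩ := hy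
    by_cases hv : ∀ v ∈ l, v.1 = r
    · have hij : ind B D j = ind B D i := by
        have h1 := congrArg Prod.fst hl
        rw [list_sum_bigDeg] at h1
        simp only [Prod.fst_sub, Prod.fst_add, add_zero] at h1
        have h2 : ∀ s, s ≠ r → sdeg B j s = sdeg B i s := fun s hs => by
          have := congrFun h1 s
          rw [Pi.sub_apply, list_sum_varDeg_apply_eq_zero hv hs, sub_zero] at this
          simp [sdeg, this]
        classical
        have : sdeg B j ∈ D ↔ sdeg B i ∈ D :=
          ⟨hD _ _ h2, hD _ _ fun s hs => (h2 s hs).symm⟩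
        simp only [ind, this]
      rw [map_smul, LinearMap.sub_apply, reg, diag_b, hij]
      simp
    · push Not at hv
      obtain ⟨v, hv, hvr⟩ := hv
      exact T.map_idealMul T.toGrMod _ (T.varIdeal_smul_mem
        (Submodule.subset_span ⟨l, rfl, v, hvr, hv⟩) _)
  | zero => rw [map_zero]; exact Submodule.zero_mem _
  | add x y _ _ hx hy => rw [map_add]; exact Submodule.add_mem _ hx hy
  | smul a x _ hx => rw [LinearMap.map_smul_of_tower]; exact T.smul_deg_mem _ _ _ hx

/-- The differential on a region is exact. -/
def ExactReg (D : Set (Deg t)) : Prop :=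
  ∀ x, reg B D x = x → dreg B D x = 0 → ∃ y, x = dreg B D y

/-- By `reg_diff_sub_mem` the region is a direct summand of an exact module after reduction modulo
the variables of the other factors; `exact_of_exact_mod` puts these variables back. -/
theorem exactReg_of_exactOn {r : Fin t} (h : T.ExactOn {v : Var n | v.1 = r}) {D : Set (Deg t)}
    (hD : IndepOf r D) (hD' : Convex D) : ExactReg B D := by
  classical
  refine exact_of_exact_mod B (reg B D) (dreg B D) (reg_idem B D) (reg_mul_dreg B D)
    (dreg_mul_dreg B hD') (Finset.univ.filter fun v : Var n => v.1 ≠ r) ?_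
  have hset : ((Finset.univ.filter fun v : Var n => v.1 ≠ r : Finset (Var n)) : Set (Var n)) =
      {v : Var n | v.1 = r}ᶜ := by ext v; simp
  rw [hset]
  intro x hx hdx
  have hcomm := reg_diff_sub_mem B hD
  have h1 : T.diff x ∈ T.idealMul {v : Var n | v.1 = r}ᶜ := by
    have h2 := hcomm x
    have h3 : dreg B D x = reg B D (T.diff x) := by
      change reg B D (T.diff (reg B D x)) = _; rw [hx]
    rw [LinearMap.sub_apply, Module.End.mul_apply, Module.End.mul_apply, hx, ← h3] at h2
    have := Submodule.sub_mem _ hdx h2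
    rwa [sub_sub_cancel] at this
  obtain ⟨y, hy⟩ := h x h1
  refine ⟨y, ?_⟩
  have h2 := T.map_idealMul T.toGrMod (reg B D) hy
  rw [map_sub, hx] at h2
  have h3 := T.map_idealMul T.toGrMod (reg B D) (hcomm y)
  have h4 : reg B D ((reg B D * T.diff - T.diff * reg B D) y) =
      reg B D (T.diff y) - dreg B D y := by
    have : reg B D * (reg B D * T.diff - T.diff * reg B D) = reg B D * T.diff - dreg B D := by
      rw [mul_sub, ← mul_assoc, reg_idem, dreg, mul_assoc]
    exact LinearMap.congr_fun this y
  rw [h4] at h3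
  have := Submodule.add_mem _ h2 h3
  rwa [sub_add_sub_cancel] at this

/-! ### Quasi-isomorphisms between regions -/

/-- An operator that induces a quasi-isomorphism between two regions. -/
structure QuasiIso (X Y : Set (Deg t)) (f : T.EndE) : Prop where
  left : reg B Y * f = f
  right : f * reg B X = f
  comm : dreg B Y * f = f * dreg B X
  inj : ∀ u w, reg B X u = u → dreg B X u = 0 → f u = dreg B Y w → ∃ z, u = dreg B X z
  surj : ∀ v, reg B Y v = v → dreg B Y v = 0 →
    ∃ u w, reg B X u = u ∧ dreg B X u = 0 ∧ v - f u = dreg B Y w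

variable {B}

theorem quasiIso_reg {X : Set (Deg t)} : QuasiIso B X X (reg B X) where
  left := reg_idem B X
  right := reg_idem B X
  comm := by rw [dreg_mul_reg, reg_mul_dreg]
  inj u w hu _ h := ⟨w, by rw [← h, hu]⟩
  surj v hv hd := ⟨v, 0, hv, hd, by rw [hv, sub_self, map_zero]⟩

theorem QuasiIso.comp {X Y Z : Set (Deg t)} {f g : T.EndE} (hg : QuasiIso B Y Z g)
    (hf : QuasiIso B X Y f) : QuasiIso B X Z (g * f) where
  left := by rw [← mul_assoc, hg.left]
  right := by rw [mul_assoc, hf.right]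
  comm := by rw [← mul_assoc, hg.comm, mul_assoc, hf.comm, mul_assoc]
  inj u w hu hd h := by
    have h1 : dreg B Y (f u) = 0 := by
      have := LinearMap.congr_fun hf.comm u
      rw [Module.End.mul_apply, Module.End.mul_apply, hd, map_zero] at this
      exact this
    obtain ⟨z, hz⟩ := hg.inj (f u) w (LinearMap.congr_fun hf.left u) h1 h
    exact hf.inj u z hu hd hz
  surj v hv hd := by
    obtain ⟨u, w, hu, hdu, h⟩ := hg.surj v hv hd
    obtain ⟨u', w', hu', hdu', h'⟩ := hf.surj u hu hdu
    refine ⟨u', w + g w', hu', hdu', ?_⟩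
    have h1 : g (dreg B Y w') = dreg B Z (g w') := (LinearMap.congr_fun hg.comm w').symm
    rw [map_add, ← h, ← h1, ← h', map_sub, Module.End.mul_apply]
    abel

/-- The connecting homomorphism of a region decomposed in a lower and an upper part. -/
noncomputable def conn (B : T.toGrMod.HBasis) (X Y : Set (Deg t)) : T.EndE :=
  reg B Y * T.diff * reg B X * sgn B

/-- No arrow leads from the upper part back to the lower part, so the differential of the union is
block triangular. -/
theorem dreg_union {X Y : Set (Deg t)} (hXY : Disjoint X Y) (hup : ∀ a ∈ Y, ∀ b ∈ X, ¬ a ≤ b) :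
    dreg B (X ∪ Y) = dreg B X + dreg B Y + reg B Y * T.diff * reg B X := by
  have h0 : reg B X * T.diff * reg B Y = 0 := by
    have h := sandwich_congr (B := B) (c₁ := ind B X) (c₁' := ind B Y) (c₂ := 0) (c₂' := 0)
      (fun i j hij => by
        by_cases hi : sdeg B i ∈ Y
        · rw [ind_of_notMem B (R := X) fun hj => hup _ hi _ hj hij.sdeg_le]; simp
        · rw [ind_of_notMem B hi]; simp)
    have hz : diag B 0 = 0 := B.b.ext fun i => by simp
    rwa [hz, zero_mul, zero_mul] at h
  rw [dreg, reg_union B hXY, add_mul, add_mul, mul_add, mul_add, h0, dreg, dreg]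
  abel

/-- The union is an extension of the quotient `X` by the submodule `Y`, and its exactness forces the
connecting map to be an isomorphism on homology. The off-diagonal block of a square-zero
differential anticommutes with the diagonal ones; the factor `sgn` in `conn` repairs the sign. -/
theorem quasiIso_conn {X Y : Set (Deg t)} (hXY : Disjoint X Y)
    (hup : ∀ a ∈ Y, ∀ b ∈ X, ¬ a ≤ b) (hconv : Convex (X ∪ Y)) (hex : ExactReg B (X ∪ Y)) :
    QuasiIso B X Y (conn B X Y) := by
  have hdu := dreg_union (B := B) hXY hup
  have hX : reg B X * reg B (X ∪ Y) = reg B X := reg_mul_of_subset B Set.subset_union_left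
  have hY : reg B Y * reg B (X ∪ Y) = reg B Y := reg_mul_of_subset B Set.subset_union_right
  have hXY0 : reg B X * reg B Y = 0 := reg_mul_eq_zero B hXY
  have hYX0 : reg B Y * reg B X = 0 := reg_mul_eq_zero B hXY.symm
  have hXd : reg B X * dreg B (X ∪ Y) = dreg B X := by
    rw [hdu, mul_add, mul_add, reg_mul_dreg, dreg]
    simp only [dreg, ← mul_assoc, hXY0, zero_mul, add_zero]
  have hYd : reg B Y * dreg B (X ∪ Y) = dreg B Y + reg B Y * T.diff * reg B X := by
    rw [hdu, mul_add, mul_add, reg_mul_dreg, ← mul_assoc (reg B Y) (reg B Y * T.diff),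
      ← mul_assoc (reg B Y) (reg B Y), reg_idem]
    simp only [dreg, ← mul_assoc, hYX0, zero_mul, zero_add]
  -- the connecting map anticommutes with the differentials
  have hanti : dreg B Y * (reg B Y * T.diff * reg B X) = -(reg B Y * T.diff * reg B X * dreg B X) := by
    have hDX : dreg B (X ∪ Y) * reg B X = dreg B X + reg B Y * T.diff * reg B X := by
      rw [hdu, add_mul, add_mul, dreg_mul_reg, mul_assoc _ (reg B X) (reg B X), reg_idem,
        show dreg B Y * reg B X = 0 by rw [dreg, mul_assoc, hYX0, mul_zero], add_zero]
    have h1 : (dreg B Y + reg B Y * T.diff * reg B X) *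
        (dreg B X + reg B Y * T.diff * reg B X) = 0 := by
      rw [← hYd, ← hDX, mul_assoc, ← mul_assoc (dreg B _), dreg_mul_dreg B hconv, zero_mul,
        mul_zero]
    have e2 : dreg B Y * dreg B X = 0 := by
      rw [← reg_mul_dreg B X, ← mul_assoc, dreg, mul_assoc _ (reg B Y) (reg B X), hYX0, mul_zero,
        zero_mul]
    have e3 : reg B Y * T.diff * reg B X * (reg B Y * T.diff * reg B X) = 0 := by
      rw [← mul_assoc, ← mul_assoc, mul_assoc _ (reg B X) (reg B Y), hXY0, mul_zero, zero_mul,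
        zero_mul]
    rw [add_mul, mul_add, mul_add, e2, e3, zero_add, add_zero] at h1
    exact eq_neg_of_add_eq_zero_left h1
  have happ : ∀ u, conn B X Y u = (reg B Y * T.diff * reg B X) (sgn B u) := fun _ => rfl
  have hss : ∀ u, sgn B (sgn B u) = u := fun u => LinearMap.congr_fun (sgn_mul_sgn B) u
  have hsX : ∀ u, sgn B (reg B X u) = reg B X (sgn B u) :=
    fun u => LinearMap.congr_fun (sgn_mul_reg B X) u
  have hsd : ∀ u, sgn B (dreg B X u) = -dreg B X (sgn B u) :=
    fun u => LinearMap.congr_fun (sgn_mul_dreg B X) u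
  have hdu' : ∀ u, dreg B (X ∪ Y) u = dreg B X u + dreg B Y u +
      (reg B Y * T.diff * reg B X) u := fun u => LinearMap.congr_fun hdu u
  have hregu : ∀ u, reg B (X ∪ Y) u = reg B X u + reg B Y u :=
    fun u => LinearMap.congr_fun (reg_union B hXY) u
  have hYX0' : ∀ u, reg B Y (reg B X u) = 0 := fun u => LinearMap.congr_fun hYX0 u
  have hXY0' : ∀ u, reg B X (reg B Y u) = 0 := fun u => LinearMap.congr_fun hXY0 u
  have hdX : ∀ u, dreg B X u = dreg B X (reg B X u) :=
    fun u => (LinearMap.congr_fun (dreg_mul_reg B X) u).symm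
  have hdY : ∀ u, dreg B Y u = dreg B Y (reg B Y u) :=
    fun u => (LinearMap.congr_fun (dreg_mul_reg B Y) u).symm
  have hcX : ∀ u, (reg B Y * T.diff * reg B X) (reg B X u) = (reg B Y * T.diff * reg B X) u :=
    fun u => by
      have : reg B Y * T.diff * reg B X * reg B X = reg B Y * T.diff * reg B X := by
        rw [mul_assoc, reg_idem]
      exact LinearMap.congr_fun this u
  have hXX : ∀ u, reg B X (reg B X u) = reg B X u := fun u => LinearMap.congr_fun (reg_idem B X) u
  have hYY : ∀ u, reg B Y (reg B Y u) = reg B Y u := fun u => LinearMap.congr_fun (reg_idem B Y) u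
  refine ⟨?_, ?_, ?_, ?_, ?_⟩
  · rw [conn, ← mul_assoc, ← mul_assoc, ← mul_assoc, reg_idem]
  · rw [conn, mul_assoc, sgn_mul_reg, ← mul_assoc, mul_assoc _ (reg B X) (reg B X), reg_idem]
  · rw [conn, ← mul_assoc, hanti, neg_mul, mul_assoc, mul_assoc _ (sgn B), sgn_mul_dreg, mul_neg]
  · intro u w hu hd h
    have hu' : reg B X (sgn B u) = sgn B u := by rw [← hsX, hu]
    have hd' : dreg B X (sgn B u) = 0 := by rw [← neg_eq_zero, ← hsd, hd, map_zero]
    -- This difference is a cycle of the union; the component in `X` of a primitive of it yields, up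
    -- to sign, a primitive of u.
    obtain ⟨z, hz⟩ := hex (sgn B u - reg B Y w)
      (by rw [hregu, map_sub, map_sub, hu', hXY0', ← hu', hYX0', hYY, hu']; abel)
      (by
        have e1 : (reg B Y * T.diff * reg B X) (reg B Y w) = 0 := by
          rw [← hcX, hXY0', map_zero]
        rw [hdu', map_sub, map_sub, map_sub, hd', hdX (reg B Y w), hXY0', map_zero,
          hdY (sgn B u), ← hu', hYX0', map_zero, hu', ← hdY, ← h, ← happ, e1]
        abel)
    refine ⟨-sgn B z, ?_⟩
    have h1 := congrArg (reg B X) hz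
    rw [map_sub, hXY0', sub_zero, hu', show reg B X (dreg B (X ∪ Y) z) = dreg B X z from
      LinearMap.congr_fun hXd z] at h1
    rw [map_neg, ← hsd, ← h1, hss]
  · intro v hv hd
    -- The cycle v of `Y` bounds in the union. The component in `X` of the primitive is the required
    -- cycle, and the component in `Y` supplies the correcting boundary.
    obtain ⟨z, hz⟩ := hex v
      (by rw [hregu, hv, ← hv, hXY0', hv, zero_add])
      (by rw [hdu', hd, hdX, ← hcX, ← hv, hXY0', map_zero, map_zero]; abel)
    have h1 := congrArg (reg B X) hz
    rw [show reg B X (dreg B (X ∪ Y) z) = dreg B X z from LinearMap.congr_fun hXd z, ← hv,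
      hXY0'] at h1
    have h2 := congrArg (reg B Y) hz
    rw [hv, show reg B Y (dreg B (X ∪ Y) z) = dreg B Y z + (reg B Y * T.diff * reg B X) z from
      LinearMap.congr_fun hYd z] at h2
    refine ⟨sgn B (reg B X z), z, by rw [hsX, hXX], ?_, ?_⟩
    · rw [← neg_eq_zero, ← hsd, ← hdX, ← h1, map_zero]
    · rw [happ, hss, hcX, h2, add_sub_cancel_right]

end DMod

namespace DMod

variable {k : Type u} [Field k] {t : ℕ} {n : Fin t → ℕ} {T : DMod k n} (B : T.toGrMod.HBasis)

/-! ### The corner maps -/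

/-- The operator is homogeneous of degree `(0; s)`. -/
def HasShift (f : T.EndE) (s : ℤ) : Prop := ∀ g x, x ∈ T.deg g → f x ∈ T.deg (g + (0, s))

theorem HasShift.mul {f f' : T.EndE} {s s' : ℤ} (h : HasShift f s) (h' : HasShift f' s') :
    HasShift (f * f') (s + s') := by
  intro g x hx
  have := h _ _ (h' g x hx)
  have e : g + (0, s') + (0, s) = g + ((0, s + s') : Deg t × ℤ) := by
    rw [add_assoc]; exact congrArg (g + ·) (Prod.ext (add_zero _) (add_comm _ _))
  rwa [e] at this

theorem HasShift.add {f f' : T.EndE} {s : ℤ} (h : HasShift f s) (h' : HasShift f' s) :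
    HasShift (f + f') s := fun g x hx => Submodule.add_mem _ (h g x hx) (h' g x hx)

theorem hasShift_zero (s : ℤ) : HasShift (0 : T.EndE) s := fun _ _ _ => Submodule.zero_mem _

theorem hasShift_diff : HasShift (T.diff : T.EndE) (-1) := T.diff_mem

theorem hasShift_diag (c : B.ι → ℤ) : HasShift (diag B c) 0 := by
  intro g x hx
  have : ((0, 0) : Deg t × ℤ) = 0 := rfl
  rw [this, add_zero]
  exact diag_mem B c g x hx

/-- The region of the degrees `a` with `a_i ≥ c_i` for the first `r` indices `i` and `a_i < c_i`
for the others. -/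
def quad (c : Deg t) (r : ℕ) : Set (Deg t) :=
  {a | ∀ i : Fin t, (i.1 < r → c i ≤ a i) ∧ (r ≤ i.1 → a i < c i)}

/-- The homotopy is the signed projection to the overlap of the source for c' with the target for c,
that is, to the strip between the two walls of index r. -/
theorem conn_homotopy {c c' : Deg t} (hc : c ≤ c') (r : ℕ) (hr : r < t) :
    reg B (quad c (r + 1)) * conn B (quad c' r) (quad c' (r + 1)) -
      conn B (quad c r) (quad c (r + 1)) * reg B (quad c r) * reg B (quad c' r) =
    dreg B (quad c (r + 1)) * (reg B (quad c' r ∩ quad c (r + 1)) * sgn B) +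
      reg B (quad c' r ∩ quad c (r + 1)) * sgn B * dreg B (quad c' r) := by
  set X := quad c' r
  set Y := quad c' (r + 1)
  set x := quad c r
  set y := quad c (r + 1)
  -- For a in `X`, b in `y` and a ≤ b, both sides have entry 1: b lies in exactly one of `Y` and
  -- `X`, and a in exactly one of `x` and `y`. All other entries are 0.
  have key : reg B (y ∩ Y) * T.diff * reg B X + reg B (X ∩ y) * T.diff * reg B X =
      reg B y * T.diff * reg B (x ∩ X) + reg B y * T.diff * reg B (X ∩ y) := by
    refine sandwich_add_congr fun i j hij => ?_
    have hle := hij.sdeg_le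
    generalize hi : sdeg B i = a at hle
    generalize hj : sdeg B j = b at hle
    classical
    simp only [ind, hi, hj]
    have hmem : ∀ (c : Deg t) (r : ℕ) a, a ∈ quad c r ↔
      ∀ i : Fin t, (i.1 < r → c i ≤ a i) ∧ (r ≤ i.1 → a i < c i) := fun _ _ _ => Iff.rfl
    have hle' : ∀ s, a s ≤ b s := hle
    have hc' : ∀ s, c s ≤ c' s := hc
    by_cases ha : a ∈ X <;> by_cases hb : b ∈ y
    · have ha' := (hmem _ _ _).mp ha
      have hb' := (hmem _ _ _).mp hb
      -- the position of `b` and of `a` relative to the two walls of index `r`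
      have h1 : b ∈ Y ↔ c' ⟨r, hr⟩ ≤ b ⟨r, hr⟩ := by
        refine ⟨fun h => ((hmem _ _ _).mp h ⟨r, hr⟩).1 (Nat.lt_succ_self r), fun h => ?_⟩
        refine (hmem _ _ _).mpr fun i => ⟨fun hi => ?_, fun hi => ?_⟩
        · rcases Nat.lt_succ_iff_lt_or_eq.mp hi with hi | hi
          · exact ((ha' i).1 hi).trans (hle' i)
          · obtain rfl : i = ⟨r, hr⟩ := Fin.ext hi
            exact h
        · exact ((hb' i).2 hi).trans_le (hc' i)
      have h2 : b ∈ X ↔ ¬ c' ⟨r, hr⟩ ≤ b ⟨r, hr⟩ := by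
        refine ⟨fun h => not_le.mpr (((hmem _ _ _).mp h ⟨r, hr⟩).2 le_rfl), fun h => ?_⟩
        refine (hmem _ _ _).mpr fun i => ⟨fun hi => ((ha' i).1 hi).trans (hle' i), fun hi => ?_⟩
        rcases Nat.eq_or_lt_of_le hi with hi | hi
        · obtain rfl : i = ⟨r, hr⟩ := Fin.ext hi.symm
          exact not_le.mp h
        · exact ((hb' i).2 hi).trans_le (hc' i)
      have h3 : a ∈ y ↔ c ⟨r, hr⟩ ≤ a ⟨r, hr⟩ := by
        refine ⟨fun h => ((hmem _ _ _).mp h ⟨r, hr⟩).1 (Nat.lt_succ_self r), fun h => ?_⟩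
        refine (hmem _ _ _).mpr fun i => ⟨fun hi => ?_, fun hi => ?_⟩
        · rcases Nat.lt_succ_iff_lt_or_eq.mp hi with hi | hi
          · exact (hc' i).trans ((ha' i).1 hi)
          · obtain rfl : i = ⟨r, hr⟩ := Fin.ext hi
            exact h
        · exact (hle' i).trans_lt ((hb' i).2 hi)
      have h4 : a ∈ x ↔ ¬ c ⟨r, hr⟩ ≤ a ⟨r, hr⟩ := by
        refine ⟨fun h => not_le.mpr (((hmem _ _ _).mp h ⟨r, hr⟩).2 le_rfl), fun h => ?_⟩
        refine (hmem _ _ _).mpr fun i => ⟨fun hi => (hc' i).trans ((ha' i).1 hi), fun hi => ?_⟩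
        rcases Nat.eq_or_lt_of_le hi with hi | hi
        · obtain rfl : i = ⟨r, hr⟩ := Fin.ext hi.symm
          exact not_le.mp h
        · exact (hle' i).trans_lt ((hb' i).2 hi)
      simp only [Set.mem_inter_iff, ha, hb, h1, h2, h3, h4, and_true, true_and]
      split_ifs <;> simp_all
    all_goals simp [ha, hb]
  have e1 : reg B (X ∩ y) * sgn B * dreg B X = -(reg B (X ∩ y) * T.diff * reg B X * sgn B) := by
    rw [mul_assoc, sgn_mul_dreg, mul_neg, dreg, ← mul_assoc, ← mul_assoc, ← mul_assoc,
      reg_mul_of_subset B Set.inter_subset_left]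
  have e2 : dreg B y * (reg B (X ∩ y) * sgn B) = reg B y * T.diff * reg B (X ∩ y) * sgn B := by
    rw [dreg, ← mul_assoc, mul_assoc _ (reg B y) (reg B (X ∩ y)),
      reg_mul_of_subset' B Set.inter_subset_right]
  have e3 : reg B y * conn B X Y = reg B (y ∩ Y) * T.diff * reg B X * sgn B := by
    rw [conn, ← mul_assoc, ← mul_assoc, ← mul_assoc, reg_mul_reg]
  have e4 : conn B x y * reg B x * reg B X = reg B y * T.diff * reg B (x ∩ X) * sgn B := by
    rw [conn, mul_assoc, mul_assoc, reg_mul_reg, sgn_mul_reg, ← mul_assoc,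
      mul_assoc _ (reg B x) (reg B (x ∩ X)), reg_mul_of_subset' B Set.inter_subset_left]
  rw [e1, e2, e3, e4, ← sub_eq_add_neg, ← sub_mul, ← sub_mul]
  congr 1
  rw [sub_eq_sub_iff_add_eq_add, key, add_comm]

/-- The composition of the connecting homomorphisms that lead from the lower quadrant to the region
`quad c r`. -/
noncomputable def corner (c : Deg t) : ℕ → T.EndE
  | 0 => reg B (quad c 0)
  | r + 1 => conn B (quad c r) (quad c (r + 1)) * corner c r

theorem hasShift_conn (X Y : Set (Deg t)) : HasShift (conn B X Y) (-1) :=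
  (((hasShift_diag B _).mul hasShift_diff).mul (hasShift_diag B _)).mul (hasShift_diag B _)

theorem hasShift_corner (c : Deg t) (r : ℕ) : HasShift (corner B c r) (-r) := by
  induction r with
  | zero => exact hasShift_diag B _
  | succ r ih =>
    have := (hasShift_conn B (quad c r) (quad c (r + 1))).mul ih
    rwa [show (-1 : ℤ) + -(r : ℤ) = -((r + 1 : ℕ) : ℤ) by push_cast; ring] at this

/-- The two regions differ only in the side of the wall of index r, so their union carries no
condition on that coordinate. This is what makes property (4) for the r-th factor applicable. -/
theorem quad_union_mem {c : Deg t} {r : ℕ} {a : Deg t} :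
    a ∈ quad c r ∪ quad c (r + 1) ↔
      ∀ i : Fin t, (i.1 < r → c i ≤ a i) ∧ (r + 1 ≤ i.1 → a i < c i) := by
  constructor
  · rintro (h | h) i
    · exact ⟨(h i).1, fun hi => (h i).2 (by omega)⟩
    · exact ⟨fun hi => (h i).1 (by omega), (h i).2⟩
  · intro h
    by_cases hr : r < t
    · rcases lt_or_ge (a ⟨r, hr⟩) (c ⟨r, hr⟩) with h' | h'
      · refine Or.inl fun i => ⟨(h i).1, fun hi => ?_⟩
        rcases Nat.eq_or_lt_of_le hi with hi | hi
        · obtain rfl : i = ⟨r, hr⟩ := Fin.ext hi.symm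
          exact h'
        · exact (h i).2 hi
      · refine Or.inr fun i => ⟨fun hi => ?_, (h i).2⟩
        rcases Nat.lt_succ_iff_lt_or_eq.mp hi with hi | hi
        · exact (h i).1 hi
        · obtain rfl : i = ⟨r, hr⟩ := Fin.ext hi
          exact h'
    · exact Or.inl fun i => ⟨(h i).1, fun hi => absurd i.2 (by omega)⟩

theorem quasiIso_conn_quad (hT : ∀ r : Fin t, T.ExactOn {v : Var n | v.1 = r}) (c : Deg t) (r : ℕ)
    (hr : r < t) :
    QuasiIso B (quad c r) (quad c (r + 1)) (conn B (quad c r) (quad c (r + 1))) := by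
  refine quasiIso_conn ?_ ?_ ?_ ?_
  · refine Set.disjoint_left.mpr fun a ha ha' => ?_
    exact absurd ((ha ⟨r, hr⟩).2 le_rfl) (not_lt.mpr ((ha' ⟨r, hr⟩).1 (Nat.lt_succ_self r)))
  · intro a ha b hb hab
    exact absurd ((hb ⟨r, hr⟩).2 le_rfl)
      (not_lt.mpr (((ha ⟨r, hr⟩).1 (Nat.lt_succ_self r)).trans (hab _)))
  · intro a ha d hd b hab hbd
    rw [quad_union_mem] at ha hd ⊢
    exact fun i => ⟨fun hi => ((ha i).1 hi).trans (hab i), fun hi => (hbd i).trans_lt ((hd i).2 hi)⟩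
  · refine exactReg_of_exactOn B (hT ⟨r, hr⟩) ?_ ?_
    · intro a b hab ha
      rw [quad_union_mem] at ha ⊢
      refine fun i => ⟨fun hi => ?_, fun hi => ?_⟩
      · rw [← hab i (fun h => by rw [h] at hi; exact absurd hi (lt_irrefl r))]
        exact (ha i).1 hi
      · rw [← hab i (fun h => by rw [h] at hi; exact absurd hi (Nat.not_succ_le_self r))]
        exact (ha i).2 hi
    · intro a ha d hd b hab hbd
      rw [quad_union_mem] at ha hd ⊢
      exact fun i =>
        ⟨fun hi => ((ha i).1 hi).trans (hab i), fun hi => (hbd i).trans_lt ((hd i).2 hi)⟩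

theorem quasiIso_corner (hT : ∀ r : Fin t, T.ExactOn {v : Var n | v.1 = r}) (c : Deg t) (r : ℕ)
    (hr : r ≤ t) : QuasiIso B (quad c 0) (quad c r) (corner B c r) := by
  induction r with
  | zero => exact quasiIso_reg
  | succ r ih =>
    exact QuasiIso.comp (quasiIso_conn_quad B hT c r hr) (ih (by omega))

theorem quad_zero_mono {c c' : Deg t} (h : c ≤ c') : quad c 0 ⊆ quad c' 0 :=
  fun _ ha i => ⟨fun hi => absurd hi (Nat.not_lt_zero _), fun hi => ((ha i).2 hi).trans_le (h i)⟩

theorem quad_top_mono {c c' : Deg t} (h : c ≤ c') : quad c' t ⊆ quad c t :=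
  fun _ ha i => ⟨fun hi => (h i).trans ((ha i).1 hi), fun hi => absurd i.2 (by omega)⟩

/-- The corner maps are compatible up to homotopy. -/
theorem corner_homotopy (hT : ∀ r : Fin t, T.ExactOn {v : Var n | v.1 = r}) {c c' : Deg t}
    (hc : c ≤ c') (r : ℕ) (hr : r ≤ t) :
    ∃ H : T.EndE, HasShift H (1 - r) ∧ reg B (quad c r) * H = H ∧
      reg B (quad c r) * corner B c' r - corner B c r =
        dreg B (quad c r) * H + H * dreg B (quad c' 0) := by
  induction r with
  | zero =>
    refine ⟨0, hasShift_zero _, mul_zero _, ?_⟩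
    rw [mul_zero, zero_mul, add_zero, corner, corner, reg_mul_of_subset B (quad_zero_mono hc),
      sub_self]
  | succ r ih =>
    obtain ⟨H, hH, hreg, h⟩ := ih (by omega)
    have hq := quasiIso_corner B hT c' r (by omega)
    have hδ := quasiIso_conn_quad B hT c r hr
    have hK := conn_homotopy B hc r hr
    have hKs : HasShift (reg B (quad c' r ∩ quad c (r + 1)) * sgn B) 0 :=
      (hasShift_diag B _).mul (hasShift_diag B _)
    have hKr : reg B (quad c (r + 1)) * (reg B (quad c' r ∩ quad c (r + 1)) * sgn B) =
        reg B (quad c' r ∩ quad c (r + 1)) * sgn B := by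
      rw [← mul_assoc, reg_mul_of_subset' B Set.inter_subset_right]
    generalize reg B (quad c' r ∩ quad c (r + 1)) * sgn B = K at hK hKs hKr
    -- The usual homotopy for a composition: the new one precomposed with the old map, plus the old
    -- one postcomposed with the new map.
    refine ⟨K * corner B c' r + conn B (quad c r) (quad c (r + 1)) * H, ?_, ?_, ?_⟩
    · refine HasShift.add ?_ ?_
      · have := hKs.mul (hasShift_corner B c' r)
        rwa [show (0 : ℤ) + -(r : ℤ) = 1 - ((r + 1 : ℕ) : ℤ) by push_cast; ring] at this
      · have := (hasShift_conn B (quad c r) (quad c (r + 1))).mul hH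
        rwa [show (-1 : ℤ) + (1 - (r : ℤ)) = 1 - ((r + 1 : ℕ) : ℤ) by push_cast; ring] at this
    · rw [mul_add, ← mul_assoc, ← mul_assoc, hδ.left, hKr]
    · have h1 : reg B (quad c (r + 1)) * conn B (quad c' r) (quad c' (r + 1)) =
          conn B (quad c r) (quad c (r + 1)) * reg B (quad c r) * reg B (quad c' r) +
            (dreg B (quad c (r + 1)) * K + K * dreg B (quad c' r)) := by
        rw [← hK]; abel
      have h2 : reg B (quad c r) * corner B c' r =
          corner B c r + (dreg B (quad c r) * H + H * dreg B (quad c' 0)) := by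
        rw [← h]; abel
      have h3 : conn B (quad c r) (quad c (r + 1)) * (dreg B (quad c r) * H) =
          dreg B (quad c (r + 1)) * (conn B (quad c r) (quad c (r + 1)) * H) := by
        rw [← mul_assoc, ← hδ.comm, mul_assoc]
      have h4 : K * dreg B (quad c' r) * corner B c' r =
          K * corner B c' r * dreg B (quad c' 0) := by
        rw [mul_assoc, hq.comm, mul_assoc]
      rw [corner, corner, ← mul_assoc, h1, add_mul, add_mul, mul_assoc _ (reg B (quad c' r)),
        hq.left, mul_assoc _ (reg B (quad c r)), h2, h4, mul_add, mul_add, h3, mul_add, add_mul]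
      simp only [mul_assoc]
      abel

end DMod

/-! ### Čech complexes of a family of sets -/

/-- The pairs of a face and a face of it come in pairs with the same composition. -/
theorem sum_eq_zero_of_faces {N : Type*} [AddCommGroup N] {m : ℕ}
    (Φ : Fin (m + 2) → Fin (m + 1) → N)
    (hΦ : ∀ i j : Fin (m + 1), i ≤ j → Φ j.succ i + Φ i.castSucc j = 0) :
    ∑ p : Fin (m + 2) × Fin (m + 1), Φ p.1 p.2 = 0 := by
  -- The involution exchanges the two orders in which the same two entries of a tuple can be
  -- removed.
  let inv : Fin (m + 2) × Fin (m + 1) → Fin (m + 2) × Fin (m + 1) := fun p =>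
    if h : p.2.castSucc < p.1 then (p.2.castSucc, p.1.pred (Fin.ne_zero_of_lt h)) else
      (p.2.succ, p.1.castPred (fun h' => h (by rw [h']; exact Fin.castSucc_lt_last _)))
  have h1 : ∀ i j : Fin (m + 1), i ≤ j → inv (j.succ, i) = (i.castSucc, j) := fun i j hij =>
    (dif_pos (Fin.castSucc_lt_succ_iff.mpr hij)).trans (Prod.ext rfl (Fin.pred_succ _ (h := Fin.succ_ne_zero _)))
  have h2 : ∀ i j : Fin (m + 1), i ≤ j → inv (i.castSucc, j) = (j.succ, i) := fun i j hij =>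
    (dif_neg (not_lt.mpr (Fin.castSucc_le_castSucc_iff.mpr hij))).trans
      (Prod.ext rfl (Fin.castPred_castSucc))
  have h3 : ∀ p : Fin (m + 2) × Fin (m + 1), ∃ i j : Fin (m + 1), i ≤ j ∧
      (p = (j.succ, i) ∨ p = (i.castSucc, j)) := by
    rintro ⟨q, r⟩
    by_cases h : r.castSucc < q
    · obtain ⟨j, rfl⟩ := Fin.exists_succ_eq.mpr (Fin.ne_zero_of_lt h)
      exact ⟨r, j, Fin.castSucc_lt_succ_iff.mp h, Or.inl rfl⟩
    · have hq : q ≠ Fin.last _ := fun h' => h (by rw [h']; exact Fin.castSucc_lt_last _)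
      obtain ⟨i, rfl⟩ := Fin.exists_castSucc_eq.mpr hq
      exact ⟨i, r, Fin.castSucc_le_castSucc_iff.mp (not_lt.mp h), Or.inr rfl⟩
  refine Finset.sum_involution (fun p _ => inv p) ?_ ?_ (fun _ _ => Finset.mem_univ _) ?_
  · intro p _
    obtain ⟨i, j, hij, rfl | rfl⟩ := h3 p
    · rw [h1 i j hij]; exact hΦ i j hij
    · rw [h2 i j hij, add_comm]; exact hΦ i j hij
  · intro p _ _ h
    obtain ⟨i, j, hij, rfl | rfl⟩ := h3 p
    · rw [h1 i j hij, Prod.mk.injEq] at h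
      exact (Fin.castSucc_lt_succ_iff.mpr hij).ne h.1
    · rw [h2 i j hij, Prod.mk.injEq] at h
      exact (Fin.castSucc_lt_succ_iff.mpr hij).ne' h.1
  · intro p _
    obtain ⟨i, j, hij, rfl | rfl⟩ := h3 p
    · rw [h1 i j hij, h2 i j hij]
    · rw [h2 i j hij, h1 i j hij]

/-- A covariant functor from the subsets of a type to abelian groups. -/
structure Coeff (V : Type*) where
  obj : Set V → Type u
  [grp : ∀ U, AddCommGroup (obj U)]
  res : ∀ {U U' : Set V}, U ⊆ U' → obj U →+ obj U'
  res_self : ∀ {U : Set V} (h : U ⊆ U) (x : obj U), res h x = x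
  res_res : ∀ {U U' U'' : Set V} (h : U ⊆ U') (h' : U' ⊆ U'') (x : obj U),
    res h' (res h x) = res (h.trans h') x

namespace Coeff

attribute [instance] grp

variable {V : Type*} {I : Type*} (u : I → Set V)

/-- The union of the sets indexed by a tuple. -/
def cover {m : ℕ} (s : Fin m → I) : Set V := {v | ∃ q, v ∈ u (s q)}

theorem cover_comp {m m' : ℕ} (s : Fin m → I) (a : Fin m' → Fin m) :
    cover u (s ∘ a) ⊆ cover u s := fun _ ⟨q, hq⟩ => ⟨a q, hq⟩

variable (F : Coeff.{u} V)

/-- Cochains on tuples of length `m`. -/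
abbrev C (m : ℕ) := ∀ s : Fin m → I, F.obj (cover u s)

/-- The Čech differential. -/
def d {m : ℕ} (f : F.C u m) : F.C u (m + 1) := fun s =>
  ∑ q : Fin (m + 1), (-1 : ℤ) ^ (q : ℕ) • F.res (cover_comp u s q.succAbove) (f (s ∘ q.succAbove))

theorem d_sub {m : ℕ} (f g : F.C u m) : F.d u (f - g) = F.d u f - F.d u g := by
  funext s
  simp only [d, Pi.sub_apply, map_sub, smul_sub, Finset.sum_sub_distrib]

theorem d_add {m : ℕ} (f g : F.C u m) : F.d u (f + g) = F.d u f + F.d u g := by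
  funext s
  simp only [d, Pi.add_apply, map_add, smul_add, Finset.sum_add_distrib]

theorem res_congr {m : ℕ} (f : F.C u m) {s s' : Fin m → I} (hs : s = s') {U : Set V}
    (h : cover u s ⊆ U) (h' : cover u s' ⊆ U) : F.res h (f s) = F.res h' (f s') := by
  subst hs; rfl

theorem d_d {m : ℕ} (f : F.C u m) : F.d u (F.d u f) = 0 := by
  funext s
  have h1 : F.d u (F.d u f) s = ∑ p : Fin (m + 2) × Fin (m + 1),
      ((-1 : ℤ) ^ ((p.1 : ℕ) + (p.2 : ℕ))) • F.res (cover_comp u s (p.1.succAbove ∘ p.2.succAbove))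
        (f (s ∘ p.1.succAbove ∘ p.2.succAbove)) := by
    rw [Fintype.sum_prod_type, d]
    refine Finset.sum_congr rfl fun q _ => ?_
    rw [d, map_sum, Finset.smul_sum]
    refine Finset.sum_congr rfl fun r _ => ?_
    rw [map_zsmul, res_res, smul_smul, ← pow_add]
    rfl
  rw [h1, Pi.zero_apply]
  have key : ∀ (i j : Fin (m + 1)), i ≤ j →
      (j.succ.succAbove ∘ i.succAbove : Fin m → Fin (m + 2)) =
        i.castSucc.succAbove ∘ j.succAbove := by
    intro i j hij
    funext x
    simp only [Function.comp_apply, Fin.succAbove, Fin.lt_def, Fin.le_def, Fin.ext_iff] at *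
    split_ifs <;> simp_all <;> omega
  refine sum_eq_zero_of_faces (fun q r => ((-1 : ℤ) ^ ((q : ℕ) + (r : ℕ))) •
    F.res (cover_comp u s (q.succAbove ∘ r.succAbove)) (f (s ∘ q.succAbove ∘ r.succAbove))) ?_
  intro i j hij
  simp only [Fin.val_succ, Fin.val_castSucc]
  rw [F.res_congr u f (congrArg (s ∘ ·) (key i j hij)) _
    (cover_comp u s (i.castSucc.succAbove ∘ j.succAbove)), ← add_smul,
    show (-1 : ℤ) ^ ((j : ℕ) + 1 + i) + (-1) ^ ((i : ℕ) + j) = 0 by ring, zero_smul]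

theorem cover_cons {m : ℕ} (x : I) (s : Fin m → I) :
    cover u (Fin.cons x s : Fin (m + 1) → I) = u x ∪ cover u s := by
  ext v
  constructor
  · rintro ⟨q, hq⟩
    refine Fin.cases (fun h => Or.inl h) (fun q h => Or.inr ⟨q, h⟩) q hq
  · rintro (h | ⟨q, hq⟩)
    · exact ⟨0, h⟩
    · exact ⟨q.succ, hq⟩

theorem cover_subset_cons {m : ℕ} (x : I) (s : Fin m → I) :
    cover u s ⊆ cover u (Fin.cons x s : Fin (m + 1) → I) := by
  rw [cover_cons]; exact Set.subset_union_right

/-- Apart from the face that forgets x, what remains is the Čech differential of s ↦ f(x, s). This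
is the identity behind every cone construction below. -/
theorem d_cons {m : ℕ} (f : F.C u (m + 1)) (x : I) (s : Fin (m + 1) → I) :
    F.d u f (Fin.cons x s) = F.res (cover_subset_cons u x s) (f s) -
      ∑ q : Fin (m + 1), (-1 : ℤ) ^ (q : ℕ) •
        F.res (by rw [cover_cons, cover_cons]; exact Set.union_subset_union_right _ (cover_comp u s _))
          (f (Fin.cons x (s ∘ q.succAbove))) := by
  rw [d, Fin.sum_univ_succ, sub_eq_add_neg, ← Finset.sum_neg_distrib]
  congr 1
  · rw [Fin.val_zero, pow_zero, one_smul]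
    exact F.res_congr u f (by funext q; simp) _ _
  · refine Finset.sum_congr rfl fun q _ => ?_
    rw [Fin.val_succ, pow_succ, mul_neg_one, neg_smul]
    congr 2
    refine F.res_congr u f ?_ _ _
    funext r
    refine Fin.cases ?_ (fun r => ?_) r
    · simp
    · simp [Fin.succ_succAbove_succ]

/-- The coefficients `U ↦ F(U₀ ∪ U)`. -/
def translate (U₀ : Set V) : Coeff.{u} V where
  obj U := F.obj (U₀ ∪ U)
  res h := F.res (Set.union_subset_union_right U₀ h)
  res_self _ x := F.res_self _ x
  res_res _ _ x := F.res_res _ _ x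

/-- In degrees at least the number of sets of a cover, the Čech cohomology vanishes. -/
theorem exact_of_card_le (J : Finset I) (m : ℕ) (hm : J.card ≤ m) (f : F.C u (m + 1))
    (hf : ∀ s, (∀ q, s q ∈ J) → F.d u f s = 0) :
    ∃ g : F.C u m, ∀ s, (∀ q, s q ∈ J) → F.d u g s = f s := by
  classical
  induction J using Finset.induction_on generalizing F m with
  | empty => exact ⟨0, fun s hs => absurd (hs 0) (Finset.notMem_empty _)⟩
  | insert x J hx ih =>
    rw [Finset.card_insert_of_notMem hx] at hm
    obtain ⟨m, rfl⟩ : ∃ m', m = m' + 1 := ⟨m - 1, by omega⟩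
    obtain ⟨g₁, hg₁⟩ := ih F (m + 1) (by omega) f
      (fun s hs => hf s fun q => Finset.mem_insert_of_mem (hs q))
    -- subtract a coboundary so that `f` vanishes on the tuples in `J`
    set f₁ : F.C u (m + 1 + 1) := f - F.d u g₁ with hf₁
    have hf₁0 : ∀ s, (∀ q, s q ∈ J) → f₁ s = 0 := fun s hs => by
      rw [hf₁, Pi.sub_apply, hg₁ s hs, sub_self]
    have hdf₁ : ∀ s, (∀ q, s q ∈ insert x J) → F.d u f₁ s = 0 := fun s hs => by
      rw [hf₁, d_sub, d_d, sub_zero, hf s hs]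
    -- The cochain s ↦ f₁(x, s) has coefficients in F(u x ∪ -). Because f₁ is a cocycle that
    -- vanishes on `J`, it is a cocycle there, and the induction hypothesis applies to `F'` in one
    -- degree less.
    let F' := F.translate (u x)
    let h : F'.C u (m + 1) := fun s => F.res (cover_cons u x s).subset (f₁ (Fin.cons x s))
    have hdh : ∀ s, (∀ q, s q ∈ insert x J) →
        F'.d u h s = F.res (Set.subset_union_right (s := u x)) (f₁ s) := by
      intro s hs
      have h1 := hdf₁ (Fin.cons x s) (fun q => Fin.cases (Finset.mem_insert_self x J) hs q)
      rw [d_cons, sub_eq_zero] at h1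
      have h2 := congrArg (F.res (cover_cons u x s).subset) h1
      rw [res_res, map_sum] at h2
      rw [h2, d]
      refine Finset.sum_congr rfl fun q _ => ?_
      rw [map_zsmul, res_res]
      congr 1
      exact F.res_res _ _ _
    obtain ⟨g₂, hg₂⟩ := ih F' m (by omega) h (fun s hs => by
      rw [hdh s fun q => Finset.mem_insert_of_mem (hs q), hf₁0 s hs, map_zero]; rfl)
    set h₁ : F'.C u (m + 1) := h - F'.d u g₂ with hh₁
    have hh₁0 : ∀ s, (∀ q, s q ∈ J) → h₁ s = 0 := fun s hs => by
      rw [hh₁, Pi.sub_apply, hg₂ s hs, sub_self]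
    have hdh₁ : F'.d u h₁ = F'.d u h := by rw [hh₁, d_sub, d_d, sub_zero]
    have hcov : ∀ {m : ℕ} (s : Fin m → I), (∃ q, s q = x) → u x ∪ cover u s ⊆ cover u s := by
      rintro m s ⟨q, rfl⟩
      exact Set.union_subset (fun v hv => ⟨q, hv⟩) subset_rfl
    let ρ : ∀ {m : ℕ} (s : Fin m → I), (∃ q, s q = x) →
        F'.obj (cover u s) →+ F.obj (cover u s) := fun s hs => F.res (hcov s hs)
    -- On a tuple that contains x the coefficients `F'` and F agree, so h₁ can be read as a cochain
    -- of F; on tuples in `J` it vanishes, so extending it by zero stays compatible with the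
    -- differential.
    let g₃ : F.C u (m + 1) := fun s => if hs : ∃ q, s q = x then ρ s hs (h₁ s) else 0
    refine ⟨g₁ + g₃, fun s hs => ?_⟩
    rw [d_add, Pi.add_apply, eq_comm, ← sub_eq_iff_eq_add', ← Pi.sub_apply, ← hf₁]
    have hJ : ∀ {m : ℕ} (s : Fin m → I), (∀ q, s q ∈ insert x J) → (¬ ∃ q, s q = x) →
        ∀ q, s q ∈ J := fun s hs hx q =>
      (Finset.mem_insert.mp (hs q)).resolve_left fun h => hx ⟨q, h⟩
    by_cases hxs : ∃ q, s q = x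
    · have h1 : F.d u g₃ s = ρ s hxs (F'.d u h₁ s) := by
        rw [d, d, map_sum]
        refine Finset.sum_congr rfl fun q _ => ?_
        rw [map_zsmul]
        congr 1
        by_cases hq : ∃ r, (s ∘ q.succAbove) r = x
        · have : g₃ (s ∘ q.succAbove) = ρ _ hq (h₁ (s ∘ q.succAbove)) := dif_pos hq
          rw [this]
          exact (F.res_res _ _ _).trans (F.res_res _ _ _).symm
        · have : g₃ (s ∘ q.succAbove) = 0 := dif_neg hq
          rw [this, hh₁0 (s ∘ q.succAbove) (hJ _ (fun r => hs _) hq), map_zero, map_zero, map_zero]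
      rw [h1, hdh₁, hdh s hs]
      exact ((F.res_res _ _ _).trans (F.res_self _ _)).symm
    · rw [hf₁0 s (hJ s hs hxs), d]
      refine (Finset.sum_eq_zero fun q _ => ?_).symm
      have : g₃ (s ∘ q.succAbove) = 0 := dif_neg fun ⟨r, hr⟩ => hxs ⟨_, hr⟩
      rw [this, map_zero, smul_zero]

end Coeff

/-! ### Exactness criteria for augmented Čech complexes -/

namespace Coeff

variable {V : Type*} {I : Type*} (u : I → Set V)

/-- Exactness of the augmented Čech complex at the cochains on tuples of length `m`. -/
def ExactAt (F : Coeff.{u} V) : ℕ → Prop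
  | 0 => ∀ f : F.C u 0, F.d u f = 0 → f = 0
  | m + 1 => ∀ f : F.C u (m + 1), F.d u f = 0 → ∃ g : F.C u m, F.d u g = f

theorem exactAt_of_card_lt [Fintype I] (F : Coeff.{u} V) (m : ℕ) (hm : Fintype.card I < m) :
    F.ExactAt u m := by
  obtain ⟨m, rfl⟩ : ∃ m', m = m' + 1 := ⟨m - 1, by omega⟩
  intro f hf
  obtain ⟨g, hg⟩ := F.exact_of_card_le u Finset.univ m (by rw [Finset.card_univ]; omega) f
    (fun s _ => congrFun hf s)
  exact ⟨g, funext fun s => hg s fun _ => Finset.mem_univ _⟩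

/-- A morphism of coefficients. -/
structure Mor (F F' : Coeff.{u} V) where
  map : ∀ U, F.obj U →+ F'.obj U
  nat : ∀ {U U' : Set V} (h : U ⊆ U') (x : F.obj U), map U' (F.res h x) = F'.res h (map U x)

theorem Mor.map_d {F F' : Coeff.{u} V} (φ : Mor F F') {m : ℕ} (f : F.C u m) (s : Fin (m + 1) → I) :
    φ.map _ (F.d u f s) = F'.d u (fun s => φ.map _ (f s)) s := by
  simp only [d, map_sum, map_zsmul, φ.nat]

/-- One step of the long exact sequence: lift a cocycle to `L`; its differential comes from a
cocycle of `K`; correcting the lift by a primitive of that turns it into a cocycle of `L`. -/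
theorem exactAt_of_shortExact {K L M : Coeff.{u} V} (α : Mor K L) (β : Mor L M)
    (hα : ∀ U, Function.Injective (α.map U)) (hβ : ∀ U, Function.Surjective (β.map U))
    (h0 : ∀ U x, β.map U (α.map U x) = 0) (hex : ∀ U x, β.map U x = 0 → ∃ y, α.map U y = x)
    (m : ℕ) (hL : L.ExactAt u m) (hK : K.ExactAt u (m + 1)) : M.ExactAt u m := by
  have key : ∀ f : M.C u m, M.d u f = 0 → ∃ (l : L.C u m) (k' : K.C u m),
      (∀ s, β.map _ (l s) = f s) ∧ L.d u (l - fun s => α.map _ (k' s)) = 0 := by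
    intro f hf
    choose l hl using fun s => hβ _ (f s)
    have hl' : (fun s => β.map _ (l s)) = f := funext hl
    choose c hc using fun s => hex _ (L.d u l s) (by rw [β.map_d, hl', hf]; rfl)
    have hdc : K.d u c = 0 := by
      funext s
      apply hα
      rw [α.map_d, show (fun s => α.map _ (c s)) = L.d u l from funext hc, d_d]
      exact (map_zero _).symm
    obtain ⟨k', hk'⟩ := hK c hdc
    refine ⟨l, k', hl, ?_⟩
    rw [d_sub, sub_eq_zero]
    funext s
    rw [← α.map_d, hk', hc]
  cases m with
  | zero =>
    intro f hf
    obtain ⟨l, k', hl, h⟩ := key f hf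
    have h1 := hL _ h
    funext s
    rw [← hl s, sub_eq_zero.mp h1]
    exact h0 _ _
  | succ m =>
    intro f hf
    obtain ⟨l, k', hl, h⟩ := key f hf
    obtain ⟨g, hg⟩ := hL _ h
    refine ⟨fun s => β.map _ (g s), ?_⟩
    funext s
    rw [← β.map_d, hg, ← hl s, Pi.sub_apply, map_sub, h0, sub_zero]

/-- Exactness from a decomposition of the coefficients in coordinates, each of which has a set of
the cover that does not affect it. -/
theorem exactAt_of_coordinates (F : Coeff.{u} V) {Λ A : Type*} [AddCommGroup A]
    (Ψ : ∀ U, F.obj U →+ (Λ → A)) (hΨ : ∀ U, Function.Injective (Ψ U))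
    (hnat : ∀ {U U' : Set V} (h : U ⊆ U') (x : F.obj U), Ψ U' (F.res h x) = Ψ U x)
    (x : Λ → I) (hx : ∀ (U : Set V) (f : ∀ y, F.obj (u y ∪ U)),
      ∃ g : F.obj U, ∀ μ, Ψ U g μ = Ψ _ (f (x μ)) μ) (m : ℕ) : F.ExactAt u m := by
  cases m with
  | zero =>
    intro f hf
    funext s
    apply hΨ
    funext μ
    have h : F.d u f (Fin.cons (x μ) s) = 0 := by rw [hf]; rfl
    rw [d, Fin.sum_univ_one, Fin.val_zero, pow_zero, one_smul] at h
    have h2 := congrFun (congrArg (Ψ _) h) μ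
    rw [hnat, map_zero] at h2
    generalize ((Fin.cons (x μ) s : Fin 1 → I) ∘ (0 : Fin 1).succAbove) = s' at h2
    obtain rfl := Subsingleton.elim s s'
    exact h2.trans (congrFun (map_zero (Ψ _)) μ).symm
  | succ m =>
    intro f hf
    -- The contracting homotopy s ↦ f(x, s), with a vertex x that depends on the coordinate μ; `hx`
    -- gathers the chosen coordinates into one element over the smaller set.
    choose g hg using fun s : Fin m → I => hx (cover u s)
      (fun y => F.res (cover_cons u y s).subset (f (Fin.cons y s)))
    refine ⟨g, ?_⟩
    funext s
    apply hΨ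
    funext μ
    have h : F.d u f (Fin.cons (x μ) s) = 0 := by rw [hf]; rfl
    rw [d_cons, sub_eq_zero] at h
    have h2 := congrFun (congrArg (Ψ _) h) μ
    rw [hnat, map_sum, Finset.sum_apply] at h2
    rw [h2, d, map_sum, Finset.sum_apply]
    refine Finset.sum_congr rfl fun q _ => ?_
    rw [map_zsmul, map_zsmul, Pi.smul_apply, Pi.smul_apply, hnat, hnat, hg, hnat]

end Coeff

namespace GrSMod

variable {k : Type u} [Field k] {t : ℕ} {n : Fin t → ℕ}

/-! ### Localizations of graded modules -/

theorem exists_monomial {U : Set (Var n)} {s : Cox k n} (hs : s ∈ varMonoid k n U) :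
    ∃ σ : Var n →₀ ℕ, s = MvPolynomial.monomial σ 1 ∧ ∀ v ∉ U, σ v = 0 := by
  induction hs using Submonoid.closure_induction with
  | mem x hx =>
    obtain ⟨v, hv, rfl⟩ := hx
    refine ⟨Finsupp.single v 1, rfl, fun v' hv' => ?_⟩
    rw [Finsupp.single_eq_of_ne]
    rintro rfl
    exact hv' hv
  | one => exact ⟨0, rfl, fun _ _ => rfl⟩
  | mul x y _ _ hx hy =>
    obtain ⟨σ, rfl, hσ⟩ := hx
    obtain ⟨τ, rfl, hτ⟩ := hy
    refine ⟨σ + τ, by rw [MvPolynomial.monomial_mul, one_mul], fun v hv => ?_⟩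
    rw [Finsupp.add_apply, hσ v hv, hτ v hv]

theorem monomial_mem_varMonoid {U : Set (Var n)} {σ : Var n →₀ ℕ} (hσ : ∀ v ∉ U, σ v = 0) :
    (MvPolynomial.monomial σ 1 : Cox k n) ∈ varMonoid k n U := by
  rw [MvPolynomial.monomial_eq, map_one, one_mul]
  refine Submonoid.prod_mem _ fun v hv => Submonoid.pow_mem _ (Submonoid.subset_closure ?_) _
  refine ⟨v, by_contra fun h => ?_, rfl⟩
  exact (Finsupp.mem_support_iff.mp hv) (hσ v h)

theorem exists_isWeightedHomogeneous {U : Set (Var n)} {s : Cox k n} (hs : s ∈ varMonoid k n U) :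
    ∃ b : Deg t, MvPolynomial.IsWeightedHomogeneous (varDeg (n := n)) s b := by
  obtain ⟨σ, rfl, -⟩ := exists_monomial hs
  exact ⟨_, MvPolynomial.isWeightedHomogeneous_monomial _ _ _ rfl⟩

theorem monomial_smul_mem (M : GrSMod k n) (σ : Var n →₀ ℕ) (c : k) {a : Deg t} {m : M}
    (hm : m ∈ M.deg a) : (MvPolynomial.monomial σ c : Cox k n) • m ∈
      M.deg (a + Finsupp.weight (varDeg (n := n)) σ) := by
  induction σ using Finsupp.induction_linear generalizing a m c with
  | zero =>
    rw [map_zero, add_zero, show MvPolynomial.monomial 0 c = algebraMap k (Cox k n) c from rfl,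
      algebraMap_smul]
    exact Submodule.smul_mem _ _ hm
  | add σ τ hσ hτ =>
    rw [show (MvPolynomial.monomial (σ + τ) c : Cox k n) =
      MvPolynomial.monomial τ c * MvPolynomial.monomial σ 1 by
        rw [MvPolynomial.monomial_mul, mul_one, add_comm], mul_smul, map_add, ← add_assoc]
    exact hτ c (hσ 1 hm)
  | single v r =>
    have h : ∀ (r : ℕ) {a : Deg t} {m : M}, m ∈ M.deg a → (MvPolynomial.X v ^ r : Cox k n) • m ∈
        M.deg (a + r • varDeg v) := by
      intro r
      induction r with
      | zero => intro a m hm; simpa using hm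
      | succ r ih =>
        intro a m hm
        rw [pow_succ', mul_smul, succ_nsmul, ← add_assoc]
        exact M.X_mem v _ _ (ih hm)
    rw [show (MvPolynomial.monomial (Finsupp.single v r) c : Cox k n) =
      algebraMap k (Cox k n) c * MvPolynomial.X v ^ r by
        rw [MvPolynomial.X_pow_eq_monomial, MvPolynomial.algebraMap_eq, MvPolynomial.C_mul_monomial,
          mul_one], mul_smul, algebraMap_smul, Finsupp.weight_single]
    exact Submodule.smul_mem _ _ (h r hm)

theorem smul_mem (M : GrSMod k n) {s : Cox k n} {b : Deg t}
    (hs : MvPolynomial.IsWeightedHomogeneous (varDeg (n := n)) s b) {a : Deg t} {m : M}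
    (hm : m ∈ M.deg a) : s • m ∈ M.deg (a + b) := by
  rw [MvPolynomial.as_sum s, Finset.sum_smul]
  refine Submodule.sum_mem _ fun σ hσ => ?_
  rw [← hs (MvPolynomial.mem_support_iff.mp hσ)]
  exact M.monomial_smul_mem σ _ hm

theorem proj_smul (M : GrSMod k n) {s : Cox k n} {b : Deg t}
    (hs : MvPolynomial.IsWeightedHomogeneous (varDeg (n := n)) s b) (a : Deg t) (m : M) :
    proj M.internal (a + b) (s • m) = s • proj M.internal a m :=
  proj_comm M.internal M.internal ((LinearMap.lsmul (Cox k n) M s).restrictScalars k)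
    (fun a => a + b) (fun _ _ h => add_right_cancel h) (fun _ _ hm => M.smul_mem hs hm) a m

theorem mk_mem_locDeg (M : GrSMod k n) {U : Set (Var n)} {a b : Deg t} (s : varMonoid k n U)
    (hs : MvPolynomial.IsWeightedHomogeneous (varDeg (n := n)) s.1 b) {m : M}
    (hm : m ∈ M.deg (a + b)) : LocalizedModule.mk m s ∈ M.locDeg U a :=
  Submodule.subset_span ⟨s, b, hs, m, hm, rfl⟩

/-- Every homogeneous element of a localization is a homogeneous fraction. -/
theorem mem_locDeg_iff (M : GrSMod k n) {U : Set (Var n)} {a : Deg t} {z : M.Loc U} :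
    z ∈ M.locDeg U a ↔ ∃ (s : varMonoid k n U) (b : Deg t),
      MvPolynomial.IsWeightedHomogeneous (varDeg (n := n)) s.1 b ∧
        ∃ m ∈ M.deg (a + b), z = LocalizedModule.mk m s := by
  refine ⟨fun hz => ?_, fun hz => Submodule.subset_span hz⟩
  induction hz using Submodule.span_induction with
  | mem z h => exact h
  | zero => exact ⟨1, 0, MvPolynomial.isWeightedHomogeneous_one _ _, 0, Submodule.zero_mem _,
      (LocalizedModule.zero_mk _).symm⟩
  | add z z' _ _ hz hz' =>
    obtain ⟨s, b, hs, m, hm, rfl⟩ := hz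
    obtain ⟨s', b', hs', m', hm', rfl⟩ := hz'
    refine ⟨s * s', b + b', hs.mul hs', s'.1 • m + s.1 • m', Submodule.add_mem _ ?_ ?_,
      LocalizedModule.mk_add_mk⟩
    · rw [← add_assoc]; exact M.smul_mem hs' hm
    · rw [add_comm b, ← add_assoc]; exact M.smul_mem hs hm'
  | smul c z _ hz =>
    obtain ⟨s, b, hs, m, hm, rfl⟩ := hz
    refine ⟨s, b, hs, c • m, Submodule.smul_mem _ _ hm, ?_⟩
    rw [← algebraMap_smul (Cox k n) c m, ← LocalizedModule.smul'_mk, algebraMap_smul]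

theorem varMonoid_mono {U U' : Set (Var n)} (h : U ⊆ U') : varMonoid k n U ≤ varMonoid k n U' :=
  Submonoid.closure_mono (Set.image_mono h)

theorem locRes_mk (M : GrSMod k n) {U U' : Set (Var n)} (h : U ⊆ U') (m : M) (s : varMonoid k n U) :
    M.locRes h (LocalizedModule.mk m s) =
      LocalizedModule.mk m ⟨s.1, varMonoid_mono h s.2⟩ := by
  rw [IsLocalizedModule.mk_eq_mk', IsLocalizedModule.mk_eq_mk']
  exact IsLocalizedModule.liftOfLE_mk' _ _ _ _ _ _ _

theorem locRes_mem (M : GrSMod k n) {U U' : Set (Var n)} (h : U ⊆ U') {a : Deg t} {z : M.Loc U}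
    (hz : z ∈ M.locDeg U a) : M.locRes h z ∈ M.locDeg U' a := by
  obtain ⟨s, b, hs, m, hm, rfl⟩ := M.mem_locDeg_iff.mp hz
  rw [locRes_mk]
  exact M.mk_mem_locDeg (U := U') ⟨s.1, varMonoid_mono h s.2⟩ hs hm

/-- The localizations of a graded module, in a fixed degree. -/
noncomputable def locCoeff (M : GrSMod k n) (a : Deg t) : Coeff.{u} (Var n) where
  obj U := M.locDeg U a
  res {U U'} h := (((M.locRes h).restrictScalars k).restrict
    (fun _ hz => M.locRes_mem h hz)).toAddMonoidHom
  res_self {U} h x := by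
    obtain ⟨x, hx⟩ := x
    apply Subtype.ext
    change M.locRes h x = x
    induction x using LocalizedModule.induction_on with
    | h m s => exact M.locRes_mk h m s
  res_res h h' x := by
    obtain ⟨x, hx⟩ := x
    apply Subtype.ext
    change M.locRes h' (M.locRes h x) = M.locRes (h.trans h') x
    induction x using LocalizedModule.induction_on with
    | h m s => rw [M.locRes_mk h m s, M.locRes_mk, M.locRes_mk]

variable (n) in
/-- The coordinates that are invertible on a chart. -/
def chartSet (x : Chart n) : Set (Var n) := {v | x v.1 = v.2}

/-- A homomorphism of graded modules. -/
structure GHom (M N : GrSMod k n) where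
  map : M →ₗ[Cox k n] N
  map_mem : ∀ a m, m ∈ M.deg a → map m ∈ N.deg a

theorem GHom.proj_map {M N : GrSMod k n} (f : GHom M N) (a : Deg t) (m : M) :
    proj N.internal a (f.map m) = f.map (proj M.internal a m) :=
  proj_comm M.internal N.internal (f.map.restrictScalars k) id Function.injective_id f.map_mem a m

/-- The map induced on localizations. -/
noncomputable def GHom.loc {M N : GrSMod k n} (f : GHom M N) (a : Deg t) :
    Coeff.Mor (M.locCoeff a) (N.locCoeff a) where
  map U := ((((LocalizedModule.map (varMonoid k n U) f.map).restrictScalars (Cox k n)).restrictScalars k).restrict (p := M.locDeg U a)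
    (q := N.locDeg U a) (by
      intro z hz
      obtain ⟨s, b, hs, m, hm, rfl⟩ := M.mem_locDeg_iff.mp hz
      change LocalizedModule.map (varMonoid k n U) f.map _ ∈ _
      rw [LocalizedModule.map_mk]
      exact N.mk_mem_locDeg _ hs (f.map_mem _ _ hm))).toAddMonoidHom
  nat {U U'} h x := by
    obtain ⟨x, hx⟩ := x
    apply Subtype.ext
    change LocalizedModule.map (varMonoid k n U') f.map (M.locRes h x) =
      N.locRes h (LocalizedModule.map (varMonoid k n U) f.map x)
    induction x using LocalizedModule.induction_on with
    | h m s => rw [M.locRes_mk, LocalizedModule.map_mk, LocalizedModule.map_mk, N.locRes_mk]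

theorem GHom.coe_loc {M N : GrSMod k n} (f : GHom M N) (a : Deg t) (U : Set (Var n))
    (x : (M.locCoeff a).obj U) :
    ((f.loc a).map U x).1 = LocalizedModule.map (varMonoid k n U) f.map x.1 := rfl

/-- Localization is exact, and preimages of homogeneous fractions can be made homogeneous by taking
components of numerators, so the short exact sequence persists in each degree of each localization.
-/
theorem exactAt_of_shortExact {K L M : GrSMod k n} (α : GHom K L) (β : GHom L M)
    (hα : Function.Injective α.map) (hβ : Function.Surjective β.map)
    (h0 : ∀ x, β.map (α.map x) = 0) (hex : ∀ x, β.map x = 0 → ∃ y, α.map y = x)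
    (a : Deg t) (m : ℕ) (hL : (L.locCoeff a).ExactAt (chartSet n) m)
    (hK : (K.locCoeff a).ExactAt (chartSet n) (m + 1)) : (M.locCoeff a).ExactAt (chartSet n) m := by
  refine Coeff.exactAt_of_shortExact (chartSet n) (α.loc a) (β.loc a) ?_ ?_ ?_ ?_ m hL hK
  · intro U x y hxy
    apply Subtype.ext
    have h := congrArg Subtype.val hxy
    rw [α.coe_loc, α.coe_loc] at h
    exact LocalizedModule.map_injective _ _ hα h
  · rintro U ⟨z, hz⟩
    obtain ⟨s, b, hs, m, hm, rfl⟩ := M.mem_locDeg_iff.mp hz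
    obtain ⟨l, rfl⟩ := hβ m
    refine ⟨⟨LocalizedModule.mk (proj L.internal (a + b) l) s,
      L.mk_mem_locDeg s hs (proj_mem _ _ _)⟩, ?_⟩
    apply Subtype.ext
    change LocalizedModule.map _ β.map (LocalizedModule.mk _ s) = LocalizedModule.mk _ s
    rw [LocalizedModule.map_mk, ← β.proj_map, proj_self _ hm]
  · rintro U ⟨x, hx⟩
    apply Subtype.ext
    change LocalizedModule.map _ β.map (LocalizedModule.map _ α.map x) = 0
    induction x using LocalizedModule.induction_on with
    | h m s => rw [LocalizedModule.map_mk, LocalizedModule.map_mk, h0, LocalizedModule.zero_mk]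
  · rintro U ⟨z, hz⟩ h
    obtain ⟨s, b, hs, l, hl, rfl⟩ := L.mem_locDeg_iff.mp hz
    have h1 := congrArg Subtype.val h
    change LocalizedModule.map _ β.map (LocalizedModule.mk l s) = 0 at h1
    rw [LocalizedModule.map_mk, ← LocalizedModule.zero_mk s, LocalizedModule.mk_eq] at h1
    obtain ⟨r, hr⟩ := h1
    obtain ⟨b', hb'⟩ := exists_isWeightedHomogeneous r.2
    rw [smul_zero, smul_zero, Submonoid.smul_def, Submonoid.smul_def, ← map_smul, ← map_smul] at hr
    obtain ⟨y, hy⟩ := hex _ hr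
    have hmem : α.map (proj K.internal (a + (b' + (b + b))) y) = r.1 • s.1 • l := by
      rw [← α.proj_map, hy, proj_self]
      rw [show a + (b' + (b + b)) = a + b + b + b' by abel]
      exact L.smul_mem hb' (L.smul_mem hs hl)
    -- The fraction l/s is rewritten as (r s l)/(r s²), because it is r s l, not l, that β kills.
    refine ⟨⟨LocalizedModule.mk (proj K.internal (a + (b' + (b + b))) y) (r * (s * s)),
      K.mk_mem_locDeg _ (hb'.mul (hs.mul hs)) (proj_mem _ _ _)⟩, ?_⟩
    apply Subtype.ext
    change LocalizedModule.map _ α.map (LocalizedModule.mk _ _) = LocalizedModule.mk l s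
    rw [LocalizedModule.map_mk, hmem, LocalizedModule.mk_eq]
    refine ⟨1, ?_⟩
    simp only [Submonoid.smul_def, Submonoid.coe_mul, one_smul, smul_smul]
    congr 1
    ring

end GrSMod

namespace GrSMod

variable {k : Type u} [Field k] {t : ℕ} {n : Fin t → ℕ}

/-! ### Submodules and quotients -/

/-- A submodule that contains the homogeneous components of its elements. -/
noncomputable def ofSubmodule (M : GrSMod k n) (N : Submodule (Cox k n) M)
    (hN : ∀ a, ∀ x ∈ N, proj M.internal a x ∈ N) : GrSMod k n where
  carrier := N
  deg a := (M.deg a).comap (N.subtype.restrictScalars k)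
  internal := by
    refine internal_of_proj (fun a => (proj M.internal a ∘ₗ
      N.subtype.restrictScalars k).codRestrict (N.restrictScalars k) fun x => hN a x x.2) ?_ ?_ ?_
    · intro a x hx
      exact Subtype.ext (proj_self M.internal hx)
    · intro a a' ha x hx
      exact Subtype.ext (proj_ne M.internal hx ha)
    · rw [eq_top_iff]
      rintro x -
      obtain ⟨f, hf⟩ := exists_sum_of_internal M.internal x.1
      have : x = ∑ a ∈ f, ⟨proj M.internal a x, hN a x x.2⟩ := by
        apply Subtype.ext
        rw [AddSubmonoidClass.coe_finsetSum]
        exact hf.symm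
      rw [this]
      exact Submodule.sum_mem _ fun a _ => Submodule.mem_iSup_of_mem a (proj_mem M.internal a x)
  X_mem v a m hm := M.X_mem v a m hm

/-- The quotient by a submodule that contains the homogeneous components of its elements. -/
noncomputable def quotient (M : GrSMod k n) (N : Submodule (Cox k n) M)
    (hN : ∀ a, ∀ x ∈ N, proj M.internal a x ∈ N) : GrSMod k n where
  carrier := M ⧸ N
  deg a := (M.deg a).map (N.mkQ.restrictScalars k)
  internal := by
    refine internal_of_proj (fun a => Submodule.mapQ (N.restrictScalars k) (N.restrictScalars k)
      (proj M.internal a) (fun x hx => hN a x hx)) ?_ ?_ ?_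
    · rintro a _ ⟨x, hx, rfl⟩
      exact congrArg N.mkQ (proj_self M.internal hx)
    · rintro a a' ha _ ⟨x, hx, rfl⟩
      exact (congrArg N.mkQ (proj_ne M.internal hx ha)).trans (map_zero _)
    · rw [eq_top_iff]
      rintro x -
      obtain ⟨x, rfl⟩ := Submodule.mkQ_surjective _ x
      obtain ⟨f, hf⟩ := exists_sum_of_internal M.internal x
      rw [← hf, map_sum]
      exact Submodule.sum_mem _ fun a _ => Submodule.mem_iSup_of_mem a
        (Submodule.mem_map_of_mem (f := N.mkQ.restrictScalars k) (proj_mem M.internal a x))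
  X_mem := by
    rintro v a _ ⟨m, hm, rfl⟩
    exact ⟨_, M.X_mem v a m hm, rfl⟩

/-! ### Graded free modules -/

section Free

variable (k) {ι : Type u} [Fintype ι] [DecidableEq ι] (b : ι → Deg t)

/-- The component of degree `a` of `⨁_i S(-b_i)`. -/
noncomputable def freeDeg (a : Deg t) : Submodule k (ι → Cox k n) :=
  Submodule.pi Set.univ fun i =>
    MvPolynomial.weightedHomogeneousSubmodule k (varDeg (n := n)) (a - b i)

theorem mem_freeDeg {a : Deg t} {f : ι → Cox k n} : f ∈ freeDeg k b a ↔
    ∀ i, MvPolynomial.IsWeightedHomogeneous (varDeg (n := n)) (f i) (a - b i) := by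
  simp [freeDeg, Submodule.mem_pi, MvPolynomial.mem_weightedHomogeneousSubmodule]

theorem single_mem_freeDeg (i : ι) (σ : Var n →₀ ℕ) (c : k) :
    (Pi.single i (MvPolynomial.monomial σ c) : ι → Cox k n) ∈
      freeDeg k b (b i + Finsupp.weight (varDeg (n := n)) σ) := by
  rw [mem_freeDeg]
  intro i'
  by_cases h : i' = i
  · subst h
    rw [Pi.single_eq_same]
    exact MvPolynomial.isWeightedHomogeneous_monomial _ _ _ (by abel)
  · rw [Pi.single_eq_of_ne h]
    exact MvPolynomial.isWeightedHomogeneous_zero _ _ _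

/-- The graded free module `⨁_i S(-b_i)`. -/
noncomputable def free : GrSMod k n where
  carrier := ι → Cox k n
  deg := freeDeg k b
  internal := by
    refine internal_of_proj (fun a => LinearMap.pi fun i =>
      MvPolynomial.weightedHomogeneousComponent (varDeg (n := n)) (a - b i) ∘ₗ
        LinearMap.proj i) ?_ ?_ ?_
    · intro a f hf
      funext i
      exact ((mem_freeDeg k b).mp hf i).weightedHomogeneousComponent_same
    · intro a a' ha f hf
      funext i
      exact ((mem_freeDeg k b).mp hf i).weightedHomogeneousComponent_ne _
        (fun h => ha (sub_left_injective h).symm)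
    · rw [eq_top_iff]
      rintro f -
      rw [← Finset.univ_sum_single f]
      refine Submodule.sum_mem _ fun i _ => ?_
      rw [MvPolynomial.as_sum (f i), ← LinearMap.single_apply (R := k), map_sum]
      exact Submodule.sum_mem _ fun σ _ => Submodule.mem_iSup_of_mem _ (single_mem_freeDeg k b i σ _)
  X_mem v a f hf := by
    change (MvPolynomial.X v : Cox k n) • f ∈ freeDeg k b (a + varDeg v)
    rw [mem_freeDeg]
    intro i
    rw [add_sub_right_comm, add_comm]
    exact (MvPolynomial.isWeightedHomogeneous_X k _ v).mul ((mem_freeDeg k b).mp hf i)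

end Free

/-- The coefficients of a polynomial, extended by zero to all integral exponents. -/
noncomputable def intCoeff (p : Cox k n) (μ : Var n → ℤ) : k :=
  if ∀ v, 0 ≤ μ v then p.coeff (Finsupp.equivFunOnFinite.symm fun v => (μ v).toNat) else 0

theorem intCoeff_coe (p : Cox k n) (σ : Var n →₀ ℕ) :
    intCoeff p (fun v => (σ v : ℤ)) = p.coeff σ := by
  rw [intCoeff, if_pos fun v => Int.natCast_nonneg _]
  congr 1
  ext v
  simp

theorem exists_of_intCoeff_ne_zero {p : Cox k n} {μ : Var n → ℤ} (h : intCoeff p μ ≠ 0) :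
    ∃ σ : Var n →₀ ℕ, μ = (fun v => (σ v : ℤ)) ∧ p.coeff σ ≠ 0 := by
  have h' : ∀ v, 0 ≤ μ v := by
    by_contra h'
    exact h (if_neg h')
  refine ⟨Finsupp.equivFunOnFinite.symm fun v => (μ v).toNat, ?_, ?_⟩
  · funext v
    simp [h' v]
  · rwa [intCoeff, if_pos h'] at h

theorem intCoeff_add (p q : Cox k n) (μ : Var n → ℤ) :
    intCoeff (p + q) μ = intCoeff p μ + intCoeff q μ := by
  unfold intCoeff
  split_ifs <;> simp

theorem intCoeff_monomial_mul (τ : Var n →₀ ℕ) (p : Cox k n) (μ : Var n → ℤ) :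
    intCoeff (MvPolynomial.monomial τ 1 * p) (fun v => μ v + τ v) = intCoeff p μ := by
  by_cases h : ∀ v, 0 ≤ μ v
  · rw [intCoeff, intCoeff, if_pos h, if_pos fun v => add_nonneg (h v) (Int.natCast_nonneg _),
      MvPolynomial.coeff_monomial_mul', if_pos, one_mul]
    · congr 1
      ext v
      have := h v
      simp
      omega
    · intro v
      have := h v
      simp
      omega
  · rw [intCoeff, intCoeff, if_neg h]
    split_ifs with h'
    · rw [MvPolynomial.coeff_monomial_mul', if_neg]
      intro hle
      refine h fun v => ?_
      have h1 := hle v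
      have h2 := h' v
      simp at h1
      omega
    · rfl

end GrSMod

/-! ### Laurent monomials in localizations of graded free modules -/

namespace GrSMod

variable {k : Type u} [Field k] {t : ℕ} {n : Fin t → ℕ}

section FreeLoc

variable {ι : Type u} [Fintype ι] [DecidableEq ι] (b : ι → Deg t)

/-- The fraction with numerator `f` and denominator the monomial with exponent `σ`. -/
noncomputable def frac (U : Set (Var n)) (f : ι → Cox k n) (σ : Var n →₀ ℕ)
    (hσ : ∀ v ∉ U, σ v = 0) : (free k b).Loc U :=
  LocalizedModule.mk (S := varMonoid k n U) (M := (free k b).carrier) f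
    ⟨MvPolynomial.monomial σ 1, monomial_mem_varMonoid hσ⟩

theorem exists_fraction {U : Set (Var n)} (z : (free k b).Loc U) :
    ∃ (f : ι → Cox k n) (σ : Var n →₀ ℕ) (hσ : ∀ v ∉ U, σ v = 0), z = frac b U f σ hσ := by
  induction z using LocalizedModule.induction_on with
  | h f s =>
    obtain ⟨s, hs⟩ := s
    obtain ⟨σ, rfl, hσ⟩ := exists_monomial hs
    exact ⟨f, σ, hσ, rfl⟩

/-- The coefficients of the Laurent monomials in an element of a localization of a free module. -/
noncomputable def laurent {U : Set (Var n)} (z : (free k b).Loc U) (p : ι × (Var n → ℤ)) : k :=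
  intCoeff ((exists_fraction b z).choose p.1)
    (fun v => p.2 v + (exists_fraction b z).choose_spec.choose v)

/-- Independence of the chosen fraction: clearing denominators multiplies numerators by monomials,
which merely shifts exponents. -/
theorem laurent_frac {U : Set (Var n)} (f : ι → Cox k n) {σ : Var n →₀ ℕ} (hσ : ∀ v ∉ U, σ v = 0)
    (p : ι × (Var n → ℤ)) :
    laurent b (frac b U f σ hσ) p = intCoeff (f p.1) (fun v => p.2 v + σ v) := by
  have key : ∀ (f' : ι → Cox k n) (σ' : Var n →₀ ℕ) (hσ' : ∀ v ∉ U, σ' v = 0),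
      frac b U f σ hσ = frac b U f' σ' hσ' →
        intCoeff (f' p.1) (fun v => p.2 v + σ' v) = intCoeff (f p.1) (fun v => p.2 v + σ v) := by
    intro f' σ' hσ' h
    obtain ⟨⟨r, hr⟩, h⟩ := LocalizedModule.mk_eq.mp h
    obtain ⟨τ, rfl, -⟩ := exists_monomial hr
    have h1 : (MvPolynomial.monomial τ 1 : Cox k n) * (MvPolynomial.monomial σ' 1 * f p.1) =
      MvPolynomial.monomial τ 1 * (MvPolynomial.monomial σ 1 * f' p.1) := congrFun h p.1
    rw [← intCoeff_monomial_mul σ, ← intCoeff_monomial_mul τ, ← h1,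
      ← intCoeff_monomial_mul σ' (f p.1), ← intCoeff_monomial_mul τ (_ * f p.1)]
    congr 1
    funext v
    ring
  exact key _ _ _ (exists_fraction b (frac b U f σ hσ)).choose_spec.choose_spec.choose_spec

theorem frac_add {U : Set (Var n)} (f f' : ι → Cox k n) {σ σ' : Var n →₀ ℕ}
    (hσ : ∀ v ∉ U, σ v = 0) (hσ' : ∀ v ∉ U, σ' v = 0) :
    frac b U f σ hσ + frac b U f' σ' hσ' =
      frac b U (fun i => MvPolynomial.monomial σ' 1 * f i + MvPolynomial.monomial σ 1 * f' i)
        (σ + σ') (fun v hv => by rw [Finsupp.add_apply, hσ v hv, hσ' v hv]) := by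
  refine LocalizedModule.mk_add_mk.trans ?_
  have h : (⟨MvPolynomial.monomial σ 1, monomial_mem_varMonoid hσ⟩ *
      ⟨MvPolynomial.monomial σ' 1, monomial_mem_varMonoid hσ'⟩ : varMonoid k n U) =
      ⟨MvPolynomial.monomial (σ + σ') 1, monomial_mem_varMonoid (fun v hv => by
        rw [Finsupp.add_apply, hσ v hv, hσ' v hv])⟩ := Subtype.ext (by
    change MvPolynomial.monomial σ 1 * MvPolynomial.monomial σ' 1 = _
    rw [MvPolynomial.monomial_mul, one_mul])
  rw [h]
  rfl

theorem laurent_add {U : Set (Var n)} (z z' : (free k b).Loc U) (p : ι × (Var n → ℤ)) :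
    laurent b (z + z') p = laurent b z p + laurent b z' p := by
  obtain ⟨f, σ, hσ, rfl⟩ := exists_fraction b z
  obtain ⟨f', σ', hσ', rfl⟩ := exists_fraction b z'
  rw [frac_add, laurent_frac, laurent_frac, laurent_frac, intCoeff_add,
    ← intCoeff_monomial_mul σ' (f p.1), ← intCoeff_monomial_mul σ (f' p.1)]
  congr 2 <;> funext v <;> simp <;> ring

theorem laurent_injective {U : Set (Var n)} (z : (free k b).Loc U) (hz : laurent b z = 0) :
    z = 0 := by
  obtain ⟨f, σ, hσ, rfl⟩ := exists_fraction b z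
  have : f = 0 := by
    funext i
    ext τ
    have h := congrFun hz (i, fun v => (τ v : ℤ) - σ v)
    rw [laurent_frac] at h
    simp only [sub_add_cancel, intCoeff_coe] at h
    exact h
  rw [this]
  exact LocalizedModule.zero_mk (M := (free k b).carrier) _

theorem laurent_res {U U' : Set (Var n)} (h : U ⊆ U') (z : (free k b).Loc U) :
    laurent b ((free k b).locRes h z) = laurent b z := by
  obtain ⟨f, σ, hσ, rfl⟩ := exists_fraction b z
  funext p
  refine (congrArg (laurent b · p) ((free k b).locRes_mk h f _)).trans ?_
  refine (laurent_frac b f (fun v hv => hσ v fun hv' => hv (h hv')) p).trans ?_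
  rw [laurent_frac]

/-- The degree of a Laurent monomial. -/
def intWeight (μ : Var n → ℤ) : Deg t := fun i => ∑ j, μ ⟨i, j⟩

theorem weight_varDeg (σ : Var n →₀ ℕ) :
    Finsupp.weight (varDeg (n := n)) σ = intWeight fun v => (σ v : ℤ) := by
  funext i
  rw [Finsupp.weight_apply, Finsupp.sum_fintype _ _ (fun v => zero_smul ℕ (varDeg v)), Finset.sum_apply,
    Fintype.sum_sigma, Finset.sum_eq_single i, intWeight]
  · simp [varDeg]
  · intro i' _ hi
    simp [varDeg, hi.symm]
  · simp

theorem intWeight_add (μ ν : Var n → ℤ) : intWeight (fun v => μ v + ν v) = intWeight μ + intWeight ν := by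
  funext i
  simp [intWeight, Finset.sum_add_distrib]

theorem laurent_ne_zero {U : Set (Var n)} {a : Deg t} {z : (free k b).Loc U}
    (hz : z ∈ (free k b).locDeg U a) {p : ι × (Var n → ℤ)} (hp : laurent b z p ≠ 0) :
    intWeight p.2 = a - b p.1 ∧ ∀ v ∉ U, 0 ≤ p.2 v := by
  obtain ⟨⟨s, hs'⟩, d, hs, f, hf, rfl⟩ := (free k b).mem_locDeg_iff.mp hz
  obtain ⟨σ, rfl, hσ⟩ := exists_monomial hs'
  change laurent b (frac b U f σ hσ) p ≠ 0 at hp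
  rw [laurent_frac b f hσ] at hp
  obtain ⟨τ, hτ, hc⟩ := exists_of_intCoeff_ne_zero hp
  have hd : Finsupp.weight (varDeg (n := n)) σ = d := hs (by simp)
  have h1 : Finsupp.weight (varDeg (n := n)) τ = a + d - b p.1 :=
    (mem_freeDeg k b).mp hf p.1 hc
  constructor
  · rw [weight_varDeg, ← hτ, intWeight_add, ← weight_varDeg, hd] at h1
    rw [← add_left_inj d, h1]
    abel
  · intro v hv
    have := congrFun hτ v
    simp only [hσ v hv, Nat.cast_zero, add_zero] at this
    rw [this]
    exact Int.natCast_nonneg _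

theorem laurent_finite {U : Set (Var n)} (z : (free k b).Loc U) :
    {p | laurent b z p ≠ 0}.Finite := by
  obtain ⟨f, σ, hσ, rfl⟩ := exists_fraction b z
  refine Set.Finite.subset (s := (fun q : (_ : ι) × (Var n →₀ ℕ) =>
    (q.1, fun v => (q.2 v : ℤ) - σ v)) ''
      ((Finset.univ : Finset ι).sigma fun i => (f i).support : Finset _)) (Set.toFinite _) ?_
  intro p hp
  rw [Set.mem_ofPred_eq, laurent_frac] at hp
  obtain ⟨τ, hτ, hc⟩ := exists_of_intCoeff_ne_zero hp
  refine ⟨⟨p.1, τ⟩, ?_, ?_⟩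
  · simpa using hc
  · refine Prod.ext rfl ?_
    funext v
    have := congrFun hτ v
    simp only at this ⊢
    omega

/-- Converse to `laurent_ne_zero`. Together they describe a homogeneous piece of a localization by
the admissible supports: weight a - b_i, with negative exponents only at the inverted coordinates.
-/
theorem exists_laurent {U : Set (Var n)} {a : Deg t} (ζ : ι × (Var n → ℤ) → k)
    (hfin : {p | ζ p ≠ 0}.Finite)
    (hζ : ∀ p, ζ p ≠ 0 → intWeight p.2 = a - b p.1 ∧ ∀ v ∉ U, 0 ≤ p.2 v) :
    ∃ z ∈ (free k b).locDeg U a, laurent b z = ζ := by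
  classical
  have hs : ∀ p, ζ p ≠ 0 → ∃ z ∈ (free k b).locDeg U a, laurent b z = Pi.single p (ζ p) := by
    rintro ⟨i, μ⟩ hp
    obtain ⟨h1, h2⟩ := hζ _ hp
    -- The positive part of the exponent goes to the numerator, the negative part to the
    -- denominator.
    let τ : Var n →₀ ℕ := Finsupp.equivFunOnFinite.symm fun v => (μ v).toNat
    let σ : Var n →₀ ℕ := Finsupp.equivFunOnFinite.symm fun v => (-μ v).toNat
    have hσ : ∀ v ∉ U, σ v = 0 := fun v hv => by
      have := h2 v hv
      simp [σ]
      exact this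
    have hμ : ∀ v, μ v + σ v = τ v := fun v => by simp [σ, τ]; omega
    have hw : b i + Finsupp.weight (varDeg (n := n)) τ =
        a + Finsupp.weight (varDeg (n := n)) σ := by
      rw [weight_varDeg, weight_varDeg, ← funext hμ, intWeight_add, h1]
      abel
    refine ⟨frac b U (Pi.single i (MvPolynomial.monomial τ (ζ (i, μ)))) σ hσ,
      (free k b).mk_mem_locDeg (b := Finsupp.weight (varDeg (n := n)) σ) _
        (MvPolynomial.isWeightedHomogeneous_monomial _ _ _ rfl) ?_, ?_⟩
    · rw [← hw]
      exact single_mem_freeDeg k b i τ _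
    · funext ⟨i', ν⟩
      rw [laurent_frac]
      by_cases hi : i' = i
      · subst hi
        simp only [Pi.single_eq_same]
        by_cases hν : ν = μ
        · subst hν
          rw [Pi.single_eq_same, funext hμ, intCoeff_coe, MvPolynomial.coeff_monomial, if_pos rfl]
        · rw [Pi.single_eq_of_ne (by simpa using hν)]
          by_contra h
          obtain ⟨τ', hτ', hc⟩ := exists_of_intCoeff_ne_zero h
          rw [MvPolynomial.coeff_monomial] at hc
          have : τ = τ' := by
            by_contra h'
            exact hc (if_neg h')
          subst this
          refine hν (funext fun v => ?_)
          have h3 := congrFun hτ' v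
          have h4 := hμ v
          omega
      · rw [Pi.single_eq_of_ne (M := fun _ => k) (by simp [hi])]
        simp only [Pi.single_eq_of_ne hi]
        simp [intCoeff]
  have key : ∀ J : Finset (ι × (Var n → ℤ)), (∀ p ∈ J, ζ p ≠ 0) →
      ∃ z ∈ (free k b).locDeg U a, laurent b z = ∑ p ∈ J, Pi.single p (ζ p) := by
    intro J
    induction J using Finset.induction_on with
    | empty =>
      intro _
      refine ⟨0, Submodule.zero_mem _, funext fun p => ?_⟩
      have := laurent_add b (0 : (free k b).Loc U) 0 p
      rw [add_zero] at this
      simpa using this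
    | insert p J hp ih =>
      intro hJ
      obtain ⟨z, hz, hz'⟩ := ih fun q hq => hJ q (Finset.mem_insert_of_mem hq)
      obtain ⟨y, hy, hy'⟩ := hs p (hJ p (Finset.mem_insert_self _ _))
      refine ⟨y + z, Submodule.add_mem _ hy hz, funext fun q => ?_⟩
      rw [laurent_add, hz', hy', Finset.sum_insert hp, Pi.add_apply]
  obtain ⟨z, hz, hz'⟩ := key hfin.toFinset (fun p hp => by simpa using hp)
  refine ⟨z, hz, hz'.trans (funext fun p => ?_)⟩
  rw [Finset.sum_apply]
  by_cases hp : ζ p = 0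
  · rw [hp]
    refine Finset.sum_eq_zero fun q _ => ?_
    by_cases hq : p = q
    · subst hq; rw [Pi.single_eq_same, hp]
    · rw [Pi.single_eq_of_ne hq]
  · rw [Finset.sum_eq_single p, Pi.single_eq_same]
    · intro q _ hq
      rw [Pi.single_eq_of_ne hq.symm]
    · intro h
      exact absurd (by simpa using hp) h

/-- A sum of integers that is nonnegative has a nonnegative term. Choosing one such coordinate in
each factor gives a chart that the monomial does not need to have inverted. -/
theorem exists_chart (μ : Var n → ℤ) : ∃ x : Chart n, ∀ i, 0 ≤ intWeight μ i → 0 ≤ μ ⟨i, x i⟩ := by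
  have h : ∀ i, ∃ j : Fin (n i + 1), 0 ≤ intWeight μ i → 0 ≤ μ ⟨i, j⟩ := by
    intro i
    by_contra h
    push Not at h
    have h0 := (h 0).1
    refine absurd h0 (not_le.mpr (Finset.sum_neg (fun j _ => (h j).2) ⟨0, Finset.mem_univ _⟩))
  choose x hx using h
  exact ⟨x, hx⟩

/-- When a ≥ b_i for all i, every Laurent monomial that occurs has nonnegative weight in each
factor, so `exists_chart` gives it a chart whose inversion does not affect it. Coning with this
chart contracts the complex at that monomial: this is the vanishing of the higher cohomology of O(d)
for d ≥ 0, along with H^0 = S_d. -/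
theorem free_exactAt {a : Deg t} (ha : ∀ i, b i ≤ a) (m : ℕ) :
    ((free k b).locCoeff (n := n) a).ExactAt (chartSet n) m := by
  choose x hx using exists_chart (n := n)
  let Ψ : ∀ U, ((free k b).locCoeff (n := n) a).obj U →+ (ι × (Var n → ℤ) → k) := fun U =>
    AddMonoidHom.mk' (fun z => laurent b z.1) (fun z z' => funext fun p => laurent_add b z.1 z'.1 p)
  refine Coeff.exactAt_of_coordinates (chartSet n) _ Ψ ?_ ?_ (fun p => x p.2) ?_ m
  · intro U
    rw [injective_iff_map_eq_zero]
    exact fun z hz => Subtype.ext (laurent_injective b z.1 hz)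
  · intro U U' h z
    exact laurent_res b h z.1
  · intro U f
    have hfin : {p | laurent b (f (x p.2)).1 p ≠ 0}.Finite := by
      refine Set.Finite.subset (Set.finite_iUnion fun y => laurent_finite b (f y).1) ?_
      intro p hp
      exact Set.mem_iUnion.mpr ⟨x p.2, hp⟩
    obtain ⟨z, hz, hz'⟩ := exists_laurent (U := U) (a := a) b
      (fun p => laurent b (f (x p.2)).1 p) hfin (by
        intro p hp
        obtain ⟨h1, h2⟩ := laurent_ne_zero b (f (x p.2)).2 hp
        refine ⟨h1, fun v hv => ?_⟩
        by_cases h : v ∈ chartSet n (x p.2)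
        · have h3 := hx p.2 v.1 (by
            rw [h1]
            exact sub_nonneg.mpr (ha p.1 v.1))
          rwa [show x p.2 v.1 = v.2 from h] at h3
        · exact h2 v fun h' => h'.elim h hv)
    exact ⟨⟨z, hz⟩, fun p => congrFun hz' p⟩

end FreeLoc

/-! ### Serre vanishing for finitely generated modules -/

theorem exists_generators (P : GrSMod k n) (hP : Module.Finite (Cox k n) P) :
    ∃ (ι : Type u) (_ : Fintype ι) (g : ι → P) (b : ι → Deg t), (∀ i, g i ∈ P.deg (b i)) ∧
      Submodule.span (Cox k n) (Set.range g) = ⊤ := by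
  classical
  obtain ⟨S, hS⟩ := hP.fg_top
  choose s hs using exists_sum_of_internal P.internal
  refine ⟨(S.sigma fun x => s x : Finset _), inferInstance,
    fun i => proj P.internal i.1.2 i.1.1, fun i => i.1.2, fun i => proj_mem _ _ _, ?_⟩
  rw [eq_top_iff, ← hS, Submodule.span_le]
  intro x hx
  rw [← hs x]
  exact Submodule.sum_mem _ fun a ha => Submodule.subset_span
    ⟨⟨⟨x, a⟩, Finset.mem_sigma.mpr ⟨hx, ha⟩⟩, rfl⟩

/-- Serre vanishing at a given place of the augmented Čech complex. -/
theorem exists_exactAt (d : ℕ) : ∀ m, Fintype.card (Chart n) < m + d → ∀ P : GrSMod k n,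
    Module.Finite (Cox k n) P →
      ∃ c₀ : Deg t, ∀ a, c₀ ≤ a → (P.locCoeff a).ExactAt (chartSet n) m := by
  classical
  -- A descending induction on the place m: beyond the number of charts the complex is exact anyway,
  -- and exactness for P at m follows from exactness for its syzygy module at m + 1.
  induction d with
  | zero => exact fun m hm P _ => ⟨0, fun a _ => Coeff.exactAt_of_card_lt _ _ m (by omega)⟩
  | succ d ih =>
    intro m hm P hP
    obtain ⟨ι, _, g, b, hg, hspan⟩ := P.exists_generators hP
    let β : GHom (free k b) P := {
      map := Fintype.linearCombination (Cox k n) g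
      map_mem := fun a f hf => by
        refine (Fintype.linearCombination_apply (Cox k n) g f).symm ▸ ?_
        refine Submodule.sum_mem _ fun i _ => ?_
        have := P.smul_mem ((mem_freeDeg k b).mp hf i) (hg i)
        rwa [add_sub_cancel] at this }
    have hβ : Function.Surjective β.map := by
      exact LinearMap.range_eq_top.mp ((Fintype.range_linearCombination (Cox k n) g).trans hspan)
    let N : Submodule (Cox k n) (free k b) := LinearMap.ker β.map
    have hN : ∀ a, ∀ x ∈ N, proj (free k b).internal a x ∈ N := fun a x hx => by
      rw [LinearMap.mem_ker, ← β.proj_map, LinearMap.mem_ker.mp hx, map_zero]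
    let K := (free k b).ofSubmodule N hN
    have hK : Module.Finite (Cox k n) K := by
      have h : IsNoetherian (Cox k n) (ι → Cox k n) := inferInstance
      exact @Module.IsNoetherian.finite _ _ _ _ _
        (@isNoetherian_submodule' _ _ _ _ _ h N)
    let α : GHom K (free k b) := ⟨N.subtype, fun _ _ h => h⟩
    obtain ⟨c₁, hc₁⟩ := ih (m + 1) (by omega) K hK
    -- The bound must work for the syzygies and must dominate the degree of every generator; the sum
    -- of absolute values serves as a common upper bound.
    refine ⟨c₁ ⊔ ∑ i, fun j => |b i j|, fun a ha => ?_⟩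
    refine exactAt_of_shortExact α β Subtype.val_injective hβ (fun x => x.2)
      (fun x hx => ⟨⟨x, hx⟩, rfl⟩) a m (free_exactAt b (fun i j => ?_) m)
      (hc₁ a (le_sup_left.trans ha))
    have h1 := le_sup_right.trans ha j
    rw [Finset.sum_apply] at h1
    refine (le_abs_self _).trans (le_trans ?_ h1)
    exact Finset.single_le_sum (f := fun i => |b i j|) (fun _ _ => abs_nonneg _) (Finset.mem_univ i)

/-- Serre vanishing: in large degrees the augmented Čech complex of a finitely generated module is
exact. -/
theorem exists_forall_exactAt (P : GrSMod k n) (hP : Module.Finite (Cox k n) P) :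
    ∃ c₀ : Deg t, ∀ a, c₀ ≤ a → ∀ m, (P.locCoeff a).ExactAt (chartSet n) m := by
  choose c hc using fun m => exists_exactAt (k := k) (n := n) (Fintype.card (Chart n) + 1) m
    (by omega) P hP
  have hle : ∀ N m, m ≤ N → c m ≤ partialSups c N := fun N m h => le_partialSups_of_le c h
  refine ⟨partialSups c (Fintype.card (Chart n)), fun a ha m => ?_⟩
  by_cases hm : m ≤ Fintype.card (Chart n)
  · exact hc m a ((hle _ m hm).trans ha)
  · exact Coeff.exactAt_of_card_lt _ _ m (by omega)

end GrSMod

namespace GrSMod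

variable {k : Type u} [Field k] {t : ℕ} {n : Fin t → ℕ}

/-! ### Čech cohomology in large degrees -/

theorem cechD_apply (M : GrSMod k n) (p : ℕ) (f : M.Cochain p) (s : Fin (p + 2) → Chart n) :
    M.cechD p f s = ∑ q : Fin (p + 2), (-1 : ℤ) ^ (q : ℕ) •
      M.locRes (chartVars_comp s q) (f (s ∘ q.succAbove)) := by
  simp only [cechD, LinearMap.coe_restrictScalars, LinearMap.pi_apply, LinearMap.sum_apply]
  rfl

theorem coe_d (M : GrSMod k n) (a : Deg t) {m : ℕ} (f : (M.locCoeff a).C (chartSet n) m)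
    (s : Fin (m + 1) → Chart n) : ((M.locCoeff a).d (chartSet n) f s).1 =
      ∑ q : Fin (m + 1), (-1 : ℤ) ^ (q : ℕ) •
        M.locRes (Coeff.cover_comp (chartSet n) s q.succAbove) (f (s ∘ q.succAbove)).1 := by
  let φ : (M.locCoeff a).obj (Coeff.cover (chartSet n) s) →+ M.Loc (Coeff.cover (chartSet n) s) :=
    (M.locDeg _ a).subtype.toAddMonoidHom
  change φ _ = _
  rw [Coeff.d, map_sum]
  refine Finset.sum_congr rfl fun q _ => ?_
  rw [map_zsmul]
  rfl

/-- A cochain of degree `a`. -/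
def cochainOf (M : GrSMod k n) (a : Deg t) {p : ℕ} (f : M.Cochain p) (hf : f ∈ M.cochainDeg p a) :
    (M.locCoeff a).C (chartSet n) (p + 1) := fun s => ⟨f s, hf s (Set.mem_univ s)⟩

theorem coe_d_cochainOf (M : GrSMod k n) (a : Deg t) {p : ℕ} (f : M.Cochain p)
    (hf : f ∈ M.cochainDeg p a) (s : Fin (p + 2) → Chart n) :
    ((M.locCoeff a).d (chartSet n) (M.cochainOf a f hf) s).1 = M.cechD p f s :=
  (M.coe_d a _ s).trans (M.cechD_apply p f s).symm

theorem d_cochainOf (M : GrSMod k n) (a : Deg t) {p : ℕ} {f : M.Cochain p}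
    (hf : f ∈ M.cocycles p a) : (M.locCoeff a).d (chartSet n) (M.cochainOf a f hf.1) = 0 := by
  funext s
  apply Subtype.ext
  rw [coe_d_cochainOf, LinearMap.mem_ker.mp hf.2]
  rfl

/-- Place 0 of the augmented complex is the module itself, so Čech degree p + 1, made of tuples of
length p + 2, sits at place p + 2. -/
theorem coh_subsingleton (M : GrSMod k n) {a : Deg t} {p : ℕ}
    (h : (M.locCoeff a).ExactAt (chartSet n) (p + 2)) : Subsingleton (M.Coh (p + 1) a) := by
  rw [Submodule.Quotient.subsingleton_iff, Submodule.submoduleOf_eq_top]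
  intro f hf
  obtain ⟨g, hg⟩ := h _ (M.d_cochainOf a hf)
  refine ⟨fun s => (g s).1, fun s _ => (g s).2, ?_⟩
  funext s
  have h1 := congrArg Subtype.val (congrFun hg s)
  rw [← coe_d_cochainOf M a _ (fun s _ => (g s).2)]
  exact h1

/-- The map from a module to the sections of its sheaf on the charts. -/
noncomputable def toCochain (M : GrSMod k n) : M →ₗ[Cox k n] M.Cochain 0 :=
  LinearMap.pi fun _ => LocalizedModule.mkLinearMap _ _

theorem toCochain_apply (M : GrSMod k n) (m : M) (s : Fin 1 → Chart n) :
    M.toCochain m s = LocalizedModule.mk m 1 := rfl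

theorem toCochain_mem (M : GrSMod k n) (a : Deg t) (m : M) (hm : m ∈ M.deg a) :
    M.toCochain m ∈ M.cocycles 0 a := by
  refine ⟨fun s _ => ?_, ?_⟩
  · exact M.mk_mem_locDeg 1 (MvPolynomial.isWeightedHomogeneous_one _ _) (by rwa [add_zero])
  · change M.cechD 0 _ = 0
    funext s
    rw [cechD_apply, Fin.sum_univ_two]
    have : ∀ q : Fin 2, M.locRes (chartVars_comp s q) (M.toCochain m (s ∘ q.succAbove)) =
        LocalizedModule.mk m 1 := fun q => M.locRes_mk _ m 1
    rw [this, this]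
    simp

theorem exists_mk_one (M : GrSMod k n) {a : Deg t} {U : Set (Var n)} (hU : ∀ v, v ∉ U) (z : M.Loc U)
    (hz : z ∈ M.locDeg U a) : ∃ m ∈ M.deg a, z = LocalizedModule.mk m 1 := by
  obtain ⟨⟨s, hs'⟩, b, hs, m, hm, rfl⟩ := M.mem_locDeg_iff.mp hz
  obtain ⟨σ, rfl, hσ⟩ := exists_monomial hs'
  have h0 : σ = 0 := Finsupp.ext fun v => hσ v (hU v)
  subst h0
  have hb : b = 0 := by
    have := hs (d := 0) (by simp)
    rw [← this, map_zero]
  subst hb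
  rw [add_zero] at hm
  exact ⟨m, hm, rfl⟩

/-- The empty tuple inverts nothing, so place 0 of the augmented complex is M_a. Likewise exactness
at place 1 gives `toCochain_surjOn`, that is, M_a → H^0 is onto. -/
theorem toCochain_injOn (M : GrSMod k n) {a : Deg t} (h : (M.locCoeff a).ExactAt (chartSet n) 0)
    {m : M} (hm : m ∈ M.deg a) (h0 : M.toCochain m = 0) : m = 0 := by
  let f : (M.locCoeff a).C (chartSet n) 0 := fun s => ⟨LocalizedModule.mk m 1,
    M.mk_mem_locDeg 1 (MvPolynomial.isWeightedHomogeneous_one _ _) (by rwa [add_zero])⟩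
  have hf := h f (by
    funext s
    apply Subtype.ext
    rw [coe_d, Fin.sum_univ_one, Fin.val_zero, pow_zero, one_smul]
    exact (M.locRes_mk _ m 1).trans (congrFun h0 s))
  have h1 : LocalizedModule.mk m (1 : varMonoid k n (Coeff.cover (chartSet n) Fin.elim0)) = 0 :=
    congrArg Subtype.val (congrFun hf Fin.elim0)
  rw [← LocalizedModule.zero_mk 1, LocalizedModule.mk_eq] at h1
  obtain ⟨⟨r, hr⟩, h1⟩ := h1
  obtain ⟨σ, rfl, hσ⟩ := exists_monomial hr
  have h2 : σ = 0 := Finsupp.ext fun v => hσ v (fun ⟨q, _⟩ => q.elim0)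
  subst h2
  simpa [Submonoid.smul_def] using h1

theorem toCochain_surjOn (M : GrSMod k n) {a : Deg t} (h : (M.locCoeff a).ExactAt (chartSet n) 1)
    {f : M.Cochain 0} (hf : f ∈ M.cocycles 0 a) : ∃ m ∈ M.deg a, M.toCochain m = f := by
  obtain ⟨g, hg⟩ := h _ (M.d_cochainOf a hf)
  obtain ⟨m, hm, hm'⟩ := M.exists_mk_one (U := Coeff.cover (chartSet n) Fin.elim0)
    (fun v ⟨q, _⟩ => q.elim0) _ (g Fin.elim0).2
  refine ⟨m, hm, ?_⟩
  funext s
  have h1 : ((M.locCoeff a).d (chartSet n) g s).1 = f s := congrArg Subtype.val (congrFun hg s)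
  rw [coe_d, Fin.sum_univ_one, Fin.val_zero, pow_zero, one_smul] at h1
  rw [← h1, toCochain_apply]
  have h2 : ∀ s' : Fin 0 → Chart n, ∀ hs : Coeff.cover (chartSet n) s' ⊆ chartVars n s,
      M.locRes hs (g s').1 = LocalizedModule.mk m 1 := by
    intro s' hs
    obtain rfl := Subsingleton.elim s' Fin.elim0
    rw [hm']
    exact M.locRes_mk _ m 1
  exact (h2 _ _).symm

/-! ### The quotient by the torsion -/

/-- The submodule of the elements that vanish on all charts. -/
noncomputable def tors (M : GrSMod k n) : Submodule (Cox k n) M := LinearMap.ker M.toCochain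

theorem mem_tors (M : GrSMod k n) {m : M} : m ∈ M.tors ↔
    ∀ s : Fin 1 → Chart n, ∃ r ∈ varMonoid k n (chartVars n s), r • m = 0 := by
  rw [tors, LinearMap.mem_ker, funext_iff]
  refine forall_congr' fun s => ?_
  rw [toCochain_apply, Pi.zero_apply, ← LocalizedModule.zero_mk 1, LocalizedModule.mk_eq]
  simp only [one_smul, smul_zero]
  exact ⟨fun ⟨r, hr⟩ => ⟨r.1, r.2, hr⟩, fun ⟨r, hr, h⟩ => ⟨⟨r, hr⟩, h⟩⟩

theorem proj_mem_tors (M : GrSMod k n) (a : Deg t) (x : M) (hx : x ∈ M.tors) :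
    proj M.internal a x ∈ M.tors := by
  rw [mem_tors] at hx ⊢
  intro s
  obtain ⟨r, hr, h⟩ := hx s
  obtain ⟨b, hb⟩ := exists_isWeightedHomogeneous hr
  exact ⟨r, hr, by rw [← M.proj_smul hb, h, map_zero]⟩

/-- The image of a module in the sections of its sheaf. -/
noncomputable def reduced (M : GrSMod k n) : GrSMod k n := M.quotient M.tors M.proj_mem_tors

/-- The projection to the quotient by the torsion. -/
noncomputable def reducedMk (M : GrSMod k n) : GHom M M.reduced where
  map := M.tors.mkQ
  map_mem _ m hm := ⟨m, hm, rfl⟩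

theorem reducedMk_surjective (M : GrSMod k n) : Function.Surjective M.reducedMk.map :=
  M.tors.mkQ_surjective

theorem reducedMk_eq_zero (M : GrSMod k n) {m : M} : M.reducedMk.map m = 0 ↔ M.toCochain m = 0 :=
  Submodule.Quotient.mk_eq_zero _

/-- The quotient of a module by its torsion has the same sheaf. -/
noncomputable def reducedIso (M : GrSMod k n) : M.reduced.SheafIso M where
  map := M.tors.liftQ M.toCochain le_rfl
  map_mem := by
    rintro a _ ⟨m, hm, rfl⟩
    exact M.toCochain_mem a m hm
  isLocalized s := by
    have h : IsLocalizedModule (varMonoid k n (chartVars n s))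
      (LocalizedModule.mkLinearMap (varMonoid k n (chartVars n s)) M) := inferInstance
    refine ⟨h.map_units, fun y => ?_, ?_⟩
    · obtain ⟨⟨x, r⟩, hx⟩ := h.surj y
      exact ⟨⟨M.tors.mkQ x, r⟩, hx⟩
    · intro x y hxy
      obtain ⟨x, rfl⟩ := M.tors.mkQ_surjective x
      obtain ⟨y, rfl⟩ := M.tors.mkQ_surjective y
      obtain ⟨r, hr⟩ := h.exists_of_eq (x₁ := x) (x₂ := y) hxy
      exact ⟨r, congrArg M.tors.mkQ hr⟩

/-- The product of the coordinates of a chart lies in the irrelevant ideal and is invertible on the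
chart. So an element killed by a power of that ideal vanishes on every chart, and such elements have
been divided out. -/
theorem reduced_torsionFree (M : GrSMod k n) : M.reduced.TorsionFree := by
  intro m ⟨r, hr⟩
  obtain ⟨m, rfl⟩ := M.reducedMk_surjective m
  rw [reducedMk_eq_zero, ← LinearMap.mem_ker]
  change m ∈ M.tors
  rw [mem_tors]
  intro s
  set q : Cox k n := ∏ i, MvPolynomial.X ⟨i, s 0 i⟩ with hq
  have hq' : q ∈ varMonoid k n (chartVars n s) :=
    Submonoid.prod_mem _ fun i _ => Submonoid.subset_closure
      ⟨⟨i, s 0 i⟩, ⟨0, rfl⟩, rfl⟩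
  have hqB : q ∈ irrelevantIdeal k n := Ideal.subset_span ⟨s 0, rfl⟩
  have h1 := hr (q ^ r) (Ideal.pow_mem_pow hqB r)
  rw [← map_smul] at h1
  have h2 : q ^ r • m ∈ M.tors := (Submodule.Quotient.mk_eq_zero _).mp h1
  obtain ⟨r', hr', h3⟩ := M.mem_tors.mp h2 s
  exact ⟨r' * q ^ r, Submonoid.mul_mem _ hr' (Submonoid.pow_mem _ hq' r), by rw [mul_smul, h3]⟩

end GrSMod

namespace DMod

variable {k : Type u} [Field k] {t : ℕ} {n : Fin t → ℕ}

/-- A bijective morphism of differential modules is an isomorphism. -/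
theorem iso_of_bijective {D D' : DMod k n} (f : Hom D D') (hf : Function.Bijective f.map) :
    Iso D D' := by
  let φ := LinearEquiv.ofBijective f.map hf
  have h1 : ∀ x, φ.symm (f.map x) = x := fun x => φ.symm_apply_apply x
  have h2 : ∀ y, f.map (φ.symm y) = y := fun y => φ.apply_symm_apply y
  refine ⟨f, ⟨φ.symm.toLinearMap, fun g y hy => ?_, fun y => ?_⟩, h1, h2⟩
  · change φ.symm y ∈ D.deg g
    rw [mem_deg_iff D.internal]
    intro g' hg
    apply hf.1
    rw [map_zero]
    refine (proj_comm D.internal D'.internal (f.map.restrictScalars k) id Function.injective_id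
      f.map_mem g' (φ.symm y)).symm.trans ?_
    change proj D'.internal g' (f.map (φ.symm y)) = 0
    rw [h2]
    exact proj_ne D'.internal hy hg.symm
  · apply hf.1
    change f.map (φ.symm (D'.diff y)) = f.map (D.diff (φ.symm y))
    rw [h2, f.comm, h2]

theorem Iso.symm {D D' : DMod k n} (h : Iso D D') : Iso D' D := by
  obtain ⟨f, f', h1, h2⟩ := h
  exact ⟨f', f, h2, h1⟩

theorem Iso.trans {D D' D'' : DMod k n} (h : Iso D D') (h' : Iso D' D'') : Iso D D'' := by
  obtain ⟨f, f', h1, h2⟩ := h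
  obtain ⟨g, g', h3, h4⟩ := h'
  exact ⟨⟨g.map ∘ₗ f.map, fun a x hx => g.map_mem a _ (f.map_mem a x hx), fun x => by
      simp [f.comm, g.comm]⟩,
    ⟨f'.map ∘ₗ g'.map, fun a x hx => f'.map_mem a _ (g'.map_mem a x hx), fun x => by
      simp [f'.comm, g'.comm]⟩, fun x => by simp [h1, h3], fun x => by simp [h2, h4]⟩

variable {T : DMod k n} (B : T.toGrMod.HBasis)

/-! ### The complex of strands -/

theorem diag_congr_of_mem {c c' : B.ι → ℤ} {g : Deg t × ℤ} {x : T.carrier} (hx : x ∈ T.deg g)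
    (h : ∀ i, (∃ l : List (Var n), B.gd i - (l.map bigDeg).sum = g) → c i = c' i) :
    diag B c x = diag B c' x := by
  have hx' := B.mem_span hx
  clear hx
  induction hx' using Submodule.span_induction with
  | mem y hy =>
    obtain ⟨i, l, rfl, hl⟩ := hy
    rw [map_smul, map_smul, diag_b, diag_b, h i ⟨l, hl⟩]
  | zero => rw [map_zero, map_zero]
  | add x y _ _ hx hy => rw [map_add, map_add, hx, hy]
  | smul a x _ hx => rw [LinearMap.map_smul_of_tower, LinearMap.map_smul_of_tower, hx]

variable {B} in
theorem hdeg_of_sub {i : B.ι} {l : List (Var n)} {g : Deg t × ℤ}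
    (h : B.gd i - (l.map bigDeg).sum = g) : hdeg B i = g.2 - total g.1 := by
  rw [← h, list_sum_bigDeg, hdeg, Prod.snd_sub, Prod.fst_sub, total_sub, total_list_sum_varDeg]
  ring

variable {B} in
theorem le_sdeg_of_sub {i : B.ι} {l : List (Var n)} {g : Deg t × ℤ}
    (h : B.gd i - (l.map bigDeg).sum = g) : g.1 - topDeg n ≤ sdeg B i := by
  rw [← h, list_sum_bigDeg, sdeg, Prod.fst_sub]
  exact sub_le_sub_right (sub_le_self _ (list_sum_varDeg_nonneg l)) _

/-- The projection to the summands of a given homological degree. -/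
noncomputable def hp (j : ℤ) : T.EndE := diag B fun i => if hdeg B i = j then 1 else 0

/-- An element of degree (a; b) involves only basis elements of homological degree b - |a|, since
exterior monomials do not change this number. So `hp`, defined through the basis, depends only on
the grading. -/
theorem hp_of_mem {j : ℤ} {g : Deg t × ℤ} {x : T.carrier} (hx : x ∈ T.deg g)
    (h : g.2 - total g.1 = j) : hp B j x = x := by
  have := diag_congr_of_mem B (c := fun i => if hdeg B i = j then 1 else 0) (c' := 1) hx
    (fun i ⟨l, hl⟩ => if_pos ((hdeg_of_sub hl).trans h))
  rwa [diag_one] at this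

theorem hp_of_ne {j : ℤ} {g : Deg t × ℤ} {x : T.carrier} (hx : x ∈ T.deg g)
    (h : g.2 - total g.1 ≠ j) : hp B j x = 0 := by
  have := diag_congr_of_mem B (c := fun i => if hdeg B i = j then 1 else 0) (c' := 0) hx
    (fun i ⟨l, hl⟩ => if_neg fun h' => h ((hdeg_of_sub hl).symm.trans h'))
  refine this.trans ?_
  have h0 : diag B 0 = 0 := B.b.ext fun i => by simp
  rw [h0, LinearMap.zero_apply]

theorem hp_hp (j : ℤ) (x : T.carrier) : hp B j (hp B j x) = hp B j x := by
  rw [← Module.End.mul_apply, hp, diag_mul]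
  congr 2
  ext i
  simp

theorem hp_of_shift {f : T.EndE} {s : ℤ} (hf : HasShift f s) (j : ℤ) (x : T.carrier) :
    hp B (j + s) (f x) = f (hp B j x) := by
  induction x using homogeneous_induction T.internal with
  | h0 => simp only [map_zero]
  | hadd x y hx hy => simp only [map_add, hx, hy]
  | hdeg g x hx =>
    have h1 := hf g x hx
    have h2 : (g + (0, s)).2 - total (g + (0, s)).1 = g.2 - total g.1 + s := by
      rw [Prod.snd_add, Prod.fst_add, add_zero]; ring
    by_cases h : g.2 - total g.1 = j
    · rw [hp_of_mem B hx h, hp_of_mem B h1 (by rw [h2, h])]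
    · rw [hp_of_ne B hx h, hp_of_ne B h1 (by rw [h2]; exact fun h' => h (add_right_cancel h')),
        map_zero]

/-- The submodule of the elements of a given homological degree. -/
noncomputable def strandSub (j : ℤ) : Submodule (Ext k n)ᵐᵒᵖ T.carrier := LinearMap.range (hp B j)

theorem mem_strandSub {j : ℤ} {x : T.carrier} : x ∈ strandSub B j ↔ hp B j x = x :=
  ⟨fun ⟨y, hy⟩ => by rw [← hy, hp_hp], fun h => ⟨x, h⟩⟩

theorem mem_strandSub_of_mem {j : ℤ} {a : Deg t} {x : T.carrier}
    (hx : x ∈ T.deg (a, j + total a)) : x ∈ strandSub B j :=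
  (mem_strandSub B).mpr (hp_of_mem B hx (by simp))

/-- The elements of a given homological degree, as a `ℤ^t`-graded module. -/
noncomputable def strand (j : ℤ) : GrMod k n (varDeg (n := n)) where
  carrier := strandSub B j
  deg a := (T.deg (a, j + total a)).comap ((strandSub B j).subtype.restrictScalars k)
  internal := by
    refine internal_of_proj (fun a => (proj T.internal (a, j + total a) ∘ₗ
      (strandSub B j).subtype.restrictScalars k).codRestrict ((strandSub B j).restrictScalars k)
        fun x => mem_strandSub_of_mem B (proj_mem _ _ _)) ?_ ?_ ?_
    · intro a x hx
      exact Subtype.ext (proj_self T.internal hx)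
    · intro a a' ha x hx
      exact Subtype.ext (proj_ne T.internal hx fun h => ha (congrArg Prod.fst h))
    · rw [eq_top_iff]
      rintro ⟨_, x, rfl⟩ -
      induction x using homogeneous_induction T.internal with
      | h0 =>
        convert Submodule.zero_mem _
        simp only [map_zero]
        rfl
      | hadd x y hx hy =>
        convert Submodule.add_mem _ hx hy
        simp only [map_add]
        rfl
      | hdeg g x hx =>
        by_cases h : g.2 - total g.1 = j
        · refine Submodule.mem_iSup_of_mem g.1 ?_
          change hp B j x ∈ T.deg (g.1, j + total g.1)
          rw [hp_of_mem B hx h, ← h, sub_add_cancel]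
          exact hx
        · convert Submodule.zero_mem _
          exact Subtype.ext (hp_of_ne B hx h)
  act_mem v a x hx := by
    have h := T.act_mem v _ _ hx
    have h' : ((a, j + total a) : Deg t × ℤ) - bigDeg v =
        (a - varDeg v, j + total (a - varDeg v)) := by
      rw [Cpx.total_sub_varDeg]
      exact Prod.ext rfl (by simp only [bigDeg, Prod.snd_sub]; ring)
    rw [h'] at h
    exact h

theorem diff_mem_strandSub {i j : ℤ} (h : i = j + 1) {x : T.carrier} (hx : x ∈ strandSub B i) :
    T.diff x ∈ strandSub B j := by
  rw [mem_strandSub] at hx ⊢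
  have := hp_of_shift B hasShift_diff i x
  rw [hx, show i + -1 = j by omega] at this
  exact this

/-- The complex with folding `T`. -/
noncomputable def unfold : Cpx k n where
  X := strand B
  d i j h := T.diff.restrict (p := strandSub B i) (q := strandSub B j)
    fun _ hx => diff_mem_strandSub B h hx
  d_mem i j h a x hx := by
    have h1 := T.diff_mem _ _ hx
    have h2 : ((a, i + total a) : Deg t × ℤ) + (0, -1) = (a, j + total a) :=
      Prod.ext (add_zero a) (by simp only [Prod.snd_add, h]; ring)
    rw [h2] at h1
    exact h1
  d_comp i j l h h' x := Subtype.ext (T.diff_sq x.1)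

theorem coe_unfold_d (i j : ℤ) (h : i = j + 1) (x : (unfold B).X i) :
    ((unfold B).d i j h x).1 = T.diff x.1 := rfl

/-- The differential module `T` is the folding of its complex of strands. -/
theorem iso_fold_unfold : Iso T (unfold B).fold := by
  refine Iso.symm ?_
  let φ : (⨁ j, (unfold B).X j) →ₗ[(Ext k n)ᵐᵒᵖ] T.carrier :=
    DirectSum.toModule _ ℤ _ fun j => (strandSub B j).subtype
  have hφ : ∀ j (x : (unfold B).X j), φ (DirectSum.of (fun j => (unfold B).X j) j x) = x.1 :=
    fun j x => DirectSum.toModule_lof (Ext k n)ᵐᵒᵖ (φ := fun j => (strandSub B j).subtype) j x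
  have hmem : ∀ g x, x ∈ (unfold B).foldDeg g → φ x ∈ T.deg g := by
    rintro g _ ⟨x, hx, rfl⟩
    have h1 : x.1 ∈ T.deg (g.1, g.2 - total g.1 + total g.1) := hx
    rw [sub_add_cancel] at h1
    rw [DirectSum.lof_eq_of, hφ]
    exact h1
  refine iso_of_bijective (D := (unfold B).fold) (D' := T) ⟨φ, hmem, fun x => ?_⟩ ⟨?_, ?_⟩
  · change φ ((unfold B).foldDiff x) = T.diff (φ x)
    induction x using DirectSum.induction_on with
    | zero => simp only [map_zero]
    | add x y hx hy => simp only [map_add, hx, hy]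
    | of j x => rw [Cpx.foldDiff_of, hφ, hφ, coe_unfold_d]
  -- The projections `hp` recover the summands of a sum of strands, which gives injectivity.
  · have key : ∀ (x : ⨁ j, (unfold B).X j) (j : ℤ), hp B j (φ x) = (x j).1 := by
      intro x j
      induction x using DirectSum.induction_on with
      | zero => simp only [map_zero]; rfl
      | add x y hx hy =>
        rw [map_add, map_add, hx, hy]
        rfl
      | of i x =>
        rw [hφ]
        by_cases h : i = j
        · subst h
          rw [(mem_strandSub B).mp x.2, DirectSum.of_eq_same]
        · rw [DirectSum.of_eq_of_ne _ _ _ (Ne.symm h)]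
          obtain ⟨_, x, rfl⟩ := x
          change hp B j (hp B i x) = 0
          rw [← Module.End.mul_apply, hp, hp, diag_mul]
          have : ((fun l : B.ι => if hdeg B l = j then (1 : ℤ) else 0) *
              fun l => if hdeg B l = i then 1 else 0) = 0 := by
            ext l
            simp only [Pi.mul_apply, Pi.zero_apply]
            split_ifs <;> simp_all
          rw [this]
          have h0 : diag B 0 = 0 := B.b.ext fun i => by simp
          rw [h0, LinearMap.zero_apply]
    rw [injective_iff_map_eq_zero]
    intro x hx
    change φ x = 0 at hx
    refine DFinsupp.ext fun j => Subtype.ext ?_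
    exact (key x j).symm.trans ((congrArg (hp B j) hx).trans (map_zero _))
  · intro x
    induction x using homogeneous_induction T.internal with
    | h0 => exact ⟨0, map_zero φ⟩
    | hadd x y hx hy =>
      obtain ⟨x', hx⟩ := hx
      obtain ⟨y', hy⟩ := hy
      exact ⟨x' + y', (map_add φ x' y').trans (by rw [← hx, ← hy]; rfl)⟩
    | hdeg g x hx =>
      exact ⟨DirectSum.of (fun j => (unfold B).X j) (g.2 - total g.1)
        ⟨x, (mem_strandSub B).mpr (hp_of_mem B hx rfl)⟩, hφ _ _⟩

/-- The basis elements of a given homological degree form a basis of the strand. -/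
noncomputable def strandSubBasis (j : ℤ) :
    Module.Basis {i : B.ι // hdeg B i = j} (Ext k n)ᵐᵒᵖ (strandSub B j) :=
  Module.Basis.mk
    (v := fun i => ⟨B.b i.1, (mem_strandSub B).mpr (hp_of_mem B (B.mem i.1) i.2)⟩)
    (LinearIndependent.of_comp (strandSub B j).subtype
      (B.b.linearIndependent.comp _ Subtype.val_injective)) (by
    rintro ⟨_, x, rfl⟩ -
    have : (⊤ : Submodule (Ext k n)ᵐᵒᵖ T.carrier) ≤ (Submodule.span _ (Set.range
        fun i : {i : B.ι // hdeg B i = j} => (⟨B.b i.1, (mem_strandSub B).mpr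
          (hp_of_mem B (B.mem i.1) i.2)⟩ : strandSub B j))).comap (hp B j).rangeRestrict := by
      rw [← B.b.span_eq, Submodule.span_le]
      rintro _ ⟨i, rfl⟩
      by_cases h : hdeg B i = j
      · exact Submodule.subset_span ⟨⟨i, h⟩, Subtype.ext (hp_of_mem B (B.mem i) h).symm⟩
      · have h0 : (hp B j).rangeRestrict (B.b i) = 0 := Subtype.ext (hp_of_ne B (B.mem i) h)
        exact Submodule.mem_comap.mpr (h0 ▸ Submodule.zero_mem _)
    exact this (x := x) trivial)

theorem coe_strandSubBasis (j : ℤ) (i : {i : B.ι // hdeg B i = j}) :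
    (strandSubBasis B j i).1 = B.b i.1 := by
  rw [strandSubBasis, Module.Basis.mk_apply]

/-- The homogeneous basis of a strand. -/
noncomputable def strandBasis (j : ℤ) : (strand B j).HBasis where
  ι := {i : B.ι // hdeg B i = j}
  b := strandSubBasis B j
  gd i := (B.gd i.1).1
  mem i := by
    change (strandSubBasis B j i).1 ∈ T.deg ((B.gd i.1).1, j + total (B.gd i.1).1)
    have h : j + total (B.gd i.1).1 = (B.gd i.1).2 := by
      have := i.2
      rw [hdeg] at this
      omega
    rw [h, coe_strandSubBasis]
    exact B.mem i.1

theorem unfold_isFree : (unfold B).IsFree := fun j => (strandBasis B j).isFree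

theorem unfold_isMinimal (hT : T.IsMinimal) : (unfold B).IsMinimal := by
  intro i j h x
  have h1 := T.toGrMod.map_idealMul (strand B j) ((hp B j).rangeRestrict) (hT x.1)
  have h2 : (unfold B).d i j h x = (hp B j).rangeRestrict (T.diff x.1) :=
    Subtype.ext ((mem_strandSub B).mp ((unfold B).d i j h x).2).symm
  rw [h2]
  exact h1

end DMod

/-! ### Lower quadrants of complexes of free modules -/

namespace Cpx

variable {k : Type u} [Field k] {t : ℕ} {n : Fin t → ℕ}

/-- A homogeneous element is a combination of multiples of basis elements whose degrees are at least
its own, so basis elements suffice as generators. -/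
theorem span_upperSet (C : Cpx k n) (c : Deg t) (j : ℤ) (D : (C.X j).HBasis) :
    Submodule.span (Ext k n)ᵐᵒᵖ (C.upperSet c j) =
      Submodule.span (Ext k n)ᵐᵒᵖ (D.b '' {i | ∃ l, c l + n l + 1 ≤ D.gd i l}) := by
  refine le_antisymm (Submodule.span_le.mpr ?_) (Submodule.span_mono ?_)
  · rintro x ⟨a, hx, l, hl⟩
    have hx' := D.mem_span hx
    clear hx
    induction hx' using Submodule.span_induction with
    | mem x h =>
      obtain ⟨i, m, rfl, rfl⟩ := h
      refine Submodule.smul_mem _ _ (Submodule.subset_span ⟨i, ⟨l, hl.trans ?_⟩, rfl⟩)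
      rw [Pi.sub_apply]
      exact sub_le_self _ (list_sum_varDeg_nonneg m l)
    | zero => exact Submodule.zero_mem _
    | add x y _ _ hx hy => exact Submodule.add_mem _ hx hy
    | smul r x _ hx => exact (C.X j).smul_deg_mem _ _ _ hx
  · rintro _ ⟨i, ⟨l, hl⟩, rfl⟩
    exact ⟨D.gd i, D.mem i, l, hl⟩

theorem lower_isFree {C : Cpx k n} (hC : C.IsFree) (c : Deg t) : (C.lower c).IsFree := by
  intro j
  obtain ⟨D⟩ := (hC j).hBasis
  set N := Submodule.span (Ext k n)ᵐᵒᵖ (C.upperSet c j) with hN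
  let Q : Set D.ι := {i | ∃ l, c l + n l + 1 ≤ D.gd i l}
  let v : {i : D.ι // i ∉ Q} → (C.X j) ⧸ N := fun i => N.mkQ (D.b i.1)
  have hli : LinearIndependent (Ext k n)ᵐᵒᵖ v := by
    refine (D.b.linearIndependent.comp _ Subtype.val_injective).map (f := N.mkQ) ?_
    rw [Submodule.ker_mkQ, hN, C.span_upperSet c j D, Set.range_comp, Subtype.range_coe_subtype]
    refine D.b.linearIndependent.disjoint_span_image ?_
    exact Set.disjoint_left.mpr fun i hi hi' => hi hi'
  have hsp : ⊤ ≤ Submodule.span (Ext k n)ᵐᵒᵖ (Set.range v) := by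
    rintro x -
    obtain ⟨x, rfl⟩ := N.mkQ_surjective x
    have : (⊤ : Submodule (Ext k n)ᵐᵒᵖ (C.X j)) ≤
        (Submodule.span (Ext k n)ᵐᵒᵖ (Set.range v)).comap N.mkQ := by
      rw [← D.b.span_eq, Submodule.span_le]
      rintro _ ⟨i, rfl⟩
      by_cases hi : i ∈ Q
      · have h0 : N.mkQ (D.b i) = 0 := by
          rw [Submodule.mkQ_apply, Submodule.Quotient.mk_eq_zero]
          obtain ⟨l, hl⟩ := hi
          exact Submodule.subset_span ⟨_, D.mem i, l, hl⟩
        exact Submodule.mem_comap.mpr (h0 ▸ Submodule.zero_mem _)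
      · exact Submodule.subset_span ⟨⟨i, hi⟩, rfl⟩
    exact this trivial
  refine ⟨{i : D.ι // i ∉ Q}, Module.Basis.mk hli hsp, fun i => ⟨D.gd i.1, ?_⟩⟩
  have h : (Module.Basis.mk hli hsp) i = N.mkQ (D.b i.1) := Module.Basis.mk_apply hli hsp i
  exact h ▸ ⟨D.b i.1, D.mem i.1, rfl⟩

theorem lower_isMinimal {C : Cpx k n} (hC : C.IsMinimal) (c : Deg t) : (C.lower c).IsMinimal := by
  intro i j h x
  obtain ⟨x, rfl⟩ := Submodule.mkQ_surjective _ x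
  exact (C.X j).map_idealMul ((C.lower c).X j) (Submodule.mkQ _) (hC i j h x)

end Cpx

/-! ### Lower and upper quadrants of `T` and of its complex of strands -/

namespace DMod

variable {k : Type u} [Field k] {t : ℕ} {n : Fin t → ℕ} {T : DMod k n} (B : T.toGrMod.HBasis)

theorem reg_eq_zero_of_mem {c : Deg t} {g : Deg t × ℤ} {x : T.carrier} (hx : x ∈ T.deg g)
    {l : Fin t} (h : c l + n l + 1 ≤ g.1 l) : reg B (quad c 0) x = 0 := by
  have h1 := diag_congr_of_mem B (c := ind B (quad c 0)) (c' := 0) hx (fun i ⟨m, hm⟩ => by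
    refine ind_of_notMem B fun hi => ?_
    have h2 := le_sdeg_of_sub hm l
    have h3 := (hi l).2 (Nat.zero_le _)
    simp only [Pi.sub_apply, topDeg] at h2
    omega)
  refine h1.trans ?_
  have h0 : diag B 0 = 0 := B.b.ext fun i => by simp
  rw [h0, LinearMap.zero_apply]

theorem reg_eq_self_of_mem {c : Deg t} {g : Deg t × ℤ} {x : T.carrier} (hx : x ∈ T.deg g)
    (h : c + topDeg n ≤ g.1) : reg B (quad c t) x = x := by
  have h1 := diag_congr_of_mem B (c := ind B (quad c t)) (c' := 1) hx (fun i ⟨m, hm⟩ =>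
    ind_of_mem B fun l => ⟨fun _ => ?_, fun hl => absurd l.2 (by omega)⟩)
  · rwa [diag_one] at h1
  · exact (le_sub_iff_add_le.mpr h).trans (le_sdeg_of_sub hm) l

/-- The inclusion of a strand. -/
noncomputable def strandIncl (j : ℤ) : (unfold B).X j →ₗ[(Ext k n)ᵐᵒᵖ] T.carrier :=
  (strandSub B j).subtype

theorem strandIncl_injective (j : ℤ) : Function.Injective (strandIncl B j) := Subtype.val_injective

theorem hp_strandIncl (j : ℤ) (x : (unfold B).X j) : hp B j (strandIncl B j x) = strandIncl B j x :=
  (mem_strandSub B).mp x.2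

theorem exists_strandIncl {j : ℤ} {x : T.carrier} (h : hp B j x = x) : ∃ y, strandIncl B j y = x :=
  ⟨⟨x, (mem_strandSub B).mpr h⟩, rfl⟩

theorem strandIncl_d (i j : ℤ) (h : i = j + 1) (x : (unfold B).X i) :
    strandIncl B j ((unfold B).d i j h x) = T.diff (strandIncl B i x) := rfl

theorem strandIncl_mem {j : ℤ} {a : Deg t} {x : (unfold B).X j} :
    strandIncl B j x ∈ T.deg (a, j + total a) ↔ x ∈ ((unfold B).X j).deg a := Iff.rfl

/-- This matches the two descriptions of the lower quadrant, by degrees of generators and by degrees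
of socles. They differ by `topDeg`, whence the n_l + 1 in `upperSet`. -/
theorem mem_span_upperSet_iff {c : Deg t} {j : ℤ} {x : (unfold B).X j} :
    x ∈ Submodule.span (Ext k n)ᵐᵒᵖ ((unfold B).upperSet c j) ↔
      reg B (quad c 0) (strandIncl B j x) = 0 := by
  constructor
  · intro hx
    have hle : Submodule.span (Ext k n)ᵐᵒᵖ ((unfold B).upperSet c j) ≤
        LinearMap.ker (reg B (quad c 0) ∘ₗ strandIncl B j) := by
      rw [Submodule.span_le]
      rintro x ⟨a, hx, l, hl⟩
      exact reg_eq_zero_of_mem B (g := (a, j + total a)) hx hl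
    exact hle hx
  · intro hx
    have key : ∀ y : T.carrier, ((hp B j * (1 - reg B (quad c 0))) y) ∈
        (Submodule.span (Ext k n)ᵐᵒᵖ ((unfold B).upperSet c j)).map (strandIncl B j) := by
      refine mem_of_basis_mem B _ _ fun i => ?_
      rw [Module.End.mul_apply, LinearMap.sub_apply, Module.End.one_apply]
      by_cases hq : sdeg B i ∈ quad c 0
      · rw [reg, diag_b, ind_of_mem B hq, one_smul, sub_self, map_zero]
        exact Submodule.zero_mem _
      · rw [reg, diag_b, ind_of_notMem B hq, zero_smul, sub_zero]
        by_cases hj : hdeg B i = j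
        · rw [hp_of_mem B (B.mem i) hj]
          have hj' : j + total (B.gd i).1 = (B.gd i).2 := by rw [← hj, hdeg]; ring
          have hmem : B.b i ∈ T.deg ((B.gd i).1, j + total (B.gd i).1) := by
            rw [hj']; exact B.mem i
          refine ⟨⟨B.b i, mem_strandSub_of_mem B hmem⟩, Submodule.subset_span ?_, rfl⟩
          have hq' : ∃ l, c l ≤ sdeg B i l := by
            by_contra h
            push Not at h
            exact hq fun l => ⟨fun hl => absurd hl (Nat.not_lt_zero _), fun _ => h l⟩
          obtain ⟨l, hl⟩ := hq'
          refine ⟨(B.gd i).1, hmem, l, ?_⟩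
          rw [sdeg, Pi.sub_apply, topDeg] at hl
          omega
        · rw [hp_of_ne B (B.mem i) hj]
          exact Submodule.zero_mem _
    obtain ⟨y, hy, hyx⟩ := key (strandIncl B j x)
    rw [Module.End.mul_apply, LinearMap.sub_apply, hx, Module.End.one_apply, sub_zero,
      hp_strandIncl] at hyx
    rwa [strandIncl_injective B j hyx] at hy

/-- The lower quadrant is downward closed, hence a quotient of `T`; dually, in `reg_diff_upper`, the
upper quadrant is upward closed, hence a differential submodule. -/
theorem reg_diff_lower (c : Deg t) :
    reg B (quad c 0) * T.diff * reg B (quad c 0) = reg B (quad c 0) * T.diff := by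
  have h := sandwich_congr (B := B) (c₁ := ind B (quad c 0)) (c₁' := ind B (quad c 0))
    (c₂ := ind B (quad c 0)) (c₂' := 1) (fun i j hij => by
      by_cases hj : sdeg B j ∈ quad c 0
      · rw [ind_of_mem B (R := quad c 0) (i := i) fun l =>
          ⟨fun hl => absurd hl (Nat.not_lt_zero _), fun hl => (hij.sdeg_le l).trans_lt ((hj l).2 hl)⟩]
        rfl
      · rw [ind_of_notMem B hj, mul_zero, mul_zero])
  rwa [diag_one, mul_one] at h

theorem reg_diff_upper (c : Deg t) :
    reg B (quad c t) * T.diff * reg B (quad c t) = T.diff * reg B (quad c t) := by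
  have h := sandwich_congr (B := B) (c₁ := ind B (quad c t)) (c₁' := ind B (quad c t))
    (c₂ := 1) (c₂' := ind B (quad c t)) (fun i j hij => by
      by_cases hi : sdeg B i ∈ quad c t
      · rw [ind_of_mem B (R := quad c t) (i := j) fun l =>
          ⟨fun hl => ((hi l).1 hl).trans (hij.sdeg_le l), fun hl => absurd l.2 (by omega)⟩]
        rfl
      · rw [ind_of_notMem B hi, zero_mul, zero_mul])
  rwa [diag_one, one_mul] at h

variable {B} in
-- With a quotient of `T` as source and a submodule as target, a chain map between the truncations
-- commutes with the differential of `T` itself.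
theorem QuasiIso.diff_comm {c : Deg t} {f : T.EndE} (h : QuasiIso B (quad c 0) (quad c t) f) :
    T.diff * f = f * T.diff := by
  calc T.diff * f = T.diff * reg B (quad c t) * f := by rw [mul_assoc, h.left]
    _ = dreg B (quad c t) * f := by rw [← reg_diff_upper, dreg]
    _ = f * dreg B (quad c 0) := h.comm
    _ = f * (reg B (quad c 0) * T.diff) := by rw [dreg, reg_diff_lower]
    _ = f * T.diff := by rw [← mul_assoc, h.right]

/-- The corner maps are compatible up to homotopy for the differential of `T`. -/
theorem exists_corner_homotopy (hT : ∀ r : Fin t, T.ExactOn {v : Var n | v.1 = r}) {c c' : Deg t}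
    (hc : c ≤ c') : ∃ H : T.EndE, HasShift H (1 - t) ∧ reg B (quad c t) * H = H ∧
      H * reg B (quad c' 0) = H ∧
      corner B c' t - corner B c t = T.diff * H + H * T.diff := by
  obtain ⟨H, h1, h2, h3⟩ := corner_homotopy B hT hc t le_rfl
  have hq := quasiIso_corner B hT c t le_rfl
  have hq' := quasiIso_corner B hT c' t le_rfl
  -- Both corner maps already vanish outside the lower quadrant at c', so the homotopy can be cut
  -- off there; afterwards it factors through that quadrant.
  refine ⟨H * reg B (quad c' 0), ?_, by rw [← mul_assoc, h2], by rw [mul_assoc, reg_idem], ?_⟩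
  · have := h1.mul (hasShift_diag B (ind B (quad c' 0)))
    rwa [add_zero] at this
  · have h4 : reg B (quad c t) * corner B c' t = corner B c' t := by
      rw [← hq'.left, ← mul_assoc, reg_mul_of_subset' B (quad_top_mono hc)]
    have h5 : corner B c t * reg B (quad c' 0) = corner B c t := by
      conv_rhs => rw [← hq.right, ← reg_mul_of_subset B (quad_zero_mono hc), ← mul_assoc, hq.right]
    have h6 : dreg B (quad c t) * H = T.diff * H := by
      rw [dreg, reg_diff_upper, mul_assoc, h2]
    rw [h4, h6] at h3
    have h7 := congrArg (· * reg B (quad c' 0)) h3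
    simp only [sub_mul, add_mul] at h7
    rw [hq'.right, h5] at h7
    rw [h7, mul_assoc, mul_assoc H, mul_assoc H, dreg_mul_reg, dreg, reg_diff_lower]

end DMod

namespace DMod

variable {k : Type u} [Field k] {t : ℕ} {n : Fin t → ℕ} {T : DMod k n} (B : T.toGrMod.HBasis)
  {P : GrSMod k n} (ψ : Hom (RR P.reduced) T)

/-! ### The upper quadrants -/

/-- Every exterior variable has total degree -1, so in ω_E the multidegree determines the additional
integral degree. -/
theorem omegaDeg_bigDeg {b : Deg t} {f : Omega k n} (hf : f ∈ omegaDeg k n varDeg b) :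
    f ∈ omegaDeg k n bigDeg (b, total b) := by
  intro h hh x hx
  induction hx using Submodule.span_induction with
  | mem x hx =>
    obtain ⟨l, rfl, rfl⟩ := hx
    refine hf (-(l.map varDeg).sum) (fun h' => hh ?_) _ (Submodule.subset_span ⟨l, rfl, rfl⟩)
    rw [list_sum_bigDeg, ← neg_injective h', total_list_sum_varDeg]
  | zero => rw [map_zero]
  | add x y _ _ hx hy => rw [map_add, hx, hy, add_zero]
  | smul c x _ hx => rw [map_smul, hx, smul_zero]

variable (P) in
/-- The projection `ω_E ⊗ P → ω_E ⊗ (P / torsion)`. -/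
noncomputable def tensorReduced : Omega k n ⊗[k] P →ₗ[(Ext k n)ᵐᵒᵖ] Omega k n ⊗[k] P.reduced :=
  TensorProduct.AlgebraTensorModule.map LinearMap.id (P.reducedMk.map.restrictScalars k)

theorem tensorReduced_koszulDiff (f : Omega k n) (m : P) :
    tensorReduced P (P.koszulDiff (f ⊗ₜ[k] m)) =
      P.reduced.koszulDiff (f ⊗ₜ[k] P.reducedMk.map m) := by
  rw [GrSMod.koszulDiff_tmul, GrSMod.koszulDiff_tmul, map_sum]
  refine Finset.sum_congr rfl fun v _ => ?_
  rw [tensorReduced, TensorProduct.AlgebraTensorModule.map_tmul]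
  exact congrArg (omegaLeft k n v f ⊗ₜ[k] ·)
    (map_smul P.reducedMk.map (MvPolynomial.X v : Cox k n) m)

/-- The map from `ω_E ⊗ P` induced by a morphism from `R(P / torsion)`. -/
noncomputable def phi : Omega k n ⊗[k] P →ₗ[(Ext k n)ᵐᵒᵖ] T.carrier := ψ.map ∘ₗ tensorReduced P

theorem phi_tmul (f : Omega k n) (m : P) :
    phi ψ (f ⊗ₜ[k] m) = ψ.map (f ⊗ₜ[k] P.reducedMk.map m : Omega k n ⊗[k] P.reduced) := rfl

theorem phi_mem {g : Deg t × ℤ} {a : Deg t} {f : Omega k n} (hf : f ∈ omegaDeg k n bigDeg g) {m : P}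
    (hm : m ∈ P.deg a) : phi ψ (f ⊗ₜ[k] m) ∈ T.deg (g + (a, 0)) := by
  have h : f ⊗ₜ[k] P.reducedMk.map m ∈
      P.reduced.koszulDeg bigDeg (AddMonoidHom.inl (Deg t) ℤ) (g + (a, 0)) :=
    Submodule.subset_span ⟨a, _, P.reducedMk.map_mem a m hm, f, by
      rwa [AddMonoidHom.inl_apply, add_sub_cancel_right], rfl⟩
  exact ψ.map_mem _ _ h

theorem phi_diff (z : Omega k n ⊗[k] P) : phi ψ (P.koszulDiff z) = T.diff (phi ψ z) := by
  induction z using TensorProduct.induction_on with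
  | zero => simp only [map_zero]
  | add x y hx hy => simp only [map_add, hx, hy]
  | tmul f m =>
    exact (congrArg ψ.map (tensorReduced_koszulDiff f m)).trans (ψ.comm _)

/-- All terms of the complex `R(P_{≥ c})`. -/
noncomputable def headAll (P : GrSMod k n) (c : Deg t) : Submodule (Ext k n)ᵐᵒᵖ (Omega k n ⊗[k] P) :=
  Submodule.span _ (⋃ j, P.headSet c j)

theorem head_le_headAll (c : Deg t) (j : ℤ) :
    Submodule.span (Ext k n)ᵐᵒᵖ (P.headSet c j) ≤ headAll P c :=
  Submodule.span_mono (Set.subset_iUnion _ j)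

theorem reducedMk_injOn {c : Deg t}
    (hc : ∀ a, c ≤ a → ∀ m ∈ P.deg a, P.toCochain m = 0 → m = 0) {x : P}
    (hx : x ∈ ⨆ a : {a : Deg t // c ≤ a}, P.deg a.1) (h0 : P.reducedMk.map x = 0) : x = 0 := by
  have hx' : x ∈ P.tors := LinearMap.mem_ker.mpr (P.reducedMk_eq_zero.mp h0)
  refine eq_of_proj_eq P.internal fun a => ?_
  rw [map_zero]
  by_cases ha : c ≤ a
  · exact hc a ha _ (proj_mem _ _ _) (LinearMap.mem_ker.mp (P.proj_mem_tors a x hx'))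
  · have hle : (⨆ a : {a : Deg t // c ≤ a}, P.deg a.1) ≤ LinearMap.ker (proj P.internal a) :=
      iSup_le fun a' y hy => proj_ne P.internal hy fun h => ha (h ▸ a'.2)
    exact hle hx

/-- By `hc` there is no torsion in degrees ≥ c, so P_{≥c} embeds in P modulo torsion; tensoring over
the field and applying ψ keep this injective. -/
theorem phi_injOn (hψ : Function.Injective ψ.map) {c : Deg t}
    (hc : ∀ a, c ≤ a → ∀ m ∈ P.deg a, P.toCochain m = 0 → m = 0) {z : Omega k n ⊗[k] P}
    (hz : z ∈ headAll P c) (h0 : phi ψ z = 0) : z = 0 := by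
  let Q : Submodule k P := ⨆ a : {a : Deg t // c ≤ a}, P.deg a.1
  let ι : Omega k n ⊗[k] Q →ₗ[(Ext k n)ᵐᵒᵖ] Omega k n ⊗[k] P :=
    TensorProduct.AlgebraTensorModule.map LinearMap.id Q.subtype
  have hle : headAll P c ≤ LinearMap.range ι := by
    rw [headAll, Submodule.span_le]
    intro z hz
    obtain ⟨j, a, ha, -, m, hm, b, f, -, rfl⟩ := Set.mem_iUnion.mp hz
    exact ⟨f ⊗ₜ ⟨m, Submodule.mem_iSup_of_mem (⟨a, ha⟩ : {a : Deg t // c ≤ a}) hm⟩, rfl⟩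
  obtain ⟨w, rfl⟩ := hle hz
  let μ : Q →ₗ[k] P.reduced := P.reducedMk.map.restrictScalars k ∘ₗ Q.subtype
  have hμ : Function.Injective μ := by
    rw [injective_iff_map_eq_zero]
    intro x hx
    exact Subtype.ext (reducedMk_injOn hc x.2 hx)
  have h1 : ∀ w, phi ψ (ι w) = ψ.map (LinearMap.lTensor (Omega k n) μ w) := by
    intro w
    induction w using TensorProduct.induction_on with
    | zero => simp only [map_zero]; exact (map_zero ψ.map).symm
    | add x y hx hy => rw [map_add, map_add, map_add, hx, hy]; exact (map_add ψ.map _ _).symm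
    | tmul f m => rfl
  rw [h1] at h0
  have h2 := Module.Flat.lTensor_preserves_injective_linearMap (M := Omega k n) μ hμ
  have h3 : LinearMap.lTensor (Omega k n) μ w = 0 := hψ (h0.trans (map_zero _).symm)
  rw [h2 (h3.trans (map_zero _).symm), map_zero]

theorem phi_headSet_mem {a b : Deg t} {f : Omega k n} (hf : f ∈ omegaDeg k n varDeg b)
    {m : P} (hm : m ∈ P.deg a) : phi ψ (f ⊗ₜ[k] m) ∈ T.deg (b + a, total b) := by
  have := phi_mem ψ (omegaDeg_bigDeg hf) hm
  rwa [Prod.mk_add_mk, add_zero] at this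

theorem phi_hp {c : Deg t} {j : ℤ} {z : Omega k n ⊗[k] P}
    (hz : z ∈ Submodule.span (Ext k n)ᵐᵒᵖ (P.headSet c j)) : hp B j (phi ψ z) = phi ψ z := by
  induction hz using Submodule.span_induction with
  | mem z hz =>
    obtain ⟨a, -, hj, m, hm, b, f, hf, rfl⟩ := hz
    exact hp_of_mem B (phi_headSet_mem ψ hf hm) (by simp only [total_add]; omega)
  | zero => simp only [map_zero]
  | add x y _ _ hx hy => simp only [map_add, hx, hy]
  | smul r x _ hx => simp only [map_smul, hx]

/-- Since ω_E is cyclic, it suffices to test f₀ ⊗ m, whose degree `topDeg` + a is large enough for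
the upper quadrant. -/
theorem phi_reg {c : Deg t} {z : Omega k n ⊗[k] P} (hz : z ∈ headAll P c) :
    reg B (quad c t) (phi ψ z) = phi ψ z := by
  induction hz using Submodule.span_induction with
  | mem z hz =>
    obtain ⟨j, a, ha, hj, m, hm, b, f, -, rfl⟩ := Set.mem_iUnion.mp hz
    obtain ⟨f₀, hf₀, -, hgen⟩ := exists_omega_generator (k := k) (n := n) (varDeg (n := n))
    obtain ⟨r, rfl⟩ := hgen f
    have h1 : reg B (quad c t) (phi ψ (f₀ ⊗ₜ[k] m)) = phi ψ (f₀ ⊗ₜ[k] m) := by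
      refine reg_eq_self_of_mem B (phi_headSet_mem ψ hf₀ hm) ?_
      rw [sum_varDeg, add_comm]
      exact add_le_add_right ha _
    rw [← TensorProduct.smul_tmul', map_smul, map_smul, h1]
  | zero => simp only [map_zero]
  | add x y _ _ hx hy => simp only [map_add, hx, hy]
  | smul r x _ hx => simp only [map_smul, hx]

/-- Nakayama's lemma: by hypothesis the socle of each summand in the upper quadrant is hit, so each
basis element agrees with the image of some f₀ ⊗ m after multiplication by the top monomial, and
therefore modulo 𝔪. -/
theorem exists_phi_eq {c : Deg t} (hs : ∀ i, c ≤ sdeg B i → ∃ a, c ≤ a ∧ ∃ m ∈ P.deg a,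
      phi ψ (oneDual k n ⊗ₜ[k] m) = op (topMono k n) • B.b i)
    {y : T.carrier} (hy : reg B (quad c t) y = y) : ∃ z ∈ headAll P c, phi ψ z = y := by
  obtain ⟨f₀, hf₀, htop, -⟩ := exists_omega_generator (k := k) (n := n) (varDeg (n := n))
  have key : LinearMap.range (reg B (quad c t)) ≤ (headAll P c).map (phi ψ) := by
    refine T.le_of_le_sup_e_smul _ _ ?_
    rintro _ ⟨x, rfl⟩
    refine mem_of_basis_mem B _ _ (fun i => ?_) x
    by_cases hi : sdeg B i ∈ quad c t
    · have hb : reg B (quad c t) (B.b i) = B.b i := by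
        rw [reg, diag_b, ind_of_mem B hi, one_smul]
      rw [hb]
      obtain ⟨a, ha, m, hm, h⟩ := hs i fun l => (hi l).1 l.2
      have hz : f₀ ⊗ₜ[k] m ∈ headAll P c := Submodule.subset_span
        (Set.mem_iUnion.mpr ⟨-total a, a, ha, (neg_neg _).symm, m, hm, _, f₀, hf₀, rfl⟩)
      have h1 : B.b i - phi ψ (f₀ ⊗ₜ[k] m) ∈ T.maxMul := by
        refine B.mem_maxMul_of_topMono ?_
        rw [smul_sub, ← h, ← htop, ← TensorProduct.smul_tmul', map_smul, sub_self]
      -- Projecting to the upper quadrant shows that the remainder is in 𝔪 times that quadrant, as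
      -- Nakayama's lemma requires, and not merely in 𝔪 times `T`.
      have h2 : B.b i - phi ψ (f₀ ⊗ₜ[k] m) ∈ Submodule.span (Ext k n)ᵐᵒᵖ
          {y | ∃ v : Var n, ∃ x ∈ LinearMap.range (reg B (quad c t)), y = op (e k v) • x} := by
        have h3 : reg B (quad c t) (B.b i - phi ψ (f₀ ⊗ₜ[k] m)) =
            B.b i - phi ψ (f₀ ⊗ₜ[k] m) := by rw [map_sub, hb, phi_reg B ψ hz]
        rw [← h3]
        clear h3
        generalize B.b i - phi ψ (f₀ ⊗ₜ[k] m) = w at h1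
        induction h1 using Submodule.span_induction with
        | mem w hw =>
          obtain ⟨v, -, x, rfl⟩ := hw
          rw [map_smul]
          exact Submodule.subset_span ⟨v, _, ⟨x, rfl⟩, rfl⟩
        | zero => rw [map_zero]; exact Submodule.zero_mem _
        | add x y _ _ hx hy => rw [map_add]; exact Submodule.add_mem _ hx hy
        | smul r x _ hx => rw [map_smul]; exact Submodule.smul_mem _ _ hx
      have := Submodule.add_mem_sup (Submodule.mem_map_of_mem (f := phi ψ) hz) h2
      rwa [add_sub_cancel] at this
    · rw [reg, diag_b, ind_of_notMem B hi, zero_smul]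
      exact Submodule.zero_mem _
  obtain ⟨z, hz, hzy⟩ := key ⟨y, hy⟩
  exact ⟨z, hz, hzy⟩

theorem exists_phi_eq_strand {c : Deg t} (hs : ∀ i, c ≤ sdeg B i → ∃ a, c ≤ a ∧ ∃ m ∈ P.deg a,
      phi ψ (oneDual k n ⊗ₜ[k] m) = op (topMono k n) • B.b i)
    {y : T.carrier} (hy : reg B (quad c t) y = y) {j : ℤ} (hj : hp B j y = y) :
    ∃ z ∈ Submodule.span (Ext k n)ᵐᵒᵖ (P.headSet c j), phi ψ z = y := by
  obtain ⟨z, hz, rfl⟩ := exists_phi_eq B ψ hs hy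
  rw [← hj]
  clear hy hj
  induction hz using Submodule.span_induction with
  | mem z hz =>
    obtain ⟨j', hz⟩ := Set.mem_iUnion.mp hz
    by_cases h : j' = j
    · subst h
      exact ⟨z, Submodule.subset_span hz, (phi_hp B ψ (Submodule.subset_span hz)).symm⟩
    · refine ⟨0, Submodule.zero_mem _, ?_⟩
      obtain ⟨a, -, hj, m, hm, b, f, hf, rfl⟩ := hz
      rw [map_zero, hp_of_ne B (phi_headSet_mem ψ hf hm)]
      simp only [total_add]
      omega
  | zero => exact ⟨0, Submodule.zero_mem _, by simp only [map_zero]⟩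
  | add x y _ _ hx hy =>
    obtain ⟨x', hx', hx⟩ := hx
    obtain ⟨y', hy', hy⟩ := hy
    exact ⟨x' + y', Submodule.add_mem _ hx' hy', by rw [map_add, hx, hy, map_add, map_add]⟩
  | smul r x _ hx =>
    obtain ⟨x', hx', hx⟩ := hx
    exact ⟨r • x', Submodule.smul_mem _ _ hx', by rw [map_smul, hx, map_smul, map_smul]⟩

/-- The map from a term of `R(P_{≥ c})` to `T`. -/
noncomputable def phiHead (c : Deg t) (j : ℤ) : (P.head c).X j →ₗ[(Ext k n)ᵐᵒᵖ] T.carrier :=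
  phi ψ ∘ₗ (Submodule.span (Ext k n)ᵐᵒᵖ (P.headSet c j)).subtype

theorem phiHead_d (c : Deg t) (i j : ℤ) (h : i = j + 1) (x : (P.head c).X i) :
    phiHead ψ c j ((P.head c).d i j h x) = T.diff (phiHead ψ c i x) := phi_diff ψ x.1

/-- The ℤ^t-grading of ω_E ⊗ P does not see the homological degree, so an element of degree a may be
spread over several strands; `hp` selects one of them. -/
theorem hp_phi_mem (j : ℤ) (a : Deg t) (z : Omega k n ⊗[k] P)
    (hz : z ∈ P.koszulDeg varDeg (AddMonoidHom.id (Deg t)) a) :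
    hp B j (phi ψ z) ∈ T.deg (a, j + total a) := by
  induction hz using Submodule.span_induction with
  | mem z hz =>
    obtain ⟨a', m, hm, f, hf, rfl⟩ := hz
    have h1 := phi_headSet_mem ψ hf hm
    rw [AddMonoidHom.id_apply, sub_add_cancel] at h1
    by_cases h : total (a - a') - total a = j
    · rw [hp_of_mem B h1 h, ← h, sub_add_cancel]
      exact h1
    · rw [hp_of_ne B h1 h]
      exact Submodule.zero_mem _
  | zero => simp only [map_zero]; exact Submodule.zero_mem _
  | add x y _ _ hx hy => rw [map_add, map_add]; exact Submodule.add_mem _ hx hy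
  | smul r x _ hx =>
    rw [LinearMap.map_smul_of_tower, LinearMap.map_smul_of_tower]
    exact Submodule.smul_mem _ _ hx

theorem phiHead_mem (B : T.toGrMod.HBasis) (ψ : Hom (RR P.reduced) T) {c : Deg t} {j : ℤ}
    (a : Deg t) (x : (P.head c).X j) (hx : x ∈ ((P.head c).X j).deg a) :
    phiHead ψ c j x ∈ T.deg (a, j + total a) := by
  have h := hp_phi_mem B ψ j a x.1 hx
  rwa [phi_hp B ψ x.2] at h

/-- The map `R(P_{≥ c}) → T` identifies the source with the upper quadrant of `T` at `c`. -/
structure IsUpper (c : Deg t) : Prop where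
  inj : ∀ j, Function.Injective (phiHead ψ c j)
  surj : ∀ j y, reg B (quad c t) y = y → hp B j y = y → ∃ z, phiHead ψ c j z = y

theorem isUpper_of (hψ : Function.Injective ψ.map) {c : Deg t}
    (hc : ∀ a, c ≤ a → ∀ m ∈ P.deg a, P.toCochain m = 0 → m = 0)
    (hs : ∀ i, c ≤ sdeg B i → ∃ a, c ≤ a ∧ ∃ m ∈ P.deg a,
      phi ψ (oneDual k n ⊗ₜ[k] m) = op (topMono k n) • B.b i) : IsUpper B ψ c where
  inj j := by
    rw [injective_iff_map_eq_zero]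
    intro x hx
    exact Subtype.ext (phi_injOn ψ hψ hc (head_le_headAll c j x.2) hx)
  surj j y hy hj := by
    obtain ⟨z, hz, h⟩ := exists_phi_eq_strand B ψ hs hy hj
    exact ⟨⟨z, hz⟩, h⟩

variable {B ψ} in
/-- An operator from a lower quadrant to an upper quadrant induces a map to `R(P_{≥ c})`. -/
theorem IsUpper.exists_map {c : Deg t} (hc : IsUpper B ψ c) {c' : Deg t} {A : T.EndE} {s : ℤ}
    (hs : HasShift A s) (hl : reg B (quad c t) * A = A) (hr : A * reg B (quad c' 0) = A)
    (i j : ℤ) (hij : j = i + s) :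
    ∃ F : ((unfold B).lower c').X i →ₗ[(Ext k n)ᵐᵒᵖ] (P.head c).X j,
      (∀ a x, x ∈ (((unfold B).lower c').X i).deg a → F x ∈ ((P.head c).X j).deg a) ∧
      ∀ x, phiHead ψ c j (F (Submodule.mkQ _ x)) = A (strandIncl B i x) := by
  have hex : ∀ x : (unfold B).X i, ∃ z, phiHead ψ c j z = A (strandIncl B i x) := fun x => by
    refine hc.surj j _ ?_ ?_
    · rw [← Module.End.mul_apply, hl]
    · rw [hij, hp_of_shift B hs, hp_strandIncl]
  -- Preimages under the injective map `phiHead` are unique; linearity and homogeneity are therefore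
  -- inherited from `A`.
  choose F₀ hF₀ using hex
  let F₁ : (unfold B).X i →ₗ[(Ext k n)ᵐᵒᵖ] (P.head c).X j :=
    { toFun := F₀
      map_add' := fun x y => hc.inj j (by rw [map_add, hF₀, hF₀, hF₀, map_add, map_add])
      map_smul' := fun r x => hc.inj j (by
        rw [RingHom.id_apply, map_smul, hF₀, hF₀, map_smul, map_smul]) }
  have hker : Submodule.span (Ext k n)ᵐᵒᵖ ((unfold B).upperSet c' i) ≤ LinearMap.ker F₁ := by
    intro x hx
    rw [LinearMap.mem_ker]
    apply hc.inj j
    rw [map_zero]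
    refine (hF₀ x).trans ?_
    rw [← hr, Module.End.mul_apply, (mem_span_upperSet_iff B).mp hx, map_zero]
  refine ⟨Submodule.liftQ _ F₁ hker, ?_, hF₀⟩
  rintro a _ ⟨x, hx, rfl⟩
  change F₁ x ∈ _
  rw [mem_deg_iff ((P.head c).X j).internal]
  intro a' ha
  apply hc.inj j
  rw [map_zero]
  have h1 := proj_comm ((P.head c).X j).internal T.internal ((phiHead ψ c j).restrictScalars k)
    (fun a => (a, j + total a)) (fun a a' h => congrArg Prod.fst h) (phiHead_mem B ψ) a' (F₁ x)
  refine h1.symm.trans ?_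
  change proj T.internal (a', j + total a') (phiHead ψ c j (F₀ x)) = 0
  rw [hF₀]
  have h2 := hs _ _ ((strandIncl_mem B).mpr hx)
  refine proj_ne T.internal h2 fun h => ha ?_
  have := congrArg Prod.fst h
  rw [Prod.fst_add, add_zero] at this
  exact this.symm

end DMod

namespace Cpx

variable {k : Type u} [Field k] {t : ℕ} {n : Fin t → ℕ} (C : Cpx k n)

/-- The projection to a lower quadrant. -/
def lowerMk (c : Deg t) (j : ℤ) : C.X j →ₗ[(Ext k n)ᵐᵒᵖ] (C.lower c).X j :=
  Submodule.mkQ (Submodule.span (Ext k n)ᵐᵒᵖ (C.upperSet c j))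

theorem lowerMk_surjective (c : Deg t) (j : ℤ) : Function.Surjective (C.lowerMk c j) :=
  Submodule.mkQ_surjective _

theorem lowerMk_eq_zero {c : Deg t} {j : ℤ} {x : C.X j} :
    C.lowerMk c j x = 0 ↔ x ∈ Submodule.span (Ext k n)ᵐᵒᵖ (C.upperSet c j) :=
  Submodule.Quotient.mk_eq_zero _

theorem lowerProj_lowerMk {c c' : Deg t} (h : c ≤ c') (j : ℤ) (x : C.X j) :
    (C.lowerProj h).map j (C.lowerMk c' j x) = C.lowerMk c j x := rfl

theorem lowerMk_mem (c : Deg t) (j : ℤ) (a : Deg t) (x : C.X j) (hx : x ∈ (C.X j).deg a) :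
    C.lowerMk c j x ∈ ((C.lower c).X j).deg a := ⟨x, hx, rfl⟩

end Cpx

namespace DMod

variable {k : Type u} [Field k] {t : ℕ} {n : Fin t → ℕ} {T : DMod k n} (B : T.toGrMod.HBasis)
  {P : GrSMod k n}

/-- Each generator of the irrelevant ideal contains a coordinate of the r-th factor. Property (4) is
needed only for these t sets of coordinates. -/
theorem isIrrelevant_factor (r : Fin t) : GrSMod.IsIrrelevant k n {v : Var n | v.1 = r} := by
  rw [GrSMod.IsIrrelevant, GrSMod.irrelevantIdeal, Ideal.span_le]
  rintro _ ⟨s, rfl⟩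
  exact Ideal.mem_of_dvd _ (Finset.dvd_prod_of_mem _ (Finset.mem_univ r))
    (Ideal.subset_span ⟨⟨r, s r⟩, rfl, rfl⟩)

/-! ### The complex of strands is a Tate resolution -/

theorem topMono_smul_b_mem (i : B.ι) :
    op (topMono k n) • B.b i ∈ T.socle (sdeg B i, (B.gd i).2 - total (topDeg n)) := by
  have h := T.topMono_smul_mem_socle (B.mem i)
  rwa [sum_bigDeg] at h

/-- The top monomial carries a basis element of a free module to a nonzero socle element, which by
property (2) represents a cohomology class. So the degrees of the basis are controlled by the
nonvanishing of cohomology. -/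
theorem exists_cohDeg (hT : IsToricTate T P) (i : B.ι) :
    ∃ p : ℕ, (B.gd i).2 - total (topDeg n) = -(p : ℤ) ∧ ¬ Subsingleton (P.Coh p (sdeg B i)) := by
  obtain ⟨-, hneg, ⟨θ, -⟩, -⟩ := hT
  have h := topMono_smul_b_mem B i
  have h0 := B.topMono_smul_ne_zero i
  by_cases hs : (B.gd i).2 - total (topDeg n) ≤ 0
  · obtain ⟨p, hp⟩ := Int.eq_ofNat_of_zero_le (neg_nonneg.mpr hs)
    have hp' : (B.gd i).2 - total (topDeg n) = -(p : ℤ) := by omega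
    refine ⟨p, hp', fun hsub => h0 ?_⟩
    rw [hp'] at h
    have h1 : Subsingleton (T.socle (sdeg B i, -(p : ℤ))) := (θ (sdeg B i) p).symm.subsingleton
    exact congrArg Subtype.val (Subsingleton.elim (⟨_, h⟩ : T.socle (sdeg B i, -(p : ℤ))) 0)
  · have h1 := hneg (sdeg B i) (-((B.gd i).2 - total (topDeg n))) (by omega)
    rw [neg_neg] at h1
    rw [h1] at h
    exact absurd h h0

/-- In large degrees, `R(P)` is the upper quadrant of `T`. -/
theorem exists_isUpper (hP : Module.Finite (Cox k n) P) (hT : IsToricTate T P) :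
    ∃ (ψ : Hom (RR P.reduced) T) (c₀ : Deg t), ∀ c, c₀ ≤ c → IsUpper B ψ c := by
  have hcoh := exists_cohDeg B hT
  obtain ⟨-, -, ⟨θ, hθ⟩, -⟩ := hT
  obtain ⟨ψ, hψ, hψθ⟩ := hθ P.reduced P.reducedIso P.reduced_torsionFree
  obtain ⟨c₀, hc₀⟩ := P.exists_forall_exactAt hP
  refine ⟨ψ, c₀, fun c hc => isUpper_of B ψ hψ ?_ ?_⟩
  · intro a ha m hm h0
    exact P.toCochain_injOn (hc₀ a (hc.trans ha) 0) hm h0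
  · intro i hi
    obtain ⟨p, hp, hns⟩ := hcoh i
    -- Serre vanishing excludes p > 0. For p = 0 the socle element comes from a global section, and
    -- in these degrees every section comes from P.
    cases p with
    | succ p => exact absurd (P.coh_subsingleton (hc₀ _ (hc.trans hi) _)) hns
    | zero =>
      have h := topMono_smul_b_mem B i
      rw [hp] at h
      obtain ⟨y, hy⟩ := (θ (sdeg B i) 0).surjective ⟨_, h⟩
      obtain ⟨⟨z, hz⟩, rfl⟩ := Submodule.Quotient.mk_surjective _ y
      obtain ⟨m, hm, rfl⟩ := P.toCochain_surjOn (hc₀ _ (hc.trans hi) 1) hz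
      refine ⟨sdeg B i, hi, m, hm, ?_⟩
      rw [phi_tmul]
      exact (hψθ (sdeg B i) _ (P.reducedMk.map_mem _ m hm)).trans (congrArg Subtype.val hy)

theorem lowerMk_eq_zero_iff {c : Deg t} {j : ℤ} {x : (unfold B).X j} :
    (unfold B).lowerMk c j x = 0 ↔ reg B (quad c 0) (strandIncl B j x) = 0 :=
  ((unfold B).lowerMk_eq_zero).trans (mem_span_upperSet_iff B)

/-- A summand with socle degree (a; -p) has homological degree -p - |a|. In the lower quadrant |a| ≤
|c|, and p is smaller than the number of charts. -/
theorem lower_bounded (hT : IsToricTate T P) (c : Deg t) (j : ℤ)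
    (hj : j < -(Fintype.card (GrSMod.Chart n) : ℤ) - total c)
    (x : ((unfold B).lower c).X j) : x = 0 := by
  obtain ⟨x, rfl⟩ := (unfold B).lowerMk_surjective c j x
  rw [lowerMk_eq_zero_iff, ← hp_strandIncl, ← Module.End.mul_apply]
  have h0 : reg B (quad c 0) * hp B j = 0 := B.b.ext fun i => by
    rw [Module.End.mul_apply, LinearMap.zero_apply]
    by_cases h : hdeg B i = j
    · rw [hp_of_mem B (B.mem i) h, reg, diag_b, ind_of_notMem, zero_smul]
      intro hi
      obtain ⟨p, hp, hns⟩ := exists_cohDeg B hT i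
      have hp1 : p < Fintype.card (GrSMod.Chart n) := by
        by_contra hlt
        cases p with
        | zero =>
          have : 0 < Fintype.card (GrSMod.Chart n) := Fintype.card_pos
          omega
        | succ p =>
          exact hns (P.coh_subsingleton (Coeff.exactAt_of_card_lt _ _ _ (by omega)))
      have hle : total (sdeg B i) ≤ total c :=
        Finset.sum_le_sum fun l _ => ((hi l).2 (Nat.zero_le _)).le
      have h1 : hdeg B i = (B.gd i).2 - total (topDeg n) - total (sdeg B i) := by
        rw [hdeg, sdeg, total_sub]; ring
      omega
    · rw [hp_of_ne B (B.mem i) h, map_zero]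
  rw [h0, LinearMap.zero_apply]

variable {B} in
theorem IsUpper.reg_phiHead {ψ : Hom (RR P.reduced) T} (c : Deg t) (j : ℤ) (z : (P.head c).X j) :
    reg B (quad c t) (phiHead ψ c j z) = phiHead ψ c j z :=
  phi_reg B ψ (head_le_headAll c j z.2)

variable {B} in
theorem IsUpper.hp_phiHead {ψ : Hom (RR P.reduced) T} (c : Deg t) (j : ℤ) (z : (P.head c).X j) :
    hp B j (phiHead ψ c j z) = phiHead ψ c j z := phi_hp B ψ z.2

variable {B} in
theorem reg_diff_reg_apply (c : Deg t) (x : T.carrier) :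
    dreg B (quad c 0) x = reg B (quad c 0) (T.diff x) := by
  rw [dreg, reg_diff_lower]; rfl

variable {B} in
theorem dreg_phiHead {ψ : Hom (RR P.reduced) T} (c : Deg t) (j : ℤ) (z : (P.head c).X j) :
    dreg B (quad c t) (phiHead ψ c j z) = T.diff (phiHead ψ c j z) := by
  rw [dreg, reg_diff_upper, Module.End.mul_apply, IsUpper.reg_phiHead]

theorem reg_reg (R : Set (Deg t)) (x : T.carrier) : reg B R (reg B R x) = reg B R x := by
  rw [← Module.End.mul_apply, reg_idem]

theorem hp_reg (j : ℤ) (R : Set (Deg t)) (x : T.carrier) :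
    hp B j (reg B R x) = reg B R (hp B j x) := by
  rw [← Module.End.mul_apply, ← Module.End.mul_apply, hp, reg, diag_comm]

variable {B} in
-- Injectivity of the corner map on homology, cut down to one strand. Since ∂ and the corner map are
-- homogeneous, `hp` may be applied to the primitive; `IsUpper.exists_sub_eq_diff` does the same for
-- surjectivity.
theorem exists_sub_diff_eq_zero {ψ : Hom (RR P.reduced) T}
    (hT : ∀ r : Fin t, T.ExactOn {v : Var n | v.1 = r}) {c : Deg t} {i : ℤ} {u : T.carrier}
    (hu : hp B (i + t) u = u) (hdu : reg B (quad c 0) (T.diff u) = 0) {y : (P.head c).X (i + 1)}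
    (h : corner B c t u = T.diff (phiHead ψ c (i + 1) y)) :
    ∃ z, hp B (i + 1 + t) z = z ∧ reg B (quad c 0) (u - T.diff z) = 0 := by
  have hq := quasiIso_corner B hT c t le_rfl
  obtain ⟨z, hz⟩ := hq.inj (reg B (quad c 0) u) (phiHead ψ c (i + 1) y)
    (reg_reg B _ u)
    (by rw [← Module.End.mul_apply, dreg_mul_reg, reg_diff_reg_apply, hdu])
    (by rw [← Module.End.mul_apply, hq.right, h, dreg_phiHead])
  rw [reg_diff_reg_apply] at hz
  refine ⟨hp B (i + 1 + t) z, hp_hp B _ _, ?_⟩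
  rw [map_sub, ← hp_of_shift B hasShift_diff, show i + 1 + t + -1 = i + (t : ℤ) by ring,
    ← hp_reg, ← hz, hp_reg, hu, sub_self]

variable {B} in
theorem IsUpper.exists_sub_eq_diff {ψ : Hom (RR P.reduced) T}
    (hT : ∀ r : Fin t, T.ExactOn {v : Var n | v.1 = r}) {c : Deg t} (hc : IsUpper B ψ c) {i : ℤ}
    {y : (P.head c).X i} (hy : T.diff (phiHead ψ c i y) = 0) :
    ∃ u, hp B (i + t) u = u ∧ reg B (quad c 0) (T.diff u) = 0 ∧
      ∃ w, phiHead ψ c i y - corner B c t u = T.diff (phiHead ψ c (i + 1) w) := by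
  have hq := quasiIso_corner B hT c t le_rfl
  obtain ⟨u, w, -, hdu, hw⟩ := hq.surj (phiHead ψ c i y) (IsUpper.reg_phiHead c i y)
    (by rw [dreg_phiHead, hy])
  obtain ⟨w', hw'⟩ := hc.surj (i + 1) (hp B (i + 1) (reg B (quad c t) w))
    (by rw [← hp_reg, reg_reg]) (hp_hp B _ _)
  refine ⟨hp B (i + t) u, hp_hp B _ _, ?_, w', ?_⟩
  · rw [← hp_of_shift B hasShift_diff, ← hp_reg, ← reg_diff_reg_apply, hdu, map_zero]
  · have h1 := hp_of_shift B (hasShift_corner B c t) (i + t) u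
    rw [show i + (t : ℤ) + -t = i by ring] at h1
    have h2 := congrArg (hp B i) hw
    rw [map_sub, IsUpper.hp_phiHead] at h2
    rw [hw', ← hp_of_shift B hasShift_diff, show i + 1 + -1 = i by ring, ← h1, h2, dreg,
      reg_diff_upper, Module.End.mul_apply]

variable {B} in
-- This is the corner map read through the identification of the upper quadrant with R(P_{≥c}); its
-- t connecting maps, each of degree -1, account for the shift by t.
theorem IsUpper.exists_resolution {ψ : Hom (RR P.reduced) T}
    (hT : ∀ r : Fin t, T.ExactOn {v : Var n | v.1 = r}) {c : Deg t} (hc : IsUpper B ψ c) :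
    ∃ ε : Cpx.Hom (((unfold B).lower c).shift t) (P.head c), ε.IsQuasiIso ∧
      ∀ j x, phiHead ψ c j (ε.map j ((unfold B).lowerMk c (j + t) x)) =
        corner B c t (strandIncl B (j + t) x) := by
  have hq := quasiIso_corner B hT c t le_rfl
  choose F hF hF' using fun j : ℤ => hc.exists_map (hasShift_corner B c t) hq.left hq.right
    (j + t) j (by ring)
  have hcomm : ∀ x, T.diff (corner B c t x) = corner B c t (T.diff x) :=
    LinearMap.congr_fun hq.diff_comm
  replace hF' : ∀ j x, phiHead ψ c j (F j ((unfold B).lowerMk c (j + t) x)) =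
    corner B c t (strandIncl B (j + t) x) := hF'
  refine ⟨⟨F, hF, fun i j h x => ?_⟩, ⟨fun i x hx hy => ?_, fun i y hy => ?_⟩, hF'⟩
  · obtain ⟨x, rfl⟩ := (unfold B).lowerMk_surjective c _ x
    apply hc.inj j
    refine (hF' j _).trans ?_
    rw [phiHead_d, strandIncl_d, ← hcomm]
    exact congrArg T.diff (hF' i x).symm
  · obtain ⟨x, rfl⟩ := (unfold B).lowerMk_surjective c _ x
    obtain ⟨y, hy⟩ := hy
    have hi' : i + (t : ℤ) = i - 1 + t + 1 := by ring
    have hx₀ : (unfold B).lowerMk c (i - 1 + t) ((unfold B).d (i + t) (i - 1 + t) hi' x) = 0 := hx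
    have hx' : reg B (quad c 0) (T.diff (strandIncl B (i + t) x)) = 0 := by
      rwa [lowerMk_eq_zero_iff, strandIncl_d] at hx₀
    obtain ⟨z, hz, hz'⟩ := exists_sub_diff_eq_zero (ψ := ψ) hT (hp_strandIncl B _ x) hx'
      (y := y) ((hF' i x).symm.trans ((congrArg (phiHead ψ c i) hy).trans (phiHead_d ψ c _ _ _ y)))
    obtain ⟨z, rfl⟩ := exists_strandIncl B hz
    refine ⟨(unfold B).lowerMk c _ z, ?_⟩
    have hi : i + 1 + (t : ℤ) = i + t + 1 := by ring
    have h0 : (unfold B).lowerMk c (i + t) (x - (unfold B).d (i + 1 + t) (i + t) hi z) = 0 := by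
      rw [lowerMk_eq_zero_iff, map_sub, strandIncl_d]
      exact hz'
    rw [map_sub, sub_eq_zero] at h0
    exact h0
  · obtain ⟨u, hu, hdu, w, hw⟩ := hc.exists_sub_eq_diff hT (y := y)
      ((phiHead_d ψ c i (i - 1) (by ring) y).symm.trans
        ((congrArg (phiHead ψ c (i - 1)) hy).trans (map_zero _)))
    obtain ⟨u, rfl⟩ := exists_strandIncl B hu
    have hi' : i + (t : ℤ) = i - 1 + t + 1 := by ring
    have hu₀ : (unfold B).lowerMk c (i - 1 + t) ((unfold B).d (i + t) (i - 1 + t) hi' u) = 0 := by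
      rwa [lowerMk_eq_zero_iff, strandIncl_d]
    refine ⟨(unfold B).lowerMk c _ u, hu₀, w, hc.inj i ?_⟩
    rw [map_sub, phiHead_d, ← hw]
    exact congrArg (phiHead ψ c i y - ·) (hF' i u)

/-- The complex of strands of a differential module with the characterizing properties is a Tate
resolution. -/
theorem unfold_isEESTate (hP : Module.Finite (Cox k n) P) (hT : IsToricTate T P) :
    IsEESTate (unfold B) P := by
  classical
  obtain ⟨ψ, c₀, hc₀⟩ := exists_isUpper B hP hT
  have hex : ∀ r : Fin t, T.ExactOn {v : Var n | v.1 = r} :=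
    fun r => hT.2.2.2 _ (isIrrelevant_factor r)
  choose ε hε hε' using fun (c : Deg t) (h : c₀ ≤ c) => (hc₀ c h).exists_resolution hex
  -- A family over all c is required, but nothing is asked of it unless c ≥ c₀; zero serves as the
  -- default.
  let zeroHom : ∀ c, Cpx.Hom (((unfold B).lower c).shift t) (P.head c) := fun c =>
    ⟨fun _ => 0, fun _ _ _ _ => Submodule.zero_mem _, fun _ _ _ _ => by simp⟩
  refine ⟨unfold_isFree B, unfold_isMinimal B hT.1.2, c₀,
    fun c => if h : c₀ ≤ c then ε c h else zeroHom c, fun c hc => ?_, fun c c' h hc => ?_⟩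
  · simp only [dif_pos hc]
    refine ⟨fun j => Cpx.lower_isFree (unfold_isFree B) c _, fun i j h x =>
      Cpx.lower_isMinimal (unfold_isMinimal B hT.1.2) c _ _ _ x, ?_, hε c hc⟩
    exact ⟨-(Fintype.card (GrSMod.Chart n) : ℤ) - total c - t, fun j hj x =>
      lower_bounded B hT c (j + t) (by omega) x⟩
  · simp only [dif_pos hc, dif_pos (hc.trans h)]
    obtain ⟨H, hH, hl, hr, hcomm⟩ := exists_corner_homotopy B hex h
    choose s hs hs' using fun i j : ℤ => fun hij : j = i + 1 =>
      (hc₀ c hc).exists_map hH hl hr (i + t) j (by rw [hij]; ring)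
    -- The sign appears because `H` joins the corner map at c to the one at c', while the difference
    -- demanded here is the opposite one.
    refine ⟨fun i j hij => -s i j hij, fun i j hij a x hx => Submodule.neg_mem _ (hs i j hij a x hx),
      fun i x => ?_⟩
    obtain ⟨x, rfl⟩ := (unfold B).lowerMk_surjective c' _ x
    apply (hc₀ c hc).inj i
    rw [map_sub, map_add, phiHead_d]
    have h1 : phiHead ψ c i (((ε c hc).comp (((unfold B).lowerProj h).shift t)).map i
        ((unfold B).lowerMk c' (i + t) x)) = corner B c t (strandIncl B (i + t) x) := hε' c hc i x
    have h2 : phiHead ψ c i (((P.headIncl h).comp (ε c' (hc.trans h))).map i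
        ((unfold B).lowerMk c' (i + t) x)) = corner B c' t (strandIncl B (i + t) x) :=
      hε' c' (hc.trans h) i x
    have h3 : phiHead ψ c (i + 1) ((-s i (i + 1) rfl) ((unfold B).lowerMk c' (i + t) x)) =
        -H (strandIncl B (i + t) x) := by
      rw [LinearMap.neg_apply, map_neg]
      exact congrArg Neg.neg (hs' i (i + 1) rfl x)
    have h4 : phiHead ψ c i ((-s (i - 1) i (by ring)) ((unfold B).lowerMk c' (i - 1 + t)
        ((unfold B).d (i + t) (i - 1 + t) (by ring) x))) = -H (T.diff (strandIncl B (i + t) x)) := by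
      rw [LinearMap.neg_apply, map_neg]
      exact congrArg Neg.neg ((hs' (i - 1) i (by ring) _).trans
        (congrArg H (strandIncl_d B _ _ _ x)))
    have h5 := LinearMap.congr_fun hcomm (strandIncl B (i + t) x)
    rw [LinearMap.sub_apply, LinearMap.add_apply, Module.End.mul_apply, Module.End.mul_apply] at h5
    refine (congrArg₂ (· - ·) h1 h2).trans (Eq.trans ?_
      (congrArg₂ (fun a b => T.diff a + b) h3 h4).symm)
    rw [map_neg, ← neg_add, ← h5, neg_sub]

end DMod

/-! ### Lifting along quasi-isomorphisms -/

/-- Dependent choice for sequences indexed by the integers, starting from a trivial tail. -/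
theorem exists_int_sequence {α : ℤ → Type*} (p : ∀ i, α i → Prop)
    (R : ∀ i j : ℤ, j = i + 1 → α i → α j → Prop) (i₀ : ℤ) (a : ∀ i, α i)
    (hp : ∀ i, i ≤ i₀ → p i (a i)) (hR : ∀ i j h, j ≤ i₀ → R i j h (a i) (a j))
    (step : ∀ i j h x, p i x → ∃ y, p j y ∧ R i j h x y) :
    ∃ s : ∀ i, α i, (∀ i, p i (s i)) ∧ ∀ i j h, R i j h (s i) (s j) := by
  classical
  have step' : ∀ i j h x, ∃ y, p i x → p j y ∧ R i j h x y := fun i j h x => by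
    by_cases hx : p i x
    · obtain ⟨y, hy⟩ := step i j h x hx
      exact ⟨y, fun _ => hy⟩
    · exact ⟨a j, fun h => absurd h hx⟩
  choose next hnext using step'
  -- The m-th approximation is correct up to index i₀ + m and is changed at one further place by the
  -- next one; so the value at each index stabilises.
  let seq : ℕ → ∀ i, α i := fun m => Nat.rec a
    (fun m s => Function.update s (i₀ + m + 1) (next (i₀ + m) (i₀ + m + 1) rfl (s (i₀ + m)))) m
  have hseq : ∀ m, seq (m + 1) = Function.update (seq m) (i₀ + m + 1)
    (next (i₀ + m) (i₀ + m + 1) rfl (seq m (i₀ + m))) := fun _ => rfl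
  have stable : ∀ (m r : ℕ) (i : ℤ), i ≤ i₀ + m → seq (m + r) i = seq m i := by
    intro m r i hi
    induction r with
    | zero => rfl
    | succ r ih => rw [← add_assoc, hseq, Function.update_of_ne (by push_cast; omega), ih]
  have good : ∀ m : ℕ, (∀ i, i ≤ i₀ + m → p i (seq m i)) ∧
      ∀ i j h, j ≤ i₀ + m → R i j h (seq m i) (seq m j) := by
    intro m
    induction m with
    | zero => exact ⟨fun i hi => hp i (by simpa using hi), fun i j h hj => hR i j h (by simpa using hj)⟩
    | succ m ih =>
      have hn := hnext (i₀ + m) (i₀ + m + 1) rfl (seq m (i₀ + m)) (ih.1 _ le_rfl)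
      refine ⟨fun i hi => ?_, fun i j h hj => ?_⟩
      · by_cases hi' : i = i₀ + m + 1
        · subst hi'
          rw [hseq, Function.update_self]
          exact hn.1
        · rw [hseq, Function.update_of_ne hi']
          exact ih.1 i (by push_cast at hi; omega)
      · by_cases hj' : j = i₀ + m + 1
        · obtain rfl : i = i₀ + m := by omega
          subst hj'
          rw [hseq, Function.update_self, Function.update_of_ne (by omega)]
          exact hn.2
        · rw [hseq, Function.update_of_ne hj', Function.update_of_ne (by push_cast at hj; omega)]
          exact ih.2 i j h (by push_cast at hj; omega)
  refine ⟨fun i => seq (i - i₀).toNat i, fun i => (good _).1 i (by omega), fun i j h => ?_⟩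
  have h1 : (j - i₀).toNat = (i - i₀).toNat + ((j - i₀).toNat - (i - i₀).toNat) := by omega
  have h2 : seq (j - i₀).toNat i = seq (i - i₀).toNat i := by
    rw [h1]
    exact stable _ _ _ (by omega)
  have h3 := (good (j - i₀).toNat).2 i j h (by omega)
  rwa [h2] at h3

namespace Cpx

variable {k : Type u} [Field k] {t : ℕ} {n : Fin t → ℕ}

/-- All terms of sufficiently low homological degree vanish. -/
def BoundedBelow (Q : Cpx k n) : Prop := ∃ j₀, ∀ j < j₀, ∀ x : Q.X j, x = 0

/-- A chain map, up to sign, of degree `s` from a bounded below complex of free modules to an exact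
complex is null-homotopic. -/
theorem exists_nullHomotopy {Q : Cpx k n} (hQ : Q.IsFree) (hb : Q.BoundedBelow)
    {K : ℤ → Type u} [∀ i, AddCommGroup (K i)] [∀ i, Module k (K i)]
    [∀ i, Module (Ext k n)ᵐᵒᵖ (K i)] [∀ i, IsScalarTower k (Ext k n)ᵐᵒᵖ (K i)]
    {kdeg : ∀ i, Deg t → Submodule k (K i)}
    (hact : ∀ i (v : Var n) g x, x ∈ kdeg i g → op (e k v) • x ∈ kdeg i (g - varDeg v))
    {δ : ∀ i j : ℤ, i = j + 1 → K i →ₗ[(Ext k n)ᵐᵒᵖ] K j}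
    (hδ : ∀ i j l h h' a, ∀ x ∈ kdeg j a, δ j l h' x = 0 → ∃ y ∈ kdeg i a, δ i j h y = x)
    {s ε : ℤ} (hε : ε * ε = 1) {φ : ∀ i j : ℤ, j = i + s → Q.X i →ₗ[(Ext k n)ᵐᵒᵖ] K j}
    (hφ : ∀ i j h a, ∀ x ∈ (Q.X i).deg a, φ i j h x ∈ kdeg j a)
    (hφd : ∀ i i' j j' h h' hi hj x,
      φ i' j' h' (Q.d i i' hi x) = ε • δ j j' hj (φ i j h x)) :
    ∃ σ : ∀ i j : ℤ, j = i + s + 1 → Q.X i →ₗ[(Ext k n)ᵐᵒᵖ] K j,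
      (∀ i j h a, ∀ x ∈ (Q.X i).deg a, σ i j h x ∈ kdeg j a) ∧
      ∀ i i' j j' h h' h'' hi hj x,
        φ i j h x = δ j' j hj (σ i j' h' x) + ε • σ i' j h'' (Q.d i i' hi x) := by
  obtain ⟨j₀, hb⟩ := hb
  obtain ⟨σ, hσ, hσR⟩ := exists_int_sequence
    (α := fun i => ∀ j : ℤ, j = i + s + 1 → Q.X i →ₗ[(Ext k n)ᵐᵒᵖ] K j)
    -- The invariant says that σ already solves the equation on boundaries; this makes φ - ε σ d a
    -- cycle in the next degree, where exactness provides the next component.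
    (fun i σ => (∀ j h a, ∀ x ∈ (Q.X i).deg a, σ j h x ∈ kdeg j a) ∧
      ∀ i' j j' hi h h' hj x, δ j j' hj (σ j h (Q.d i' i hi x)) = φ i j' h' (Q.d i' i hi x))
    (fun i' i hi σ' σ => ∀ j j' h h' h'' hj x,
        φ i j h x = δ j' j hj (σ j' h' x) + ε • σ' j h'' (Q.d i i' hi x))
    (j₀ - 1) (fun _ _ _ => 0)
    (fun i hi => ⟨fun _ _ _ _ _ => Submodule.zero_mem _, fun i' j j' _ _ _ _ x => by
      rw [hb i (by omega) (Q.d i' i _ x), LinearMap.zero_apply, map_zero, map_zero]⟩)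
    (fun i' i hi hi' j j' _ _ _ _ x => by
      rw [hb i (by omega) x, map_zero, map_zero, map_zero, map_zero, LinearMap.zero_apply,
        smul_zero, add_zero])
    (by
      rintro i _ rfl σ ⟨hσ, hσd⟩
      obtain ⟨B⟩ := (hQ (i + 1)).hBasis
      obtain ⟨τ, hτ, hτd⟩ := B.exists_lift (hact (i + 1 + s + 1))
        (δ (i + 1 + s + 1) (i + 1 + s) rfl)
        (φ (i + 1) (i + 1 + s) rfl - ε • (σ (i + 1 + s) (by ring) ∘ₗ Q.d (i + 1) i rfl)) (by
          intro a x hx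
          refine hδ _ _ (i + s) _ (by ring) a _ (Submodule.sub_mem _ (hφ _ _ _ a x hx) ?_) ?_
          · exact zsmul_mem (hσ _ _ a _ (Q.d_mem _ _ _ a x hx)) ε
          · rw [LinearMap.sub_apply, LinearMap.smul_apply, map_sub, map_zsmul, LinearMap.comp_apply,
              hσd (i + 1) (i + 1 + s) (i + s) rfl _ rfl _ x,
              hφd (i + 1) i (i + 1 + s) (i + s) rfl rfl rfl (by ring) x, smul_smul, hε, one_smul,
              sub_self])
      refine ⟨fun j h => by subst h; exact τ, ⟨?_, ?_⟩, ?_⟩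
      · rintro _ rfl a x hx
        exact hτ a x hx
      · rintro i' j j' hi rfl rfl hj x
        refine (hτd _).trans ?_
        rw [LinearMap.sub_apply, LinearMap.smul_apply, LinearMap.comp_apply, Q.d_comp, map_zero,
          smul_zero, sub_zero]
      · rintro j j' rfl rfl h'' hj x
        refine eq_add_of_sub_eq ?_
        exact (hτd x).symm)
  exact ⟨σ, fun i => (hσ i).1, fun i i' j j' h h' h'' hi hj x => hσR i' i hi j j' h h' h'' hj x⟩

/-! ### Chain maps, homotopies and mapping cones -/

namespace Hom

/-- The identity. -/
def id (C : Cpx k n) : Hom C C where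
  map _ := LinearMap.id
  map_mem _ _ _ hx := hx
  comm _ _ _ _ := rfl

/-- A component of a chain map, with two names for its index. -/
def mapAt {A D : Cpx k n} (g : Hom A D) (i j : ℤ) (h : i = j) : A.X i →ₗ[(Ext k n)ᵐᵒᵖ] D.X j := by
  subst h
  exact g.map i

theorem mapAt_rfl {A D : Cpx k n} (g : Hom A D) (i : ℤ) : g.mapAt i i rfl = g.map i := rfl

theorem mapAt_mem {A D : Cpx k n} (g : Hom A D) (i j : ℤ) (h : i = j) (a : Deg t) (x : A.X i)
    (hx : x ∈ (A.X i).deg a) : g.mapAt i j h x ∈ (D.X j).deg a := by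
  subst h
  exact g.map_mem i a x hx

/-- Every index has the form i + 1; writing it so avoids the subtraction in the definition of
homotopy. -/
theorem Homotopic.of_eq {C D : Cpx k n} {f g : Hom C D}
    (s : ∀ i j : ℤ, j = i + 1 → (C.X i →ₗ[(Ext k n)ᵐᵒᵖ] D.X j))
    (hs : ∀ i j h a x, x ∈ (C.X i).deg a → s i j h x ∈ (D.X j).deg a)
    (h : ∀ i x, f.map (i + 1) x - g.map (i + 1) x =
      D.d (i + 1 + 1) (i + 1) rfl (s (i + 1) (i + 1 + 1) rfl x) +
        s i (i + 1) rfl (C.d (i + 1) i rfl x)) : f.Homotopic g := by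
  refine ⟨s, hs, fun i => ?_⟩
  have key : ∀ i' (hi : i = i' + 1) (x : C.X i), f.map i x - g.map i x =
      D.d (i + 1) i rfl (s i (i + 1) rfl x) + s i' i hi (C.d i i' hi x) := by
    rintro i' rfl x
    exact h i' x
  exact key (i - 1) _

theorem Homotopic.symm {C D : Cpx k n} {f g : Hom C D} (h : f.Homotopic g) : g.Homotopic f := by
  obtain ⟨s, hs, h⟩ := h
  refine ⟨fun i j hij => -s i j hij, fun i j hij a x hx => Submodule.neg_mem _ (hs i j hij a x hx),
    fun i x => ?_⟩
  rw [LinearMap.neg_apply, LinearMap.neg_apply, map_neg, ← neg_add, ← h, neg_sub]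

theorem Homotopic.trans {C D : Cpx k n} {f g l : Hom C D} (h : f.Homotopic g) (h' : g.Homotopic l) :
    f.Homotopic l := by
  obtain ⟨s, hs, h⟩ := h
  obtain ⟨s', hs', h'⟩ := h'
  refine ⟨fun i j hij => s i j hij + s' i j hij,
    fun i j hij a x hx => Submodule.add_mem _ (hs i j hij a x hx) (hs' i j hij a x hx),
    fun i x => ?_⟩
  rw [LinearMap.add_apply, LinearMap.add_apply, map_add, add_add_add_comm, ← h, ← h',
    sub_add_sub_cancel]

theorem Homotopic.comp_left {C D F : Cpx k n} {f f' : Hom C D} (h : f.Homotopic f') (g : Hom D F) :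
    (g.comp f).Homotopic (g.comp f') := by
  obtain ⟨s, hs, h⟩ := h
  refine ⟨fun i j hij => g.map j ∘ₗ s i j hij,
    fun i j hij a x hx => g.map_mem j a _ (hs i j hij a x hx), fun i x => ?_⟩
  have h1 := congrArg (g.map i) (h i x)
  rw [map_sub, map_add, g.comm] at h1
  exact h1

theorem Homotopic.comp_right {C D F : Cpx k n} {g g' : Hom D F} (h : g.Homotopic g')
    (f : Hom C D) : (g.comp f).Homotopic (g'.comp f) := by
  obtain ⟨s, hs, h⟩ := h
  refine ⟨fun i j hij => s i j hij ∘ₗ f.map i,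
    fun i j hij a x hx => hs i j hij a _ (f.map_mem i a x hx), fun i x => ?_⟩
  have h1 := h i (f.map i x)
  rw [← f.comm] at h1
  exact h1

/-- The differential of the mapping cone. -/
def coneD {A D : Cpx k n} (g : Hom A D) (i j : ℤ) (h : i = j + 1) :
    A.X i × D.X (i + 1) →ₗ[(Ext k n)ᵐᵒᵖ] A.X j × D.X (j + 1) :=
  LinearMap.prod (-(A.d i j h ∘ₗ LinearMap.fst _ _ _))
    (g.mapAt i (j + 1) h ∘ₗ LinearMap.fst _ _ _ +
      D.d (i + 1) (j + 1) (by rw [h]) ∘ₗ LinearMap.snd _ _ _)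

theorem coneD_apply {A D : Cpx k n} (g : Hom A D) (i j : ℤ) (h : i = j + 1) (x : A.X i)
    (y : D.X (i + 1)) : g.coneD i j h (x, y) =
      (-A.d i j h x, g.mapAt i (j + 1) h x + D.d (i + 1) (j + 1) (by rw [h]) y) := rfl

/-- For a cycle (a, y), injectivity on homology gives a = dz; then y + g z is a cycle, equal to g b
+ dw for a cycle b by surjectivity, and (b - z, w) is a primitive. -/
theorem IsQuasiIso.coneD_exact {A D : Cpx k n} {g : Hom A D} (hg : g.IsQuasiIso) (i j l : ℤ)
    (h : i = j + 1) (h' : j = l + 1) (x : A.X j × D.X (j + 1)) (hx : g.coneD j l h' x = 0) :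
    ∃ y, g.coneD i j h y = x := by
  subst h' h
  obtain ⟨a, y⟩ := x
  rw [coneD_apply, Prod.mk_eq_zero, neg_eq_zero, mapAt_rfl] at hx
  have hA : ∀ (j l : ℤ) (h h') (x : A.X l), A.d l j h x = 0 → A.d l (l - 1) h' x = 0 := by
    intro j l h h' x hx
    obtain rfl : j = l - 1 := by omega
    exact hx
  have hD : ∀ (j l : ℤ) (h h') (x : D.X l), D.d l j h x = 0 → D.d l (l - 1) h' x = 0 := by
    intro j l h h' x hx
    obtain rfl : j = l - 1 := by omega
    exact hx
  obtain ⟨z, rfl⟩ := hg.1 (l + 1) a (hA l _ _ _ a hx.1)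
    ⟨-y, by rw [map_neg]; exact eq_neg_of_add_eq_zero_left hx.2⟩
  obtain ⟨b, hb, w, hw⟩ := hg.2 (l + 1 + 1) (y + g.map _ z) (hD (l + 1) _ rfl _ _ (by
    rw [map_add, ← g.comm]
    exact (add_comm _ _).trans hx.2))
  have hb' : A.d (l + 1 + 1) (l + 1) rfl b = 0 := by
    have : ∀ j (h : l + 1 + 1 = j + 1) (h' : l + 1 + 1 = l + 1 + 1 - 1 + 1),
        A.d (l + 1 + 1) (l + 1 + 1 - 1) h' b = 0 → A.d (l + 1 + 1) j h b = 0 := by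
      intro j h h' hx
      obtain rfl : j = l + 1 + 1 - 1 := by omega
      exact hx
    exact this _ _ _ hb
  refine ⟨(-z + b, w), ?_⟩
  rw [coneD_apply, mapAt_rfl, map_add, map_neg, hb', add_zero, neg_neg, ← hw, map_add, map_neg]
  congr 1
  abel

theorem IsQuasiIso.coneD_exact_homogeneous {A D : Cpx k n} {g : Hom A D} (hg : g.IsQuasiIso)
    (i j l : ℤ) (h : i = j + 1) (h' : j = l + 1) (a : Deg t) (x : A.X j × D.X (j + 1))
    (ha : x ∈ ((A.X j).deg a).prod ((D.X (j + 1)).deg a)) (hx : g.coneD j l h' x = 0) :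
    ∃ y ∈ ((A.X i).deg a).prod ((D.X (i + 1)).deg a), g.coneD i j h y = x := by
  obtain ⟨⟨y, z⟩, rfl⟩ := hg.coneD_exact i j l h h' x hx
  rw [coneD_apply, Submodule.mem_prod] at ha
  refine ⟨(proj (A.X i).internal a y, proj (D.X (i + 1)).internal a z),
    ⟨proj_mem _ _ _, proj_mem _ _ _⟩, ?_⟩
  rw [coneD_apply, coneD_apply]
  have hA := proj_comm (A.X i).internal (A.X j).internal ((A.d i j h).restrictScalars k)
    _root_.id Function.injective_id (A.d_mem i j h) a y
  have hD := proj_comm (D.X (i + 1)).internal (D.X (j + 1)).internal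
    ((D.d (i + 1) (j + 1) (by rw [h])).restrictScalars k) _root_.id Function.injective_id
    (D.d_mem _ _ _) a z
  have hM := proj_comm (A.X i).internal (D.X (j + 1)).internal
    ((g.mapAt i (j + 1) h).restrictScalars k) _root_.id Function.injective_id
    (g.mapAt_mem _ _ _) a y
  simp only [LinearMap.restrictScalars_apply, _root_.id] at hA hD hM
  rw [← hA, ← hD, ← hM, ← map_add, ← map_neg]
  exact Prod.ext (proj_self _ ha.1) (proj_self _ ha.2)

theorem prod_act_mem (A D : Cpx k n) (i : ℤ) (v : Var n) (g : Deg t) (x : A.X i × D.X (i + 1))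
    (hx : x ∈ ((A.X i).deg g).prod ((D.X (i + 1)).deg g)) :
    op (e k v) • x ∈ ((A.X i).deg (g - varDeg v)).prod ((D.X (i + 1)).deg (g - varDeg v)) :=
  ⟨(A.X i).act_mem v g _ hx.1, (D.X (i + 1)).act_mem v g _ hx.2⟩

/-- Chain maps from bounded below complexes of free modules lift along quasi-isomorphisms. -/
theorem IsQuasiIso.exists_lift {Q A D : Cpx k n} (hQ : Q.IsFree) (hb : Q.BoundedBelow)
    {g : Hom A D} (hg : g.IsQuasiIso) (φ : Hom Q D) : ∃ f : Hom Q A, (g.comp f).Homotopic φ := by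
  -- The map φ, placed in the second component, is a chain map to the exact cone of g. In a
  -- null-homotopy of it, the first component is the lift and the second, up to sign, the homotopy
  -- from g ∘ f to φ.
  obtain ⟨σ, hσ, hσd⟩ := exists_nullHomotopy hQ hb (K := fun i => A.X i × D.X (i + 1))
    (prod_act_mem A D) hg.coneD_exact_homogeneous (s := -1) (one_mul 1)
    (φ := fun i j h => LinearMap.prod 0 (φ.mapAt i (j + 1) (by omega)))
    (fun i j h a x hx => ⟨Submodule.zero_mem _, φ.mapAt_mem _ _ _ a x hx⟩) (by
      intro i i' j j' h h' hi hj x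
      obtain rfl : i' = j' + 1 := by omega
      obtain rfl : i = j + 1 := by omega
      subst hj
      rw [one_smul]
      exact Prod.ext (by simp [coneD_apply]) (by simp [coneD_apply, mapAt_rfl, φ.comm]))
  have key : ∀ i i' (hi : i = i' + 1) x, (0, φ.mapAt i (i' + 1) hi x) =
      g.coneD i i' hi (σ i i (by ring) x) + σ i' i' (by ring) (Q.d i i' hi x) := by
    intro i i' hi x
    have := hσd i i' i' i (by omega) (by ring) (by ring) hi hi x
    rwa [one_smul] at this
  refine ⟨⟨fun i => LinearMap.fst _ _ _ ∘ₗ σ i i (by ring), fun i a x hx => (hσ _ _ _ a x hx).1,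
    fun i j h x => ?_⟩, ?_⟩
  · have := congrArg Prod.fst (key i j h x)
    exact (neg_add_eq_zero.mp this.symm).symm
  · refine Homotopic.of_eq (fun i j h => by
      subst h; exact -(LinearMap.snd _ _ _ ∘ₗ σ i i (by ring))) ?_ fun i x => ?_
    · rintro i _ rfl a x hx
      exact Submodule.neg_mem _ (hσ _ _ _ a x hx).2
    · have h1 := congrArg Prod.snd (key (i + 1) i rfl x)
      have h2 : φ.map (i + 1) x = g.map (i + 1) (σ (i + 1) (i + 1) (by ring) x).1 +
        D.d (i + 1 + 1) (i + 1) rfl (σ (i + 1) (i + 1) (by ring) x).2 +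
        (σ i i (by ring) (Q.d (i + 1) i rfl x)).2 := h1
      change g.map (i + 1) (σ (i + 1) (i + 1) _ x).1 - φ.map (i + 1) x =
        D.d (i + 1 + 1) (i + 1) rfl (-(σ (i + 1) (i + 1) _ x).2) +
          -(σ i i _ (Q.d (i + 1) i rfl x)).2
      rw [h2, map_neg]
      abel

/-- Lifts along quasi-isomorphisms are unique up to homotopy. -/
theorem IsQuasiIso.homotopic_of_comp {Q A D : Cpx k n} (hQ : Q.IsFree) (hb : Q.BoundedBelow)
    {g : Hom A D} (hg : g.IsQuasiIso) {f f' : Hom Q A}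
    (h : (g.comp f).Homotopic (g.comp f')) : f.Homotopic f' := by
  obtain ⟨τ, hτ, hτd⟩ := h
  have hτ' : ∀ i i' (hi : i = i' + 1) x, g.map i (f.map i x) - g.map i (f'.map i x) =
      D.d (i + 1) i rfl (τ i (i + 1) rfl x) + τ i' i hi (Q.d i i' hi x) := by
    intro i i' hi x
    obtain rfl : i' = i - 1 := by omega
    exact hτd i x
  -- The pair (f - f', -τ) is a map to the cone that commutes with the differentials up to the sign
  -- ε = -1; the first component of a null-homotopy joins f to f'.
  obtain ⟨σ, hσ, hσd⟩ := exists_nullHomotopy hQ hb (K := fun i => A.X i × D.X (i + 1))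
    (prod_act_mem A D) hg.coneD_exact_homogeneous (s := 0) (ε := -1) (by norm_num)
    (φ := fun i j h => LinearMap.prod (f.mapAt i j (by omega) - f'.mapAt i j (by omega))
      (-τ i (j + 1) (by omega)))
    (fun i j h a x hx => ⟨Submodule.sub_mem _ (f.mapAt_mem _ _ _ a x hx)
      (f'.mapAt_mem _ _ _ a x hx), Submodule.neg_mem _ (hτ _ _ _ a x hx)⟩) (by
      intro i i' j j' h h' hi hj x
      obtain rfl : i' = j' := by omega
      obtain rfl : i = j := by omega
      subst hj
      refine Prod.ext ?_ ?_
      · simp [coneD_apply, mapAt_rfl, f.comm, f'.comm]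
      · have h1 := hτ' (i' + 1) i' rfl x
        have h2 : g.map (i' + 1) (f.map (i' + 1) x - f'.map (i' + 1) x) +
            D.d (i' + 1 + 1) (i' + 1) rfl (-τ (i' + 1) (i' + 1 + 1) rfl x) =
              τ i' (i' + 1) rfl (Q.d (i' + 1) i' rfl x) := by
          rw [map_sub, h1, map_neg]
          abel
        rw [neg_smul, one_smul]
        exact congrArg Neg.neg h2.symm)
  refine ⟨fun i j h => -(LinearMap.fst _ _ _ ∘ₗ σ i j (by omega)),
    fun i j h a x hx => Submodule.neg_mem _ (hσ _ _ _ a x hx).1, fun i x => ?_⟩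
  have h1 := congrArg Prod.fst (hσd i (i - 1) i (i + 1) (by ring) (by ring) (by ring) (by ring) rfl x)
  have h2 : f.map i x - f'.map i x = -A.d (i + 1) i rfl (σ i (i + 1) (by ring) x).1 +
    ((-1 : ℤ) • σ (i - 1) i (by ring) (Q.d i (i - 1) (by ring) x)).1 := h1
  rw [h2, neg_smul, one_smul]
  change _ = A.d (i + 1) i rfl (-(σ i (i + 1) _ x).1) + -(σ (i - 1) i _ (Q.d i (i - 1) _ x)).1
  rw [map_neg]
  rfl

/-- By minimality both ds and sd have values in the multiples of 𝔪, so the map differs from the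
identity by a nilpotent endomorphism. -/
theorem isUnit_of_homotopic_id {Q : Cpx k n} (hQ : Q.IsMinimal) {f : Hom Q Q}
    (h : f.Homotopic (id Q)) (i : ℤ) : IsUnit (f.map i : Module.End (Ext k n)ᵐᵒᵖ (Q.X i)) := by
  obtain ⟨s, -, h⟩ := h
  have h1 : IsNilpotent ((f.map i : Module.End (Ext k n)ᵐᵒᵖ (Q.X i)) - 1) := by
    refine (Q.X i).isNilpotent_of_maxMul _ fun x => ?_
    have hx : ((f.map i : Module.End (Ext k n)ᵐᵒᵖ (Q.X i)) - 1) x = _ := h i x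
    rw [hx]
    exact Submodule.add_mem _ (hQ _ _ _ _) ((Q.X (i - 1)).map_idealMul (Q.X i) _ (hQ _ _ _ _))
  have h2 := h1.isUnit_one_add
  rwa [add_sub_cancel] at h2

/-- A lift between minimal free resolutions is an isomorphism. -/
theorem IsMinimalFreeResolution.bijective {Q Q' D : Cpx k n} {ε : Hom Q D} {ε' : Hom Q' D}
    (hε : ε.IsMinimalFreeResolution) (hε' : ε'.IsMinimalFreeResolution) {f : Hom Q Q'}
    (hf : (ε'.comp f).Homotopic ε) (i : ℤ) : Function.Bijective (f.map i) := by
  obtain ⟨hF, hM, hb, hq⟩ := hε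
  obtain ⟨hF', hM', hb', hq'⟩ := hε'
  obtain ⟨f', hf'⟩ := hq.exists_lift hF' hb' ε'
  have h1 : (f'.comp f).Homotopic (id Q) :=
    hq.homotopic_of_comp hF hb ((hf'.comp_right f).trans hf)
  have h2 : (f.comp f').Homotopic (id Q') :=
    hq'.homotopic_of_comp hF' hb' ((hf.comp_right f').trans hf')
  have h3 := (Module.End.isUnit_iff _).mp (isUnit_of_homotopic_id hM h1 i)
  have h4 := (Module.End.isUnit_iff _).mp (isUnit_of_homotopic_id hM' h2 i)
  exact ⟨Function.Injective.of_comp (f := f'.map i) h3.1, Function.Surjective.of_comp (g := f'.map i) h4.2⟩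

end Hom

end Cpx

/-! ### Uniqueness of Tate resolutions -/

theorem list_sum_varDeg_le_topDeg {t : ℕ} {n : Fin t → ℕ} {l : List (Var n)} (hl : l.Nodup) :
    (l.map varDeg).sum ≤ topDeg n := by
  rw [← List.sum_toFinset _ hl, ← sum_varDeg]
  exact Finset.sum_le_univ_sum_of_nonneg fun v => Pi.single_nonneg.mpr zero_le_one

namespace Cpx

variable {k : Type u} [Field k] {t : ℕ} {n : Fin t → ℕ}

theorem exists_add_homotopy {C D : Cpx k n} (f : Hom C D)
    (s : ∀ i j : ℤ, j = i + 1 → (C.X i →ₗ[(Ext k n)ᵐᵒᵖ] D.X j))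
    (hs : ∀ i j h a x, x ∈ (C.X i).deg a → s i j h x ∈ (D.X j).deg a) :
    ∃ g : Hom C D, g.Homotopic f ∧ ∀ i x, g.map i x = f.map i x +
      (D.d (i + 1) i rfl (s i (i + 1) rfl x) + s (i - 1) i (by ring) (C.d i (i - 1) (by ring) x)) := by
  let F : ∀ i, C.X i →ₗ[(Ext k n)ᵐᵒᵖ] D.X i := fun i => f.map i +
    (D.d (i + 1) i rfl ∘ₗ s i (i + 1) rfl + s (i - 1) i (by ring) ∘ₗ C.d i (i - 1) (by ring))
  have hF : ∀ i x, F i x = f.map i x +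
    (D.d (i + 1) i rfl (s i (i + 1) rfl x) + s (i - 1) i (by ring) (C.d i (i - 1) (by ring) x)) :=
    fun _ _ => rfl
  refine ⟨⟨F, fun i a x hx => ?_, fun i j h x => ?_⟩, ⟨s, hs, fun i x => ?_⟩, hF⟩
  · exact Submodule.add_mem _ (f.map_mem i a x hx) (Submodule.add_mem _
      (D.d_mem _ _ _ a _ (hs _ _ _ a x hx)) (hs _ _ _ a _ (C.d_mem _ _ _ a x hx)))
  · obtain rfl : j = i - 1 := by omega
    have key : ∀ (l j : ℤ) (hl : l = j + 1) y, D.d l j hl (s j l hl y) =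
        D.d (j + 1) j rfl (s j (j + 1) rfl y) := by
      rintro _ j rfl y
      rfl
    rw [hF, hF, map_add, map_add, C.d_comp, map_zero, add_zero, D.d_comp, zero_add, f.comm, key i (i - 1) h]
  · exact add_sub_cancel_left _ _

/-- Lifts between resolutions can be chosen compatibly with given projections. -/
theorem exists_compatible_lift {Q Q₁ Q' Q₁' D D₁ : Cpx k n} {ε : Hom Q D} {ε' : Hom Q' D}
    {ε₁ : Hom Q₁ D₁} {ε₁' : Hom Q₁' D₁} {p : Hom Q₁ Q} {p' : Hom Q₁' Q'} {ι : Hom D₁ D}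
    (hQ₁ : Q₁.IsFree) (hb₁ : Q₁.BoundedBelow) (hε' : ε'.IsQuasiIso) (hε₁' : ε₁'.IsQuasiIso)
    (hp : (ε.comp p).Homotopic (ι.comp ε₁)) (hp' : (ε'.comp p').Homotopic (ι.comp ε₁'))
    (hsurj : ∀ i a, ∀ x ∈ (Q'.X i).deg a, ∃ y ∈ (Q₁'.X i).deg a, p'.map i y = x)
    {f : Hom Q Q'} (hf : (ε'.comp f).Homotopic ε) :
    ∃ f₁ : Hom Q₁ Q₁', (ε₁'.comp f₁).Homotopic ε₁ ∧
      ∀ i x, p'.map i (f₁.map i x) = f.map i (p.map i x) := by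
  -- An arbitrary lift g is compatible with the projections only up to a homotopy s. Since Q₁ is
  -- free and p' is surjective, s lifts to σ, and adding dσ + σd to g makes the square commute
  -- strictly.
  obtain ⟨g, hg⟩ := hε₁'.exists_lift hQ₁ hb₁ ε₁
  have h1 : (ε'.comp (f.comp p)).Homotopic (ε'.comp (p'.comp g)) :=
    (hf.comp_right p).trans (hp.trans ((hg.comp_left ι).symm.trans (hp'.comp_right g).symm))
  obtain ⟨s, hs, hsd⟩ := hε'.homotopic_of_comp hQ₁ hb₁ h1
  have hex : ∀ i j (h : j = i + 1), ∃ σ : Q₁.X i →ₗ[(Ext k n)ᵐᵒᵖ] Q₁'.X j,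
      (∀ a, ∀ x ∈ (Q₁.X i).deg a, σ x ∈ (Q₁'.X j).deg a) ∧ ∀ x, p'.map j (σ x) = s i j h x := by
    intro i j h
    obtain ⟨B⟩ := (hQ₁ i).hBasis
    exact B.exists_lift (Q₁'.X j).act_mem (p'.map j) (s i j h) fun a x hx =>
      hsurj j a _ (hs i j h a x hx)
  choose σ hσ hσp using hex
  obtain ⟨f₁, hf₁, hf₁'⟩ := exists_add_homotopy g σ hσ
  refine ⟨f₁, (hf₁.comp_left ε₁').trans hg, fun i x => ?_⟩
  have h2 : f.map i (p.map i x) - p'.map i (g.map i x) = _ := hsd i x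
  rw [hf₁', map_add, map_add, p'.comm, hσp, hσp, ← h2, add_sub_cancel]

/-! ### Gluing along lower quadrants -/

section Glue

variable {C C' : Cpx k n} {c : ℕ → Deg t}

/-- A nonzero monomial lowers degrees by at most n_i + 1 in the i-th coordinate, so the generators
in `upperSet` contribute nothing in degrees below c. Thus each multidegree of the complex embeds in
every sufficiently large lower quadrant. -/
theorem eq_zero_of_mem_span_upperSet {c : Deg t} {j : ℤ} {a : Deg t} (ha : ∀ i, a i < c i)
    {x : C.X j} (hx : x ∈ (C.X j).deg a)
    (h : x ∈ Submodule.span (Ext k n)ᵐᵒᵖ (C.upperSet c j)) : x = 0 := by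
  suffices H : proj (C.X j).internal a x = 0 by rwa [proj_self _ hx] at H
  clear hx
  have h' : x ∈ Submodule.span k {z : C.X j | ∃ l : List (Var n), ∃ y ∈ C.upperSet c j,
      z = op (mono k l) • y} := by
    induction h using Submodule.span_induction with
    | mem y hy => exact Submodule.subset_span ⟨[], y, hy, by rw [mono_nil, op_one, one_smul]⟩
    | zero => exact Submodule.zero_mem _
    | add x y _ _ hx hy => exact Submodule.add_mem _ hx hy
    | smul r x hx₀ hx =>
      clear hx₀
      rw [← op_unop r]
      generalize r.unop = r
      induction hx using Submodule.span_induction with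
      | mem z hz =>
        obtain ⟨l, y, hy, rfl⟩ := hz
        rw [smul_smul, ← op_mul]
        generalize mono k l * r = r
        induction r using mono_induction with
        | hm l => exact Submodule.subset_span ⟨l, y, hy, rfl⟩
        | h0 => rw [op_zero, zero_smul]; exact Submodule.zero_mem _
        | ha x y hx hy => rw [op_add, add_smul]; exact Submodule.add_mem _ hx hy
        | hs c x hx => rw [op_smul, smul_assoc]; exact Submodule.smul_mem _ _ hx
      | zero => rw [smul_zero]; exact Submodule.zero_mem _
      | add x y _ _ hx hy => rw [smul_add]; exact Submodule.add_mem _ hx hy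
      | smul c x _ hx =>
        rw [← algebraMap_smul (Ext k n)ᵐᵒᵖ c x, smul_smul, ← Algebra.commutes, ← smul_smul,
          algebraMap_smul]
        exact Submodule.smul_mem _ _ hx
  clear h
  induction h' using Submodule.span_induction with
  | mem z hz =>
    obtain ⟨l, y, ⟨a', hy, i, hi⟩, rfl⟩ := hz
    by_cases h0 : mono k l = 0
    · rw [h0, op_zero, zero_smul, map_zero]
    · refine proj_ne _ ((C.X j).mono_smul_mem l hy) fun h => ?_
      have h1 := list_sum_varDeg_le_topDeg (nodup_of_mono_ne_zero h0) i
      have h2 := ha i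
      rw [← h, Pi.sub_apply] at h2
      change _ ≤ (n i : ℤ) + 1 at h1
      omega
  | zero => exact map_zero _
  | add x y _ _ hx hy => rw [map_add, hx, hy, add_zero]
  | smul r x _ hx => rw [map_smul, hx, smul_zero]

theorem eq_zero_of_forall_lowerMk (hc : ∀ a : Deg t, ∃ m, ∀ i, a i < c m i) {j : ℤ} {x : C.X j}
    (hx : ∀ m, C.lowerMk (c m) j x = 0) : x = 0 := by
  refine eq_of_proj_eq (C.X j).internal fun a => ?_
  rw [map_zero]
  obtain ⟨m, hm⟩ := hc a
  exact eq_zero_of_mem_span_upperSet hm (proj_mem _ _ _)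
    ((C.X j).span_homogeneous _ (fun _ hx => ⟨hx.choose, hx.choose_spec.1⟩) a x
      (C.lowerMk_eq_zero.mp (hx m)))

/-- A compatible family of maps between lower quadrants comes from a map. -/
theorem exists_glue (hc : ∀ a : Deg t, ∃ m, ∀ i, a i < c m i) (hmono : Monotone c) {j : ℤ}
    (hC : (C.X j).IsFree)
    (f : ∀ m, (C.lower (c m)).X j →ₗ[(Ext k n)ᵐᵒᵖ] (C'.lower (c m)).X j)
    (hf : ∀ m a, ∀ x ∈ ((C.lower (c m)).X j).deg a, f m x ∈ ((C'.lower (c m)).X j).deg a)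
    (hfc : ∀ m x, (C'.lowerProj (hmono m.le_succ)).map j (f (m + 1) x) =
      f m ((C.lowerProj (hmono m.le_succ)).map j x)) :
    ∃ F : C.X j →ₗ[(Ext k n)ᵐᵒᵖ] C'.X j, (∀ a, ∀ x ∈ (C.X j).deg a, F x ∈ (C'.X j).deg a) ∧
      ∀ m x, C'.lowerMk (c m) j (F x) = f m (C.lowerMk (c m) j x) := by
  have hcomp : ∀ m r (h : m ≤ r) x, (C'.lowerProj (hmono h)).map j (f r (C.lowerMk (c r) j x)) =
      f m (C.lowerMk (c m) j x) := by
    intro m r h x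
    induction r, h using Nat.le_induction with
    | base =>
      obtain ⟨y, hy⟩ := C'.lowerMk_surjective (c m) j (f m (C.lowerMk (c m) j x))
      rw [← hy, lowerProj_lowerMk]
    | succ r h ih =>
      rw [← ih, ← C.lowerProj_lowerMk (hmono r.le_succ), ← hfc]
      obtain ⟨y, hy⟩ := C'.lowerMk_surjective (c (r + 1)) j (f (r + 1) (C.lowerMk (c (r + 1)) j x))
      rw [← hy, lowerProj_lowerMk, lowerProj_lowerMk, lowerProj_lowerMk]
  obtain ⟨B⟩ := hC.hBasis
  obtain ⟨F, hF, hF'⟩ := B.exists_lift (C'.X j).act_mem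
    (LinearMap.pi fun m => C'.lowerMk (c m) j)
    (LinearMap.pi fun m => f m ∘ₗ C.lowerMk (c m) j) (by
      intro a x hx
      -- At a level M beyond a, projection is injective in degree a, so a homogeneous representative
      -- of the value at level M is correct at all higher levels as well; lower levels follow by
      -- projecting.
      obtain ⟨M, hM⟩ := hc a
      obtain ⟨y, hy, hyx⟩ := hf M a _ (C.lowerMk_mem (c M) j a x hx)
      replace hyx : C'.lowerMk (c M) j y = f M (C.lowerMk (c M) j x) := hyx
      refine ⟨y, hy, funext fun m => ?_⟩
      change C'.lowerMk (c m) j y = f m (C.lowerMk (c m) j x)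
      rcases le_total m M with h | h
      · rw [← hcomp m M h, ← hyx, lowerProj_lowerMk]
      · obtain ⟨z, hz, hzx⟩ := hf m a _ (C.lowerMk_mem (c m) j a x hx)
        replace hzx : C'.lowerMk (c m) j z = f m (C.lowerMk (c m) j x) := hzx
        have h1 := hcomp M m h x
        rw [← hzx, ← hyx, lowerProj_lowerMk, ← sub_eq_zero, ← map_sub, lowerMk_eq_zero] at h1
        rw [← hzx, ← sub_eq_zero.mp (eq_zero_of_mem_span_upperSet hM
          (Submodule.sub_mem _ hz hy) h1)])
  exact ⟨F, hF, fun m x => congrFun (hF' x) m⟩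

/-- The inverses of the given maps are again homogeneous and compatible, so they glue too; the two
glued maps are inverse to each other because this can be tested in the lower quadrants. -/
theorem exists_glue_bijective (hc : ∀ a : Deg t, ∃ m, ∀ i, a i < c m i) (hmono : Monotone c)
    {j : ℤ} (hC : (C.X j).IsFree) (hC' : (C'.X j).IsFree)
    (f : ∀ m, (C.lower (c m)).X j →ₗ[(Ext k n)ᵐᵒᵖ] (C'.lower (c m)).X j)
    (hf : ∀ m a, ∀ x ∈ ((C.lower (c m)).X j).deg a, f m x ∈ ((C'.lower (c m)).X j).deg a)
    (hfc : ∀ m x, (C'.lowerProj (hmono m.le_succ)).map j (f (m + 1) x) =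
      f m ((C.lowerProj (hmono m.le_succ)).map j x)) (hbij : ∀ m, Function.Bijective (f m)) :
    ∃ F : C.X j →ₗ[(Ext k n)ᵐᵒᵖ] C'.X j, (∀ a, ∀ x ∈ (C.X j).deg a, F x ∈ (C'.X j).deg a) ∧
      (∀ m x, C'.lowerMk (c m) j (F x) = f m (C.lowerMk (c m) j x)) ∧ Function.Bijective F := by
  obtain ⟨F, hF, hF'⟩ := exists_glue hc hmono hC f hf hfc
  let g := fun m => LinearEquiv.ofBijective (f m) (hbij m)
  have hfg : ∀ m y, f m ((g m).symm y) = y := fun m y => (g m).apply_symm_apply y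
  have hgf : ∀ m x, (g m).symm (f m x) = x := fun m x => (g m).symm_apply_apply x
  obtain ⟨G, -, hG'⟩ := exists_glue hc hmono hC' (fun m => (g m).symm.toLinearMap) (by
      intro m a y hy
      change (g m).symm y ∈ _
      rw [mem_deg_iff ((C.lower (c m)).X j).internal]
      intro a' ha
      apply (hbij m).1
      have h1 := proj_comm ((C.lower (c m)).X j).internal ((C'.lower (c m)).X j).internal
        ((f m).restrictScalars k) id Function.injective_id (hf m) a' ((g m).symm y)
      rw [map_zero]
      refine h1.symm.trans ?_
      rw [LinearMap.restrictScalars_apply, hfg]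
      exact proj_ne _ hy ha.symm)
    (by
      intro m y
      apply (hbij m).1
      change f m ((C.lowerProj _).map j ((g (m + 1)).symm y)) = f m ((g m).symm _)
      rw [← hfc, hfg, hfg])
  refine ⟨F, hF, hF', (injective_iff_map_eq_zero F).mpr fun x hx => ?_, fun y => ⟨G y, ?_⟩⟩
  · refine eq_zero_of_forall_lowerMk hc fun m => (hbij m).1 ?_
    rw [← hF', hx, map_zero, map_zero]
  · rw [← sub_eq_zero]
    refine eq_zero_of_forall_lowerMk hc fun m => ?_
    rw [map_sub, hF', hG']
    exact sub_eq_zero.mpr (hfg m _)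

end Glue

/-! ### Foldings and shifts of isomorphisms of complexes -/

/-- Isomorphic complexes have isomorphic foldings. -/
theorem fold_iso {C C' : Cpx k n} (f : Hom C C') (hf : ∀ i, Function.Bijective (f.map i)) :
    DMod.Iso C.fold C'.fold := by
  let φ : (⨁ j, C.X j) →ₗ[(Ext k n)ᵐᵒᵖ] ⨁ j, C'.X j := DirectSum.lmap f.map
  have hφ : ∀ j x, φ (DirectSum.of (fun j => C.X j) j x) =
      DirectSum.of (fun j => C'.X j) j (f.map j x) := fun j x => DirectSum.lmap_lof f.map j x
  refine DMod.iso_of_bijective (D := C.fold) (D' := C'.fold) ⟨φ, ?_, fun x => ?_⟩ ⟨?_, ?_⟩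
  · rintro ⟨a, b⟩ _ ⟨x, hx, rfl⟩
    exact ⟨f.map _ x, f.map_mem _ a x hx, (hφ _ x).symm⟩
  · change φ (C.foldDiff x) = C'.foldDiff (φ x)
    induction x using DirectSum.induction_on with
    | zero => simp only [map_zero]
    | add x y hx hy => simp only [map_add, hx, hy]
    | of j x => rw [foldDiff_of, hφ, hφ, foldDiff_of, f.comm]
  · exact (DirectSum.lmap_injective f.map).mpr fun i => (hf i).1
  · exact (DirectSum.lmap_surjective f.map).mpr fun i => (hf i).2

/-- Every index has the form j + s. Heterogeneous equality expresses that the component there is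
that of `f`, without transporting along i = i - s + s. -/
theorem exists_unshift {C C' : Cpx k n} {s : ℤ} (f : Hom (C.shift s) (C'.shift s))
    (hf : ∀ i, Function.Bijective (f.map i)) : ∃ g : Hom C C', ∀ i, Function.Bijective (g.map i) := by
  have hex : ∀ i, ∃ g : C.X i →ₗ[(Ext k n)ᵐᵒᵖ] C'.X i, ∀ j, i = j + s → HEq g (f.map j) := by
    intro i
    obtain ⟨j, rfl⟩ : ∃ j, i = j + s := ⟨i - s, by ring⟩
    refine ⟨f.map j, fun j' h => ?_⟩
    obtain rfl : j = j' := by omega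
    rfl
  choose g hg using hex
  have hg' : ∀ j, g (j + s) = f.map j := fun j => eq_of_heq (hg (j + s) j rfl)
  refine ⟨⟨g, fun i a x hx => ?_, fun i j h x => ?_⟩, fun i => ?_⟩
  · obtain ⟨j, rfl⟩ : ∃ j, i = j + s := ⟨i - s, by ring⟩
    rw [hg']
    exact f.map_mem j a x hx
  · obtain ⟨j, rfl⟩ : ∃ l, j = l + s := ⟨j - s, by ring⟩
    obtain ⟨i, rfl⟩ : ∃ l, i = l + s := ⟨i - s, by ring⟩
    rw [hg', hg']
    exact f.comm i j (by omega) x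
  · obtain ⟨j, rfl⟩ : ∃ j, i = j + s := ⟨i - s, by ring⟩
    have h : Function.Bijective (g (j + s)) := by
      rw [hg']
      exact hf j
    exact h

end Cpx

/-- Tate resolutions are unique up to isomorphism of complexes. -/
theorem IsEESTate.exists_bijective {k : Type u} [Field k] {t : ℕ} {n : Fin t → ℕ} {C C' : Cpx k n}
    {P : GrSMod k n} (hC : IsEESTate C P) (hC' : IsEESTate C' P) :
    ∃ f : Cpx.Hom C C', ∀ i, Function.Bijective (f.map i) := by
  obtain ⟨hF, -, c₀, ε, hε, hεp⟩ := hC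
  obtain ⟨hF', -, c₀', ε', hε', hεp'⟩ := hC'
  -- A cofinal diagonal sequence beyond the bounds of both resolutions; a chain is needed so that
  -- the compatible lifts can be chosen recursively.
  let c : ℕ → Deg t := fun m => c₀ ⊔ c₀' + fun _ => (m : ℤ)
  have hmono : Monotone c := fun m r h => add_le_add_right (fun _ => Int.ofNat_le.mpr h) _
  have h₀ : ∀ m, c₀ ⊔ c₀' ≤ c m := fun m =>
    le_add_of_nonneg_right fun _ => Int.natCast_nonneg m
  have hle : ∀ m, c₀ ≤ c m := fun m => le_sup_left.trans (h₀ m)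
  have hle' : ∀ m, c₀' ≤ c m := fun m => le_sup_right.trans (h₀ m)
  have hcof : ∀ a : Deg t, ∃ m, ∀ i, a i < c m i := by
    intro a
    refine ⟨∑ i, (a i - (c₀ ⊔ c₀') i + 1).toNat, fun i => ?_⟩
    have h1 : (a i - (c₀ ⊔ c₀') i + 1).toNat ≤ ∑ i, (a i - (c₀ ⊔ c₀') i + 1).toNat :=
      Finset.single_le_sum (f := fun i => (a i - (c₀ ⊔ c₀') i + 1).toNat)
        (fun _ _ => Nat.zero_le _) (Finset.mem_univ i)
    change a i < (c₀ ⊔ c₀') i + ((∑ i, (a i - (c₀ ⊔ c₀') i + 1).toNat : ℕ) : ℤ)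
    omega
  obtain ⟨f₀, hf₀⟩ := (hε' _ (hle' 0)).2.2.2.exists_lift (hε _ (hle 0)).1 (hε _ (hle 0)).2.2.1
    (ε (c 0))
  -- The recursion carries along that f lifts the identity of R(P_{≥c}) up to homotopy, which is
  -- what both the next lift and bijectivity need.
  have step : ∀ m (f : {f : Cpx.Hom ((C.lower (c m)).shift t) ((C'.lower (c m)).shift t) //
      ((ε' (c m)).comp f).Homotopic (ε (c m))}),
      ∃ f₁ : {f : Cpx.Hom ((C.lower (c (m + 1))).shift t) ((C'.lower (c (m + 1))).shift t) //
        ((ε' (c (m + 1))).comp f).Homotopic (ε (c (m + 1)))},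
        ∀ i x, ((C'.lowerProj (hmono m.le_succ)).shift t).map i (f₁.1.map i x) =
          f.1.map i (((C.lowerProj (hmono m.le_succ)).shift t).map i x) := by
    rintro m ⟨f, hf⟩
    obtain ⟨f₁, hf₁, h⟩ := Cpx.exists_compatible_lift (hε _ (hle (m + 1))).1
      (hε _ (hle (m + 1))).2.2.1 (hε' _ (hle' m)).2.2.2 (hε' _ (hle' (m + 1))).2.2.2
      (hεp _ _ (hmono m.le_succ) (hle m)) (hεp' _ _ (hmono m.le_succ) (hle' m)) (by
        rintro i a _ ⟨y, hy, rfl⟩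
        exact ⟨C'.lowerMk (c (m + 1)) (i + t) y, C'.lowerMk_mem _ _ a y hy, rfl⟩) hf
    exact ⟨⟨f₁, hf₁⟩, h⟩
  choose next hnext using step
  let f : ∀ m, {f : Cpx.Hom ((C.lower (c m)).shift t) ((C'.lower (c m)).shift t) //
      ((ε' (c m)).comp f).Homotopic (ε (c m))} := fun m => Nat.rec ⟨f₀, hf₀⟩ next m
  have hfs : ∀ m i x, ((C'.lowerProj (hmono m.le_succ)).shift t).map i ((f (m + 1)).1.map i x) =
      (f m).1.map i (((C.lowerProj (hmono m.le_succ)).shift t).map i x) :=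
    fun m => hnext m (f m)
  have hbij : ∀ m i, Function.Bijective ((f m).1.map i) := fun m i =>
    (hε _ (hle m)).bijective (hε' _ (hle' m)) (f m).2 i
  choose F hFmem hFmk hFbij using fun j : ℤ => Cpx.exists_glue_bijective (C := C) (C' := C')
    (j := j + t) hcof hmono (hF _) (hF' _) (fun m => (f m).1.map j)
    (fun m a x hx => (f m).1.map_mem j a x hx) (fun m x => hfs m j x) (fun m => hbij m j)
  refine Cpx.exists_unshift (s := t) ⟨F, hFmem, fun i j h x => ?_⟩ hFbij
  refine sub_eq_zero.mp (Cpx.eq_zero_of_forall_lowerMk (C := C') hcof fun m => ?_)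
  have h1 : C'.lowerMk (c m) (j + t) (F j (C.d (i + t) (j + t) (by omega) x)) =
      (f m).1.map j (C.lowerMk (c m) (j + t) (C.d (i + t) (j + t) (by omega) x)) := hFmk j m _
  have h2 : (C'.lower (c m)).d (i + t) (j + t) (by omega) (C'.lowerMk (c m) (i + t) (F i x)) =
      (C'.lower (c m)).d (i + t) (j + t) (by omega)
        ((f m).1.map i (C.lowerMk (c m) (i + t) x)) := congrArg _ (hFmk i m x)
  refine (map_sub (C'.lowerMk (c m) (j + t)) _ _).trans (sub_eq_zero.mpr (h1.trans ?_))
  exact ((f m).1.comm i j h (C.lowerMk (c m) (i + t) x)).trans h2.symm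

end ToricTate

open ToricTate in
theorem theorem3p6 {k : Type u} [Field k] {t : ℕ} (ht : 0 < t) (n : Fin t → ℕ)
    (hn : ∀ i, 1 ≤ n i) (P : GrSMod k n) (hP : Module.Finite (Cox k n) P)
    (T : DMod k n) (hT : IsToricTate T P) :
    (∃ C : Cpx k n, IsEESTate C P) ∧
    (∀ C : Cpx k n, IsEESTate C P → DMod.Iso T C.fold) ∧
    (∀ T' : DMod k n, IsToricTate T' P → DMod.Iso T T') := by
  obtain ⟨B⟩ := hT.1.1.hBasis
  have hB := DMod.unfold_isEESTate B hP hT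
  have hfold : ∀ C : Cpx k n, IsEESTate C P → DMod.Iso T C.fold := fun C hC => by
    obtain ⟨f, hf⟩ := hB.exists_bijective hC
    exact (DMod.iso_fold_unfold B).trans (Cpx.fold_iso f hf)
  refine ⟨⟨_, hB⟩, hfold, fun T' hT' => ?_⟩
  obtain ⟨B'⟩ := hT'.1.1.hBasis
  exact (hfold _ (DMod.unfold_isEESTate B' hP hT')).trans (DMod.iso_fold_unfold B').symm
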